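/- Let $n\ge 2$, $N\ge 1$, $m\ge 1$ be integers, $\Omega\subset\mathbb R^n$ a bounded domain, $O\subset\Omega$ open, $1<\gamma_1\le\gamma_2<\infty$, $L\ge 1$, $0<\mu\le 1$. Put $\mathcal M=N\sum_{k=0}^{m-1}\binom{n+k-1}{k}$ and $\mathcal N=N\binom{n+m-1}{m}$. For $\mathbb R^N$-valued $w$ write $D^kw=(D^\alpha w_i)_{|\alpha|=k,\,1\le i\le N}$ for the weak derivatives of order $k$, and $\delta w=(w,Dw,\dots,D^{m-1}w)$, so that $\delta w(x)\in\mathbb R^{\mathcal M}$ and $D^mw(x)\in\mathbb R^{\mathcal N}$; $|\cdot|$ is the Euclidean norm. Let $\omega_1:(0,\infty)\to(0,\infty)$ be non-decreasing, concave and continuous with $\lim_{R\downarrow 0}\omega_1(R)=0$ and $\omega_1(R)\log\frac1R\le L$ for all $R\in(0,1]$, and let $p:\Omega\to(1,\infty)$ satisfy $\gamma_1\le p(x)\le\gamma_2$ for all $x\in\Omega$ and $|p(x)-p(y)|\le\omega_1(|x-y|)$ for all distinct $x,y\in\Omega$. Let $f:O\times\mathbb R^{\mathcal M}\times\mathbb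 R^{\mathcal N}\to\mathbb R$ be a Carathéodory function (measurable in $x$ for all $(\xi,z)$, continuous in $(\xi,z)$ for almost every $x$) such that for all $x,x'\in O$ with $x\ne x'$, all $\xi\in\mathbb R^{\mathcal M}$ and all $z\in\mathbb R^{\mathcal N}$ $$L^{-1}(\mu^2+|z|^2)^{p(x)/2}\le f(x,\xi,z)\le L(\mu^2+|z|^2)^{p(x)/2},$$ $$|f(x,\xi,z)-f(x',\xi,z)|\le L\,\omega_1(|x-x'|)\Bigl((\mu^2+|z|^2)^{p(x)/2}+(\mu^2+|z|^2)^{p(x')/2}\Bigr)\bigl(1+|\log(\mu^2+|z|^2)|\bigr).$$ Let $u\in W^{m,1}_{loc}(O;\mathbb R^N)$ be a local minimizer of $w\mapsto\int_O f(x,\delta w,D^mw)\,dx$, that is, $|D^mu|^{p(\cdot)}\in L^1_{loc}(O)$ and $$\int_{\operatorname{spt}\varphi}f(x,\delta u,D^mu)\,dx\le\int_{\operatorname{spt}\varphi}f(x,\delta u+\delta\varphi,D^mu+D^m\varphi)\,dx$$ for all $\varphi\in W^{m,1}_0(O;\mathbb R^N)$ (the closure of $C_c^\infty(O;\mathbb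 R^N)$ in $W^{m,1}(O;\mathbb R^N)$) with $|D^m\varphi|^{p(\cdot)}\in L^1_{loc}(O)$ and $\operatorname{spt}\varphi\Subset O$. Assume moreover that $$\int_O|D^mu|^{p(x)}\,dx\le M<\infty .$$ Then there exist $\delta,c>0$ depending only on $n,\gamma_1,\gamma_2,L,M,m$ and a radius $R_0>0$ depending only on $n,\gamma_1,\omega_1(\cdot)$ such that for every ball $B_R\Subset O$ with $R\le R_0$ (and concentric ball $B_{R/2}$) the function $|D^mu|^{p(x)(1+\delta)}$ is integrable on $B_{R/2}$ and $$\Bigl(\frac1{|B_{R/2}|}\int_{B_{R/2}}|D^mu|^{p(x)(1+\delta)}\,dx\Bigr)^{\frac1{1+\delta}}\le c\,\Bigl(\frac1{|B_R|}\int_{B_R}|D^mu|^{p(x)}\,dx+1\Bigr),$$ where $|B|$ denotes the Lebesgue measure of $B$. -/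

import Mathlib

open MeasureTheory Set Filter Topology
open scoped ENNReal ContDiff

noncomputable section

namespace HigherOrder

/-- The Euclidean space `ℝⁿ`. -/
abbrev Sp (n : ℕ) : Type := EuclideanSpace ℝ (Fin n)

/-- Multi-indices `α ∈ ℕⁿ` of length `|α| = α₁ + ⋯ + αₙ = k`. -/
abbrev MultiIndex (n k : ℕ) : Type :=
  {α : Fin n → ℕ // α ∈ Finset.piAntidiag (Finset.univ : Finset (Fin n)) k}

/-- The space of the values of `D^m u = (D^α u_i)`, `|α| = m`, `1 ≤ i ≤ N`, i.e.
`ℝ^{N·binom(n+m-1, m)}` with its Euclidean norm. -/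
abbrev TopJet (n N m : ℕ) : Type := EuclideanSpace ℝ (MultiIndex n m × Fin N)

/-- The space of the values of `δu = (u, Du, …, D^{m-1} u)`, i.e.
`ℝ^{N·∑_{k<m} binom(n+k-1, k)}` with its Euclidean norm. -/
abbrev LowJet (n N m : ℕ) : Type :=
  EuclideanSpace ℝ ((Σ k : Fin m, MultiIndex n (k : ℕ)) × Fin N)

/-- The classical partial derivative `D_i g`. -/
def partialD {n : ℕ} {F : Type*} [NormedAddCommGroup F] [NormedSpace ℝ F]
    (i : Fin n) (g : Sp n → F) : Sp n → F :=
  fun x => fderiv ℝ g x (EuclideanSpace.single i 1)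

/-- The classical derivative `D^α g = D_1^{α_1} ⋯ D_n^{α_n} g`. -/
def multiD {n : ℕ} {F : Type*} [NormedAddCommGroup F] [NormedSpace ℝ F]
    (α : Fin n → ℕ) (g : Sp n → F) : Sp n → F :=
  (List.finRange n).foldr (fun i h => (partialD i)^[α i] h) g

/-- `ψ ∈ C_c^∞(O; F)`. -/
structure IsTest {n : ℕ} {F : Type*} [NormedAddCommGroup F] [NormedSpace ℝ F]
    (O : Set (Sp n)) (ψ : Sp n → F) : Prop where
  smooth : ContDiff ℝ ∞ ψ
  compact : HasCompactSupport ψ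
  support : tsupport ψ ⊆ O

/-- `v ∈ L¹_loc(O)` is the weak derivative of order `α` of `u ∈ L¹_loc(O)` in the open set `O`. -/
structure IsWeakDeriv {n N : ℕ} (O : Set (Sp n)) (α : Fin n → ℕ) (u v : Sp n → Sp N) : Prop where
  locInt : LocallyIntegrableOn u O
  locInt_deriv : LocallyIntegrableOn v O
  integral_eq : ∀ ψ : Sp n → ℝ, IsTest O ψ →
    ∫ x in O, multiD α ψ x • u x = (-1 : ℝ) ^ (∑ i, α i) • ∫ x in O, ψ x • v x

open Classical in
/-- A representative of the weak derivative `D^α u` in `O` (unique up to null sets);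
by convention `0` if there is none. -/
def weakD {n N : ℕ} (O : Set (Sp n)) (α : Fin n → ℕ) (u : Sp n → Sp N) : Sp n → Sp N :=
  if h : ∃ v, IsWeakDeriv O α u v then h.choose else 0

/-- `D^m u`, in the weak sense in `O`. -/
def topJet {n N : ℕ} (O : Set (Sp n)) (m : ℕ) (u : Sp n → Sp N) (x : Sp n) : TopJet n N m :=
  WithLp.toLp 2 fun a => weakD O a.1.1 u x a.2

/-- `δu = (u, Du, …, D^{m-1} u)`, in the weak sense in `O`. -/
def lowJet {n N : ℕ} (O : Set (Sp n)) (m : ℕ) (u : Sp n → Sp N) (x : Sp n) : LowJet n N m :=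
  WithLp.toLp 2 fun a => weakD O a.1.2.1 u x a.2

/-- `u ∈ W^{m,1}_loc(O; ℝᴺ)`. -/
def MemSobolevLoc {n N : ℕ} (O : Set (Sp n)) (m : ℕ) (u : Sp n → Sp N) : Prop :=
  ∀ α : Fin n → ℕ, ∑ i, α i ≤ m → ∃ v, IsWeakDeriv O α u v

/-- `u ∈ W^{m,1}(O; ℝᴺ)`. -/
def MemSobolev {n N : ℕ} (O : Set (Sp n)) (m : ℕ) (u : Sp n → Sp N) : Prop :=
  IntegrableOn u O ∧
    ∀ α : Fin n → ℕ, ∑ i, α i ≤ m → ∃ v, IsWeakDeriv O α u v ∧ IntegrableOn v O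

/-- `u ∈ W^{m,1}_0(O; ℝᴺ)`, the closure of `C_c^∞(O; ℝᴺ)` in `W^{m,1}(O; ℝᴺ)`. -/
def MemSobolevZero {n N : ℕ} (O : Set (Sp n)) (m : ℕ) (u : Sp n → Sp N) : Prop :=
  MemSobolev O m u ∧ ∃ ψ : ℕ → Sp n → Sp N, (∀ j, IsTest O (ψ j)) ∧
    ∀ α : Fin n → ℕ, ∑ i, α i ≤ m →
      Tendsto (fun j => ∫ x in O, ‖multiD α (ψ j) x - weakD O α u x‖) atTop (𝓝 0)

/-- The support `spt φ` (relative to `O`) of an a.e. class of functions on `O`: the points of `O`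
without a neighbourhood on which `φ = 0` almost everywhere. -/
def spt {n N : ℕ} (O : Set (Sp n)) (φ : Sp n → Sp N) : Set (Sp n) :=
  {x ∈ O | ∀ U ∈ 𝓝 x, ¬ ∀ᵐ y ∂(volume.restrict (U ∩ O)), φ y = 0}

/-- `f : O × ℝ^𝓜 × ℝ^𝓝 → ℝ` is a Carathéodory function. -/
structure IsCaratheodoryFun {n N m : ℕ} (O : Set (Sp n))
    (f : Sp n → LowJet n N m → TopJet n N m → ℝ) : Prop where
  measurable : ∀ ξ z, AEMeasurable (fun x => f x ξ z) (volume.restrict O)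
  continuous : ∀ᵐ x ∂(volume.restrict O),
    Continuous fun q : LowJet n N m × TopJet n N m => f x q.1 q.2

/-- Growth condition with exponent `p(x)`. -/
def HasGrowth {n N m : ℕ} (O : Set (Sp n)) (p : Sp n → ℝ) (μ L : ℝ)
    (f : Sp n → LowJet n N m → TopJet n N m → ℝ) : Prop :=
  ∀ x ∈ O, ∀ ξ z,
    L⁻¹ * (μ ^ 2 + ‖z‖ ^ 2) ^ (p x / 2) ≤ f x ξ z ∧
      f x ξ z ≤ L * (μ ^ 2 + ‖z‖ ^ 2) ^ (p x / 2)

/-- Continuity condition in the first variable; it is empty for `x = x'`, where `ω₁ 0` would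
otherwise enter, the modulus being a function on `(0, ∞)`. -/
def HasXContinuity {n N m : ℕ} (O : Set (Sp n)) (p : Sp n → ℝ) (ω₁ : ℝ → ℝ) (μ L : ℝ)
    (f : Sp n → LowJet n N m → TopJet n N m → ℝ) : Prop :=
  ∀ x ∈ O, ∀ x' ∈ O, x ≠ x' → ∀ ξ z,
    |f x ξ z - f x' ξ z| ≤
      L * ω₁ ‖x - x'‖ *
        ((μ ^ 2 + ‖z‖ ^ 2) ^ (p x / 2) + (μ ^ 2 + ‖z‖ ^ 2) ^ (p x' / 2)) *
        (1 + |Real.log (μ ^ 2 + ‖z‖ ^ 2)|)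

/-- A modulus of continuity `ω₁ : (0, ∞) → (0, ∞)`; the values outside `(0, ∞)` are irrelevant. -/
structure IsModulus (ω₁ : ℝ → ℝ) : Prop where
  pos : ∀ R, 0 < R → 0 < ω₁ R
  mono : MonotoneOn ω₁ (Ioi 0)
  concave : ConcaveOn ℝ (Ioi 0) ω₁
  continuous : ContinuousOn ω₁ (Ioi 0)
  tendsto : Tendsto ω₁ (𝓝[>] 0) (𝓝 0)

/-- `u ∈ W^{m,1}_loc(O; ℝᴺ)` is a local minimizer of `w ↦ ∫_O f(x, δw, D^m w) dx`. -/
structure IsLocalMinimizer {n N m : ℕ} (O : Set (Sp n)) (p : Sp n → ℝ)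
    (f : Sp n → LowJet n N m → TopJet n N m → ℝ) (u : Sp n → Sp N) : Prop where
  memSobolev : MemSobolevLoc O m u
  locInt : LocallyIntegrableOn (fun x => ‖topJet O m u x‖ ^ p x) O
  minimal : ∀ φ : Sp n → Sp N, MemSobolevZero O m φ →
    LocallyIntegrableOn (fun x => ‖topJet O m φ x‖ ^ p x) O →
    IsCompact (spt O φ) →
    ∫ x in spt O φ, f x (lowJet O m u x) (topJet O m u x) ≤
      ∫ x in spt O φ, f x (lowJet O m u x + lowJet O m φ x) (topJet O m u x + topJet O m φ x)

end HigherOrder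

end

open HigherOrder

/-!
The proof establishes a reverse Hölder inequality for `F = |D^m u|^{p(x)}` and applies Gehring's
lemma.

The growth condition alone makes `u` a quasi-minimizer of `∫ F`
(`IsLocalMinimizer.lintegral_topJet_le`). Testing with `-η (u - P)`, where `η` is a cutoff
function and `P` a polynomial of degree less than `m`, and filling the hole gives Caccioppoli's
inequality (`exists_caccioppoli`): on concentric balls of radii `ρ` and `2ρ`, the integral of `F`
over the smaller one is controlled by that of `1 + (∑_{j<m} ρ^{j-m} |D^j (u - P)|)^{p(x)}` over
the larger one. The Leibniz rule for weak derivatives of higher order that this requires is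
`exists_isWeakDeriv_smul`, and the competitor lies in `W^{m,1}_0` by mollification
(`memSobolevZero_of_compact`).

If `P` is chosen such that all derivatives of `u - P` of order less than `m` have mean value zero
(`exists_polynomial_mean`), the Sobolev–Poincaré inequality (`exists_jet_sobolev_poincare`), a
consequence of the pointwise bound by a Riesz potential, applies with exponents `q = s p₁` and
`qτ = p₂`, where `p₁ ≤ p ≤ p₂` on the ball. An `s < 1` close to `1` leaves room for the
oscillation of the exponent if the radius is small. Since `τ` exceeds `1/s` by a
multiple of `p₂ - p₁`, a surplus factor `(2 + M / |B|)^{C ω₁}` arises; it is bounded by the condition `ω₁(R) log (1/R) ≤ L`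
(`rpow_le_of_log_condition`). The result is `exists_reverse_holder`.

Gehring's lemma (`exists_gehring`) is proved on a single ball, with all dilations kept inside: a
stopping-time argument and Vitali's covering lemma give a level-set inequality
(`lintegral_superlevel_le`), the layer-cake formula turns it into a bound for a truncated higher
power on concentric balls (`lintegral_mul_rpow_le_of_level`), and the iteration lemma
(`exists_iteration_const`) absorbs the term on the larger ball.

The estimates are carried out with `[0, ∞]`-valued integrals and mean values, so that no
integrability has to be known in advance.
-/

namespace HigherOrder

/-! ### Classical partial derivatives -/

section Classical

variable {n : ℕ} {F : Type*} [NormedAddCommGroup F] [NormedSpace ℝ F]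

/-- The multi-index `e_i`. -/
abbrev unitIdx {n : ℕ} (i : Fin n) : Fin n → ℕ := Pi.single i 1

lemma sum_add_unitIdx (α : Fin n → ℕ) (i : Fin n) : ∑ j, (α + unitIdx i) j = ∑ j, α j + 1 := by
  simp [Finset.sum_add_distrib]

lemma sum_unitIdx (i : Fin n) : ∑ j, unitIdx i j = 1 := by simp

lemma exists_eq_add_unitIdx {α : Fin n → ℕ} {k : ℕ} (h : ∑ j, α j = k + 1) :
    ∃ β i, α = β + unitIdx i ∧ ∑ j, β j = k := by
  have : ∃ i, α i ≠ 0 := by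
    by_contra! h0
    simp [h0] at h
  obtain ⟨i, hi⟩ := this
  have e : α = (α - unitIdx i) + unitIdx i := by
    funext j
    by_cases hj : j = i
    · subst hj; simp; omega
    · simp [hj]
  refine ⟨α - unitIdx i, i, e, ?_⟩
  rw [e, sum_add_unitIdx] at h
  omega

lemma eq_zero_of_sum_eq_zero {α : Fin n → ℕ} (h : ∑ j, α j = 0) : α = 0 := by
  funext j
  simpa using (Finset.sum_eq_zero_iff.1 h) j (Finset.mem_univ j)

/-- Induction on the order of a multi-index. -/
lemma multiIndex_induction {P : (Fin n → ℕ) → Prop} (h0 : P 0)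
    (hs : ∀ α i, P α → P (α + unitIdx i)) (α : Fin n → ℕ) : P α := by
  obtain ⟨k, hk⟩ : ∃ k, ∑ j, α j = k := ⟨_, rfl⟩
  induction k generalizing α with
  | zero => rw [eq_zero_of_sum_eq_zero hk]; exact h0
  | succ k ih =>
    obtain ⟨β, i, rfl, hβ⟩ := exists_eq_add_unitIdx hk
    exact hs _ _ (ih _ hβ)

lemma contDiff_partialD {g : Sp n → F} (hg : ContDiff ℝ ∞ g) (i : Fin n) :
    ContDiff ℝ ∞ (partialD i g) :=
  (hg.fderiv_right (m := ∞) (by simp)).clm_apply contDiff_const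

lemma contDiff_iterate_partialD {g : Sp n → F} (hg : ContDiff ℝ ∞ g) (i : Fin n) (k : ℕ) :
    ContDiff ℝ ∞ ((partialD i)^[k] g) := by
  induction k generalizing g with
  | zero => exact hg
  | succ k ih => exact ih (contDiff_partialD hg i)

lemma contDiff_foldr {g : Sp n → F} (hg : ContDiff ℝ ∞ g) (α : Fin n → ℕ) (l : List (Fin n)) :
    ContDiff ℝ ∞ (l.foldr (fun i h => (partialD i)^[α i] h) g) := by
  induction l with
  | nil => exact hg
  | cons j l ih => exact contDiff_iterate_partialD ih j _

lemma contDiff_multiD {g : Sp n → F} (hg : ContDiff ℝ ∞ g) (α : Fin n → ℕ) :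
    ContDiff ℝ ∞ (multiD α g) := contDiff_foldr hg α _

lemma partialD_comm {g : Sp n → F} (hg : ContDiff ℝ ∞ g) (i j : Fin n) :
    partialD i (partialD j g) = partialD j (partialD i g) := by
  have key : ∀ (i j : Fin n) x, partialD i (partialD j g) x =
      fderiv ℝ (fderiv ℝ g) x (EuclideanSpace.single i 1) (EuclideanSpace.single j 1) := by
    intro i j x
    have hd : DifferentiableAt ℝ (fderiv ℝ g) x :=
      ((hg.fderiv_right (m := ∞) (by simp)).differentiable (by simp)) x
    unfold partialD
    rw [fderiv_clm_apply hd (by fun_prop)]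
    simp
  funext x
  rw [key, key]
  exact (hg.contDiffAt.isSymmSndFDerivAt
    (by simpa using WithTop.coe_le_coe.2 (le_top : (2 : ℕ∞) ≤ ⊤))) _ _

lemma iterate_partialD_comm {g : Sp n → F} (hg : ContDiff ℝ ∞ g) (i j : Fin n) (k : ℕ) :
    partialD i ((partialD j)^[k] g) = (partialD j)^[k] (partialD i g) := by
  induction k generalizing g with
  | zero => rfl
  | succ k ih =>
    rw [Function.iterate_succ_apply, ih (contDiff_partialD hg j), partialD_comm hg i j]
    rfl

lemma foldr_partialD_comm {g : Sp n → F} (hg : ContDiff ℝ ∞ g) (α : Fin n → ℕ) (i : Fin n)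
    (l : List (Fin n)) :
    partialD i (l.foldr (fun i h => (partialD i)^[α i] h) g) =
      l.foldr (fun i h => (partialD i)^[α i] h) (partialD i g) := by
  induction l with
  | nil => rfl
  | cons j l ih =>
    simp only [List.foldr_cons]
    rw [iterate_partialD_comm (contDiff_foldr hg α l), ih]

lemma foldr_partialD_congr {g : Sp n → F} {α β : Fin n → ℕ} {l : List (Fin n)}
    (h : ∀ i ∈ l, α i = β i) :
    l.foldr (fun i h => (partialD i)^[α i] h) g = l.foldr (fun i h => (partialD i)^[β i] h) g := by
  induction l with
  | nil => rfl
  | cons j l ih =>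
    simp only [List.foldr_cons]
    rw [h j (by simp), ih fun i hi => h i (by simp [hi])]

lemma foldr_partialD_add_unitIdx {g : Sp n → F} (hg : ContDiff ℝ ∞ g) (α : Fin n → ℕ) (i : Fin n)
    {l : List (Fin n)} (hl : l.Nodup) (hi : i ∈ l) :
    l.foldr (fun j h => (partialD j)^[(α + unitIdx i) j] h) g =
      partialD i (l.foldr (fun j h => (partialD j)^[α j] h) g) := by
  induction l with
  | nil => simp at hi
  | cons j l ih =>
    simp only [List.foldr_cons]
    rw [List.nodup_cons] at hl
    by_cases hij : j = i
    · subst hij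
      have : (α + unitIdx j) j = α j + 1 := by simp
      rw [this, Function.iterate_succ_apply', foldr_partialD_congr (α := α + unitIdx j) (β := α)]
      intro k hk
      have : k ≠ j := fun h => hl.1 (h ▸ hk)
      simp [this]
    · have : (α + unitIdx i) j = α j := by simp [hij]
      rw [this, ih hl.2 (by simpa [Ne.symm hij] using hi), ← iterate_partialD_comm
        (contDiff_foldr hg α l)]

lemma multiD_zero (g : Sp n → F) : multiD 0 g = g := by
  unfold multiD
  induction List.finRange n with
  | nil => rfl
  | cons j l ih => simp

/-- For smooth functions the order of differentiation does not matter, so that the partial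
derivative `D_i` may be taken last or, as in `multiD_add_unitIdx'`, first. -/
lemma multiD_add_unitIdx {g : Sp n → F} (hg : ContDiff ℝ ∞ g) (α : Fin n → ℕ) (i : Fin n) :
    multiD (α + unitIdx i) g = partialD i (multiD α g) :=
  foldr_partialD_add_unitIdx hg α i (List.nodup_finRange n) (List.mem_finRange i)

lemma partialD_multiD {g : Sp n → F} (hg : ContDiff ℝ ∞ g) (α : Fin n → ℕ) (i : Fin n) :
    partialD i (multiD α g) = multiD α (partialD i g) := foldr_partialD_comm hg α i _

lemma multiD_add_unitIdx' {g : Sp n → F} (hg : ContDiff ℝ ∞ g) (α : Fin n → ℕ) (i : Fin n) :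
    multiD (α + unitIdx i) g = multiD α (partialD i g) := by
  rw [multiD_add_unitIdx hg, partialD_multiD hg]

lemma multiD_unitIdx {g : Sp n → F} (hg : ContDiff ℝ ∞ g) (i : Fin n) :
    multiD (unitIdx i) g = partialD i g := by
  rw [← zero_add (unitIdx i), multiD_add_unitIdx hg, multiD_zero]

lemma partialD_add {g h : Sp n → F} (hg : ContDiff ℝ ∞ g) (hh : ContDiff ℝ ∞ h) (i : Fin n) :
    partialD i (g + h) = partialD i g + partialD i h := by
  funext x
  simp only [partialD, Pi.add_apply]
  rw [fderiv_add (hg.differentiable (by simp) x) (hh.differentiable (by simp) x)]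
  rfl

lemma multiD_add_fun {g h : Sp n → F} (hg : ContDiff ℝ ∞ g) (hh : ContDiff ℝ ∞ h)
    (α : Fin n → ℕ) : multiD α (g + h) = multiD α g + multiD α h := by
  induction α using multiIndex_induction with
  | h0 => simp only [multiD_zero]
  | hs α i ih =>
    rw [multiD_add_unitIdx (show ContDiff ℝ ∞ (g + h) from hg.add hh), ih, multiD_add_unitIdx hg,
      multiD_add_unitIdx hh,
      partialD_add (contDiff_multiD hg α) (contDiff_multiD hh α)]

lemma partialD_smul {η : Sp n → ℝ} {g : Sp n → F} (hη : ContDiff ℝ ∞ η) (hg : ContDiff ℝ ∞ g)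
    (i : Fin n) (x : Sp n) :
    partialD i (fun y => η y • g y) x = partialD i η x • g x + η x • partialD i g x := by
  simp only [partialD]
  rw [fderiv_fun_smul (hη.differentiable (by simp) x) (hg.differentiable (by simp) x)]
  simp [add_comm]

lemma tsupport_partialD_subset (g : Sp n → F) (i : Fin n) :
    tsupport (partialD i g) ⊆ tsupport g :=
  (tsupport_fderiv_apply_subset ℝ (EuclideanSpace.single i 1) : _)

lemma IsTest.partialD {O : Set (Sp n)} {ψ : Sp n → F} (h : IsTest O ψ) (i : Fin n) :
    IsTest O (partialD i ψ) :=
  ⟨contDiff_partialD h.smooth i, h.compact.mono' (subset_tsupport _ |>.trans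
    (tsupport_partialD_subset ψ i)), (tsupport_partialD_subset ψ i).trans h.support⟩

lemma IsTest.multiD {O : Set (Sp n)} {ψ : Sp n → F} (h : IsTest O ψ) (α : Fin n → ℕ) :
    IsTest O (multiD α ψ) := by
  induction α using multiIndex_induction with
  | h0 => rwa [multiD_zero]
  | hs α i ih => rw [multiD_add_unitIdx h.smooth]; exact ih.partialD i

lemma multiD_congr_of_eventuallyEq {g h : Sp n → F} (hg : ContDiff ℝ ∞ g) (hh : ContDiff ℝ ∞ h)
    (α : Fin n → ℕ) {U : Set (Sp n)} (hU : IsOpen U) (e : ∀ x ∈ U, g x = h x) :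
    ∀ x ∈ U, multiD α g x = multiD α h x := by
  induction α using multiIndex_induction with
  | h0 => simpa only [multiD_zero]
  | hs α i ih =>
    intro x hx
    rw [multiD_add_unitIdx hg, multiD_add_unitIdx hh]
    have : multiD α g =ᶠ[𝓝 x] multiD α h := by
      filter_upwards [hU.mem_nhds hx] with y hy using ih y hy
    simp only [partialD]
    rw [this.fderiv_eq]

lemma IsTest.mono {O O' : Set (Sp n)} {ψ : Sp n → F} (h : IsTest O ψ) (hO : O ⊆ O') :
    IsTest O' ψ := ⟨h.smooth, h.compact, h.support.trans hO⟩

lemma IsTest.mul_left {O : Set (Sp n)} {ψ : Sp n → F} (h : IsTest O ψ) {η : Sp n → ℝ}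
    (hη : ContDiff ℝ ∞ η) : IsTest O (fun x => η x • ψ x) :=
  ⟨hη.smul h.smooth, h.compact.smul_left, (tsupport_smul_subset_right η ψ).trans h.support⟩

end Classical

/-! ### Weak derivatives -/

section Weak

variable {n N : ℕ} {O : Set (Sp n)}

lemma integrable_test_smul {ψ : Sp n → ℝ} {u : Sp n → Sp N} (hψ : Continuous ψ)
    (hc : HasCompactSupport ψ) (hs : tsupport ψ ⊆ O) (hu : LocallyIntegrableOn u O) :
    Integrable (fun x => ψ x • u x) := by
  have h1 : IntegrableOn u (tsupport ψ) := hu.integrableOn_compact_subset hs hc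
  have h2 : IntegrableOn (fun x => ψ x • u x) (tsupport ψ) :=
    h1.continuousOn_smul hψ.continuousOn hc
  refine (integrableOn_iff_integrable_of_support_subset ?_).1 h2
  exact (Function.support_smul_subset_left ψ u).trans (subset_tsupport ψ)

lemma setIntegral_test_smul {ψ : Sp n → ℝ} (u : Sp n → Sp N) (hs : tsupport ψ ⊆ O) :
    ∫ x in O, ψ x • u x = ∫ x, ψ x • u x := by
  refine setIntegral_eq_integral_of_forall_compl_eq_zero fun x hx => ?_
  rw [image_eq_zero_of_notMem_tsupport fun h => hx (hs h), zero_smul]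

lemma locallyIntegrableOn_smul {η : Sp n → ℝ} (hη : Continuous η) {u : Sp n → Sp N}
    (hO : IsOpen O) (hu : LocallyIntegrableOn u O) :
    LocallyIntegrableOn (fun x => η x • u x) O :=
  hu.continuousOn_smul hO.isLocallyClosed hη.continuousOn

lemma IsWeakDeriv.ae_eq (hO : IsOpen O) {α : Fin n → ℕ} {u v v' : Sp n → Sp N}
    (h : IsWeakDeriv O α u v) (h' : IsWeakDeriv O α u v') :
    ∀ᵐ x ∂(volume.restrict O), v x = v' x := by
  rw [ae_restrict_iff' hO.measurableSet]
  have := hO.ae_eq_zero_of_integral_contDiff_smul_eq_zero (μ := volume) (f := fun x => v x - v' x)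
    (h.locInt_deriv.sub h'.locInt_deriv) ?_
  · filter_upwards [this] with x hx hxO using sub_eq_zero.1 (hx hxO)
  · intro g hg hgc hgs
    have e1 := h.integral_eq g ⟨hg, hgc, hgs⟩
    rw [h'.integral_eq g ⟨hg, hgc, hgs⟩, setIntegral_test_smul _ hgs,
      setIntegral_test_smul _ hgs] at e1
    have e2 : ∫ x, g x • v' x = ∫ x, g x • v x :=
      smul_right_injective _ (pow_ne_zero _ (by norm_num : (-1 : ℝ) ≠ 0)) e1
    simp only [smul_sub]
    rw [integral_sub (integrable_test_smul hg.continuous hgc hgs h.locInt_deriv)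
      (integrable_test_smul hg.continuous hgc hgs h'.locInt_deriv), e2, sub_self]

lemma IsWeakDeriv.weakD {α : Fin n → ℕ} {u v : Sp n → Sp N} (h : IsWeakDeriv O α u v) :
    IsWeakDeriv O α u (weakD O α u) := by
  have hex : ∃ v, IsWeakDeriv O α u v := ⟨v, h⟩
  unfold HigherOrder.weakD
  rw [dif_pos hex]
  exact hex.choose_spec

lemma IsWeakDeriv.weakD_ae_eq (hO : IsOpen O) {α : Fin n → ℕ} {u v : Sp n → Sp N}
    (h : IsWeakDeriv O α u v) : ∀ᵐ x ∂(volume.restrict O), HigherOrder.weakD O α u x = v x :=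
  h.weakD.ae_eq hO h

lemma IsWeakDeriv.congr (hO : IsOpen O) {α : Fin n → ℕ} {u v u' v' : Sp n → Sp N}
    (h : IsWeakDeriv O α u v)
    (hu : ∀ᵐ x ∂(volume.restrict O), u x = u' x) (hv : ∀ᵐ x ∂(volume.restrict O), v x = v' x) :
    IsWeakDeriv O α u' v' := by
  have key : ∀ {w w' : Sp n → Sp N}, LocallyIntegrableOn w O →
      (∀ᵐ x ∂(volume.restrict O), w x = w' x) → LocallyIntegrableOn w' O := by
    intro w w' hw hww
    rw [locallyIntegrableOn_iff hO.isLocallyClosed] at hw ⊢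
    intro k hk hkc
    exact (hw k hk hkc).congr (ae_restrict_of_ae_restrict_of_subset hk hww)
  refine ⟨key h.locInt hu, key h.locInt_deriv hv, fun ψ hψ => ?_⟩
  have e1 : ∫ x in O, HigherOrder.multiD α ψ x • u' x = ∫ x in O, HigherOrder.multiD α ψ x • u x :=
    integral_congr_ae (by filter_upwards [hu] with x hx; rw [hx])
  have e2 : ∫ x in O, ψ x • v' x = ∫ x in O, ψ x • v x :=
    integral_congr_ae (by filter_upwards [hv] with x hx; rw [hx])
  rw [e1, e2, h.integral_eq ψ hψ]

lemma isWeakDeriv_zero {u : Sp n → Sp N} (hu : LocallyIntegrableOn u O) : IsWeakDeriv O 0 u u :=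
  ⟨hu, hu, fun ψ _ => by simp [multiD_zero]⟩

/-- If `D_i u = v` and `D^α v = w`, then `D^{α + e_i} u = w`. -/
lemma IsWeakDeriv.trans' {α : Fin n → ℕ} {i : Fin n} {u v w : Sp n → Sp N}
    (h : IsWeakDeriv O (unitIdx i) u v) (h' : IsWeakDeriv O α v w) :
    IsWeakDeriv O (α + unitIdx i) u w := by
  refine ⟨h.locInt, h'.locInt_deriv, fun ψ hψ => ?_⟩
  have := h.integral_eq _ (hψ.multiD α)
  rw [multiD_unitIdx (hψ.multiD α).smooth, ← multiD_add_unitIdx hψ.smooth] at this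
  rw [this, h'.integral_eq ψ hψ, sum_add_unitIdx, sum_unitIdx, smul_smul, pow_add, mul_comm]

/-- If `D^α u = v` and `D^{α + e_i} u = w`, then `D_i v = w`. -/
lemma IsWeakDeriv.of_add_unitIdx {α : Fin n → ℕ} {i : Fin n} {u v w : Sp n → Sp N}
    (h : IsWeakDeriv O α u v) (h' : IsWeakDeriv O (α + unitIdx i) u w) :
    IsWeakDeriv O (unitIdx i) v w := by
  refine ⟨h.locInt_deriv, h'.locInt_deriv, fun ψ hψ => ?_⟩
  have e1 := h.integral_eq _ (hψ.partialD i)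
  rw [← multiD_add_unitIdx' hψ.smooth, h'.integral_eq ψ hψ, sum_add_unitIdx, pow_add,
    mul_smul] at e1
  rw [multiD_unitIdx hψ.smooth, sum_unitIdx]
  exact (smul_right_injective _ (pow_ne_zero _ (by norm_num : (-1 : ℝ) ≠ 0)) e1).symm

lemma IsWeakDeriv.sub {α : Fin n → ℕ} {u v u' v' : Sp n → Sp N}
    (h : IsWeakDeriv O α u v) (h' : IsWeakDeriv O α u' v') :
    IsWeakDeriv O α (fun x => u x - u' x) (fun x => v x - v' x) := by
  refine ⟨h.locInt.sub h'.locInt, h.locInt_deriv.sub h'.locInt_deriv, fun ψ hψ => ?_⟩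
  have hα := hψ.multiD α
  simp only [smul_sub]
  rw [integral_sub, integral_sub, h.integral_eq ψ hψ, h'.integral_eq ψ hψ, smul_sub]
  · exact (integrable_test_smul hψ.smooth.continuous hψ.compact hψ.support
      h.locInt_deriv).integrableOn
  · exact (integrable_test_smul hψ.smooth.continuous hψ.compact hψ.support
      h'.locInt_deriv).integrableOn
  · exact (integrable_test_smul hα.smooth.continuous hα.compact hα.support
      h.locInt).integrableOn
  · exact (integrable_test_smul hα.smooth.continuous hα.compact hα.support
      h'.locInt).integrableOn

lemma IsWeakDeriv.neg {α : Fin n → ℕ} {u v : Sp n → Sp N} (h : IsWeakDeriv O α u v) :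
    IsWeakDeriv O α (fun x => - u x) (fun x => - v x) := by
  refine ⟨h.locInt.neg, h.locInt_deriv.neg, fun ψ hψ => ?_⟩
  simp only [smul_neg, integral_neg]
  rw [h.integral_eq ψ hψ]

lemma IsWeakDeriv.add {α : Fin n → ℕ} {u v u' v' : Sp n → Sp N}
    (h : IsWeakDeriv O α u v) (h' : IsWeakDeriv O α u' v') :
    IsWeakDeriv O α (fun x => u x + u' x) (fun x => v x + v' x) := by
  simpa using h.sub h'.neg

/-- The product rule `D_i (η u) = (D_i η) u + η D_i u` for smooth `η`. -/
lemma IsWeakDeriv.smul_left (hO : IsOpen O) {i : Fin n} {u v : Sp n → Sp N} {η : Sp n → ℝ}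
    (hη : ContDiff ℝ ∞ η) (h : IsWeakDeriv O (unitIdx i) u v) :
    IsWeakDeriv O (unitIdx i) (fun x => η x • u x)
      (fun x => partialD i η x • u x + η x • v x) := by
  have hη' := contDiff_partialD hη i
  refine ⟨locallyIntegrableOn_smul hη.continuous hO h.locInt,
    (locallyIntegrableOn_smul hη'.continuous hO h.locInt).add
      (locallyIntegrableOn_smul hη.continuous hO h.locInt_deriv), fun ψ hψ => ?_⟩
  have hψη := hψ.mul_left hη
  have hψη' := hψ.mul_left hη'
  have e := h.integral_eq _ hψη
  rw [multiD_unitIdx hψη.smooth, sum_unitIdx] at e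
  rw [multiD_unitIdx hψ.smooth, sum_unitIdx]
  have i1 : IntegrableOn (fun x => partialD i (fun y => η y • ψ y) x • u x) O :=
    (integrable_test_smul (hψη.partialD i).smooth.continuous (hψη.partialD i).compact
      (hψη.partialD i).support h.locInt).integrableOn
  have i2 : IntegrableOn (fun x => (partialD i η x • ψ x) • u x) O :=
    (integrable_test_smul hψη'.smooth.continuous hψη'.compact hψη'.support h.locInt).integrableOn
  have i3 : IntegrableOn (fun x => (η x • ψ x) • v x) O :=
    (integrable_test_smul hψη.smooth.continuous hψη.compact hψη.support
      h.locInt_deriv).integrableOn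
  have e1 : ∫ x in O, partialD i ψ x • η x • u x =
      ∫ x in O, (partialD i (fun y => η y • ψ y) x • u x - (partialD i η x • ψ x) • u x) := by
    congr 1; funext x
    rw [partialD_smul hη hψ.smooth, add_smul, add_sub_cancel_left, smul_smul, smul_eq_mul, mul_comm]
  have e2 : ∫ x in O, ψ x • (partialD i η x • u x + η x • v x) =
      ∫ x in O, ((partialD i η x • ψ x) • u x + (η x • ψ x) • v x) := by
    congr 1; funext x
    simp only [smul_add, smul_smul, smul_eq_mul, mul_comm]
  rw [e1, e2, integral_sub i1 i2, integral_add i2 i3, e]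
  simp only [pow_one, neg_smul, one_smul]
  abel

lemma isWeakDeriv_of_contDiff_unitIdx {P : Sp n → Sp N} (hP : ContDiff ℝ ∞ P)
    (i : Fin n) : IsWeakDeriv O (unitIdx i) P (partialD i P) := by
  have hP' := contDiff_partialD hP i
  refine ⟨(hP.continuous.locallyIntegrable.locallyIntegrableOn O),
    (hP'.continuous.locallyIntegrable.locallyIntegrableOn O), fun ψ hψ => ?_⟩
  have hψ' := hψ.partialD i
  rw [multiD_unitIdx hψ.smooth, sum_unitIdx, setIntegral_test_smul _ hψ'.support,
    setIntegral_test_smul _ hψ.support]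
  have := integral_smul_fderiv_eq_neg_fderiv_smul_of_integrable (μ := volume) (f := ψ) (g := P)
    (v := EuclideanSpace.single i 1)
    (integrable_test_smul hψ'.smooth.continuous hψ'.compact hψ'.support
      (hP.continuous.locallyIntegrable.locallyIntegrableOn O))
    (integrable_test_smul hψ.smooth.continuous hψ.compact hψ.support
      (hP'.continuous.locallyIntegrable.locallyIntegrableOn O))
    (integrable_test_smul hψ.smooth.continuous hψ.compact hψ.support
      (hP.continuous.locallyIntegrable.locallyIntegrableOn O))
    (fun x _ => hψ.smooth.differentiable (by simp) x)
    (fun x _ => hP.differentiable (by simp) x)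
  simp only [partialD]
  rw [this]
  simp

/-- A jet of order `m` on `O`: a family `(U_α)_{|α| ≤ m}` in `L¹_loc(O)` with `D_i U_α = U_{α+e_i}`
weakly. It consists of the weak derivatives of `U_0`; entries with `|α| > m` are arbitrary. -/
structure IsJet (O : Set (Sp n)) (m : ℕ) (U : (Fin n → ℕ) → Sp n → Sp N) : Prop where
  locInt : ∀ α, ∑ i, α i ≤ m → LocallyIntegrableOn (U α) O
  deriv : ∀ α i, ∑ j, α j < m → IsWeakDeriv O (unitIdx i) (U α) (U (α + unitIdx i))

lemma MemSobolevLoc.isWeakDeriv {m : ℕ} {u : Sp n → Sp N} (h : MemSobolevLoc O m u)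
    (α : Fin n → ℕ) (hα : ∑ i, α i ≤ m) : IsWeakDeriv O α u (weakD O α u) :=
  (h α hα).choose_spec.weakD

lemma MemSobolevLoc.isJet {m : ℕ} {u : Sp n → Sp N} (h : MemSobolevLoc O m u) :
    IsJet O m (fun α => weakD O α u) :=
  ⟨fun α hα => (h.isWeakDeriv α hα).locInt_deriv, fun α i hα =>
    (h.isWeakDeriv α hα.le).of_add_unitIdx (h.isWeakDeriv _ (by rw [sum_add_unitIdx]; omega))⟩

lemma isJet_of_contDiff (m : ℕ) {P : Sp n → Sp N} (hP : ContDiff ℝ ∞ P) :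
    IsJet O m (fun α => multiD α P) :=
  ⟨fun α _ => (contDiff_multiD hP α).continuous.locallyIntegrable.locallyIntegrableOn O,
    fun α i _ => by
      simp only [multiD_add_unitIdx hP]
      exact isWeakDeriv_of_contDiff_unitIdx (contDiff_multiD hP α) i⟩

lemma IsJet.sub {m : ℕ} {U V : (Fin n → ℕ) → Sp n → Sp N} (hU : IsJet O m U) (hV : IsJet O m V) :
    IsJet O m (fun α x => U α x - V α x) :=
  ⟨fun α hα => (hU.locInt α hα).sub (hV.locInt α hα),
    fun α i hα => (hU.deriv α i hα).sub (hV.deriv α i hα)⟩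

lemma IsJet.shift {m : ℕ} {U : (Fin n → ℕ) → Sp n → Sp N} (hU : IsJet O (m + 1) U) (i : Fin n) :
    IsJet O m (fun α => U (α + unitIdx i)) :=
  ⟨fun α hα => hU.locInt _ (by rw [sum_add_unitIdx]; omega), fun α j hα => by
    have := hU.deriv (α + unitIdx i) j (by rw [sum_add_unitIdx]; omega)
    rwa [add_right_comm] at this⟩

lemma IsJet.mono {m k : ℕ} {U : (Fin n → ℕ) → Sp n → Sp N} (hU : IsJet O m U) (hk : k ≤ m) :
    IsJet O k U :=
  ⟨fun α hα => hU.locInt α (hα.trans hk), fun α i hα => hU.deriv α i (hα.trans_le hk)⟩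

/-- The multi-indices of length `k`. -/
abbrev indices (n k : ℕ) : Finset (Fin n → ℕ) :=
  Finset.piAntidiag (Finset.univ : Finset (Fin n)) k

lemma mem_indices {k : ℕ} {α : Fin n → ℕ} : α ∈ indices n k ↔ ∑ i, α i = k := by
  simp [indices, Finset.mem_piAntidiag]

/-- The sum of the norms of the entries of order `k` of a jet. -/
noncomputable def jetSum (U : (Fin n → ℕ) → Sp n → Sp N) (k : ℕ) (x : Sp n) : ℝ :=
  ∑ α ∈ indices n k, ‖U α x‖

lemma jetSum_nonneg (U : (Fin n → ℕ) → Sp n → Sp N) (k : ℕ) (x : Sp n) : 0 ≤ jetSum U k x :=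
  Finset.sum_nonneg fun _ _ => norm_nonneg _

lemma norm_le_jetSum (U : (Fin n → ℕ) → Sp n → Sp N) (α : Fin n → ℕ) (x : Sp n) :
    ‖U α x‖ ≤ jetSum U (∑ i, α i) x :=
  Finset.single_le_sum (f := fun β => ‖U β x‖) (fun _ _ => norm_nonneg _) (mem_indices.2 rfl)

lemma jetSum_shift_le (U : (Fin n → ℕ) → Sp n → Sp N) (i : Fin n) (k : ℕ) (x : Sp n) :
    jetSum (fun α => U (α + unitIdx i)) k x ≤ jetSum U (k + 1) x := by
  unfold jetSum
  rw [← Finset.sum_image (s := indices n k) (g := fun α => α + unitIdx i) (f := fun α => ‖U α x‖)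
    (fun a _ b _ h => by simpa using h)]
  refine Finset.sum_le_sum_of_subset_of_nonneg ?_ fun _ _ _ => norm_nonneg _
  intro β hβ
  obtain ⟨α, hα, rfl⟩ := Finset.mem_image.1 hβ
  rw [mem_indices, sum_add_unitIdx, mem_indices.1 hα]

/-- Leibniz' rule in quantitative form: if `|D^γ η| ≤ A d^{-|γ|}`, the weak derivative `D^α (η u)`
differs from `η D^α u` by at most `2^k A ∑_{j<k} d^{-(k-j)} |D^j u|`, where `k = |α|`. -/
lemma exists_isWeakDeriv_smul (hO : IsOpen O) (k : ℕ) :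
    ∀ (V : (Fin n → ℕ) → Sp n → Sp N) (η : Sp n → ℝ) (A d : ℝ) (α : Fin n → ℕ),
      IsJet O k V → ContDiff ℝ ∞ η → 0 ≤ A → 0 < d →
      (∀ γ x, ∑ i, γ i ≤ k → |multiD γ η x| ≤ A * d⁻¹ ^ (∑ i, γ i)) → ∑ i, α i = k →
      ∃ z, IsWeakDeriv O α (fun x => η x • V 0 x) z ∧
        ∀ x, ‖z x - η x • V α x‖ ≤
          2 ^ k * A * ∑ j ∈ Finset.range k, d⁻¹ ^ (k - j) * jetSum V j x := by
  induction k with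
  | zero =>
    intro V η A d α hV hη hA hd hb hα
    obtain rfl := eq_zero_of_sum_eq_zero hα
    exact ⟨_, isWeakDeriv_zero (locallyIntegrableOn_smul hη.continuous hO
      (hV.locInt 0 (by simp))), fun x => by simp⟩
  | succ k ih =>
    intro V η A d α' hV hη hA hd hb hα'
    obtain ⟨α, i, rfl, hα⟩ := exists_eq_add_unitIdx hα'
    have hη' := contDiff_partialD hη i
    have hd' : 0 < d⁻¹ := inv_pos.2 hd
    obtain ⟨z₁, hz₁, hb₁⟩ := ih V (partialD i η) (A * d⁻¹) d α (hV.mono (by omega)) hη'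
      (by positivity) hd (fun γ x hγ => by
        have := hb (γ + unitIdx i) x (by rw [sum_add_unitIdx]; omega)
        rw [multiD_add_unitIdx' hη, sum_add_unitIdx, pow_succ] at this
        linarith) hα
    obtain ⟨z₂, hz₂, hb₂⟩ := ih (fun β => V (β + unitIdx i)) η A d α (hV.shift i) hη hA hd
      (fun γ x hγ => hb γ x (by omega)) hα
    have h1 := (hV.deriv 0 i (by simp)).smul_left hO hη
    have h2 := hz₁.add hz₂
    refine ⟨fun x => z₁ x + z₂ x, h1.trans' h2, fun x => ?_⟩
    have hS : ∀ j, 0 ≤ jetSum V j x := fun j => jetSum_nonneg V j x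
    have e : z₁ x + z₂ x - η x • V (α + unitIdx i) x =
        (z₁ x - partialD i η x • V α x) + partialD i η x • V α x +
          (z₂ x - η x • V (α + unitIdx i) x) := by abel
    rw [e]
    refine (norm_add₃_le).trans ?_
    have t2 : ‖partialD i η x • V α x‖ ≤ A * d⁻¹ * jetSum V k x := by
      rw [norm_smul, Real.norm_eq_abs]
      have := hb (unitIdx i) x (by rw [sum_unitIdx]; omega)
      rw [multiD_unitIdx hη, sum_unitIdx, pow_one] at this
      have h3 := norm_le_jetSum V α x
      rw [hα] at h3
      gcongr
    have t1 := hb₁ x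
    have t3 : ‖z₂ x - η x • V (α + unitIdx i) x‖ ≤ 2 ^ k * A *
        ∑ j ∈ Finset.range k, d⁻¹ ^ (k - j) * jetSum V (j + 1) x := by
      refine (hb₂ x).trans ?_
      gcongr with j hj
      exact jetSum_shift_le V i j x
    set T := ∑ j ∈ Finset.range k, d⁻¹ ^ (k + 1 - j) * jetSum V j x with hT
    have t1' : 2 ^ k * (A * d⁻¹) * ∑ j ∈ Finset.range k, d⁻¹ ^ (k - j) * jetSum V j x =
        2 ^ k * A * T := by
      have : T = d⁻¹ * ∑ j ∈ Finset.range k, d⁻¹ ^ (k - j) * jetSum V j x := by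
        rw [hT, Finset.mul_sum]
        refine Finset.sum_congr rfl fun j hj => ?_
        rw [Finset.mem_range] at hj
        rw [show k + 1 - j = (k - j) + 1 by omega, pow_succ]
        ring
      rw [this]
      ring
    have t3' : ∑ j ∈ Finset.range k, d⁻¹ ^ (k - j) * jetSum V (j + 1) x ≤
        ∑ j ∈ Finset.range (k + 1), d⁻¹ ^ (k + 1 - j) * jetSum V j x := by
      rw [Finset.sum_range_succ']
      have : ∀ j, k + 1 - (j + 1) = k - j := fun j => by omega
      simp only [this]
      have := hS 0
      linarith [show 0 ≤ d⁻¹ ^ (k + 1 - 0) * jetSum V 0 x by positivity]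
    rw [Finset.sum_range_succ, ← hT, show k + 1 - k = 1 by omega, pow_one] at t3'
    rw [Finset.sum_range_succ, ← hT, show k + 1 - k = 1 by omega, pow_one]
    have h4 : 2 ^ k * A * ∑ j ∈ Finset.range k, d⁻¹ ^ (k - j) * jetSum V (j + 1) x ≤
        2 ^ k * A * (T + d⁻¹ * jetSum V k x) := by gcongr
    have h5 : A * d⁻¹ * jetSum V k x ≤ 2 ^ k * A * (d⁻¹ * jetSum V k x) := by
      have : 1 ≤ (2 : ℝ) ^ k := one_le_pow₀ (by norm_num)
      have h6 : 0 ≤ A * (d⁻¹ * jetSum V k x) := by have := hS k; positivity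
      nlinarith
    have h7 : (2 : ℝ) ^ (k + 1) = 2 * 2 ^ k := by ring
    rw [h7]
    linarith [t1.trans_eq t1', t2.trans h5, t3.trans h4,
      show 2 * 2 ^ k * A * (T + d⁻¹ * jetSum V k x) = 2 ^ k * A * T +
        2 ^ k * A * (d⁻¹ * jetSum V k x) + 2 ^ k * A * (T + d⁻¹ * jetSum V k x) by ring]

end Weak

/-! ### Mollification -/

section Mollify

open scoped Convolution
open ContinuousLinearMap (lsmul)

variable {n N : ℕ} {F : Type*} [NormedAddCommGroup F] [NormedSpace ℝ F]

lemma partialD_convolution [CompleteSpace F] {f : Sp n → ℝ} {g : Sp n → F} (hf : ContDiff ℝ ∞ f)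
    (hc : HasCompactSupport f) (hg : LocallyIntegrable g) (i : Fin n) :
    partialD i (f ⋆[lsmul ℝ ℝ, volume] g) = (partialD i f ⋆[lsmul ℝ ℝ, volume] g) := by
  funext x
  have h1 := (hc.hasFDerivAt_convolution_left (lsmul ℝ ℝ) (hf.of_le (by exact_mod_cast le_top))
    hg x).fderiv
  have hex : ConvolutionExistsAt (fderiv ℝ f) g x ((lsmul ℝ ℝ).precompL (Sp n)) volume :=
    (hc.fderiv ℝ).convolutionExists_left _ (hf.continuous_fderiv (by simp)) hg x
  change fderiv ℝ (f ⋆[lsmul ℝ ℝ, volume] g) x (EuclideanSpace.single i 1) = _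
  rw [h1, convolution_def, ContinuousLinearMap.integral_apply hex]
  rfl

lemma multiD_convolution [CompleteSpace F] {f : Sp n → ℝ} {g : Sp n → F} (hf : ContDiff ℝ ∞ f)
    (hc : HasCompactSupport f) (hg : LocallyIntegrable g) (α : Fin n → ℕ) :
    multiD α (f ⋆[lsmul ℝ ℝ, volume] g) = (multiD α f ⋆[lsmul ℝ ℝ, volume] g) := by
  have hsm : ContDiff ℝ ∞ (f ⋆[lsmul ℝ ℝ, volume] g) := hc.contDiff_convolution_left _ hf hg
  have ht : IsTest univ f := ⟨hf, hc, subset_univ _⟩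
  induction α using multiIndex_induction with
  | h0 => simp only [multiD_zero]
  | hs α i ih =>
    rw [multiD_add_unitIdx hsm, ih, multiD_add_unitIdx hf,
      partialD_convolution (ht.multiD α).smooth (ht.multiD α).compact hg]

/-- The mollification of `g` by the normed bump function `φ`. -/
noncomputable def mollify (φ : ContDiffBump (0 : Sp n)) (g : Sp n → F) : Sp n → F :=
  φ.normed volume ⋆[lsmul ℝ ℝ, volume] g

lemma contDiff_mollify [CompleteSpace F] (φ : ContDiffBump (0 : Sp n)) {g : Sp n → F}
    (hg : LocallyIntegrable g) : ContDiff ℝ ∞ (mollify φ g) :=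
  φ.hasCompactSupport_normed.contDiff_convolution_left _ φ.contDiff_normed hg

lemma partialD_comp_sub {f : Sp n → F} (hf : ContDiff ℝ ∞ f) (i : Fin n) (x y : Sp n) :
    partialD i (fun y => f (x - y)) y = - partialD i f (x - y) := by
  have h := ((hf.differentiable (by simp) (x - y)).hasFDerivAt.comp y
    ((hasFDerivAt_id y).const_sub x)).fderiv
  simp only [partialD]
  have e : (fun y => f (x - y)) = f ∘ HSub.hSub x := rfl
  rw [e, h]
  simp

lemma partialD_mollify (φ : ContDiffBump (0 : Sp n)) {g v : Sp n → Sp N} {i : Fin n}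
    (h : IsWeakDeriv univ (unitIdx i) g v) : partialD i (mollify φ g) = mollify φ v := by
  unfold mollify
  have hs : ContDiff ℝ ∞ (φ.normed volume) := φ.contDiff_normed
  rw [partialD_convolution hs φ.hasCompactSupport_normed
    (locallyIntegrableOn_univ.1 h.locInt)]
  funext x
  rw [convolution_eq_swap, convolution_eq_swap]
  have ht : IsTest univ (fun y => φ.normed volume (x - y)) :=
    ⟨hs.comp (contDiff_const.sub contDiff_id),
      φ.hasCompactSupport_normed.comp_homeomorph (Homeomorph.subLeft x), subset_univ _⟩
  have e := h.integral_eq _ ht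
  rw [multiD_unitIdx ht.smooth, sum_unitIdx] at e
  simp only [Measure.restrict_univ, pow_one, neg_smul, one_smul, partialD_comp_sub hs,
    integral_neg, neg_inj] at e
  exact e

lemma IsJet.multiD_mollify {m : ℕ} {V : (Fin n → ℕ) → Sp n → Sp N} (hV : IsJet univ m V)
    (φ : ContDiffBump (0 : Sp n)) (α : Fin n → ℕ) (hα : ∑ i, α i ≤ m) :
    multiD α (mollify φ (V 0)) = mollify φ (V α) := by
  have hs : ContDiff ℝ ∞ (mollify φ (V 0)) :=
    contDiff_mollify φ (locallyIntegrableOn_univ.1 (hV.locInt 0 (by simp)))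
  induction α using multiIndex_induction with
  | h0 => rw [multiD_zero]
  | hs α i ih =>
    rw [sum_add_unitIdx] at hα
    rw [multiD_add_unitIdx hs, ih (by omega), partialD_mollify φ (hV.deriv α i (by omega))]

lemma lintegral_enorm_mollify_le (φ : ContDiffBump (0 : Sp n)) {g : Sp n → F}
    (hg : AEStronglyMeasurable g volume) : ∫⁻ x, ‖mollify φ g x‖ₑ ≤ ∫⁻ x, ‖g x‖ₑ := by
  have hm := (φ.continuous_normed (μ := volume)).aestronglyMeasurable (μ := volume)
    |>.convolution_integrand (lsmul ℝ ℝ) hg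
  calc ∫⁻ x, ‖mollify φ g x‖ₑ
      ≤ ∫⁻ x, ∫⁻ t, ‖φ.normed volume t • g (x - t)‖ₑ :=
        lintegral_mono fun x => enorm_integral_le_lintegral_enorm _
    _ = ∫⁻ t, ∫⁻ x, ‖φ.normed volume t • g (x - t)‖ₑ := lintegral_lintegral_swap hm.enorm
    _ = ∫⁻ t, ‖φ.normed volume t‖ₑ * ∫⁻ x, ‖g x‖ₑ := by
        refine lintegral_congr fun t => ?_
        simp only [enorm_smul]
        have hm' : AEMeasurable (fun x => ‖g (x - t)‖ₑ) volume :=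
          hg.enorm.comp_quasiMeasurePreserving
            (measurePreserving_sub_right volume t).quasiMeasurePreserving
        rw [lintegral_const_mul'' _ hm']
        rw [lintegral_sub_right_eq_self (fun x => ‖g x‖ₑ) t]
    _ = ∫⁻ x, ‖g x‖ₑ := by
        rw [lintegral_mul_const _ (φ.continuous_normed.enorm.measurable)]
        have : ∫⁻ t, ‖φ.normed volume t‖ₑ = 1 := by
          rw [← ofReal_integral_norm_eq_lintegral_enorm φ.integrable_normed]
          have : ∀ t, ‖φ.normed (volume : Measure (Sp n)) t‖ = φ.normed volume t := fun t => by
            rw [Real.norm_eq_abs, abs_of_nonneg (φ.nonneg_normed t)]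
          simp only [this, φ.integral_normed, ENNReal.ofReal_one]
        rw [this, one_mul]

lemma mollify_sub (φ : ContDiffBump (0 : Sp n)) {g h : Sp n → F}
    (hg : LocallyIntegrable g) (hh : LocallyIntegrable h) (x : Sp n) :
    mollify φ (fun x => g x - h x) x = mollify φ g x - mollify φ h x := by
  have e1 := φ.hasCompactSupport_normed.convolutionExists_left (lsmul ℝ ℝ)
    (φ.continuous_normed (μ := volume)) hg x
  have e2 := φ.hasCompactSupport_normed.convolutionExists_left (lsmul ℝ ℝ)
    (φ.continuous_normed (μ := volume)) hh x
  unfold mollify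
  simp only [convolution_def, map_sub]
  exact integral_sub e1 e2

lemma mollify_eq_zero (φ : ContDiffBump (0 : Sp n)) {g : Sp n → F} {x : Sp n}
    (h : ∀ y ∈ Metric.ball x φ.rOut, g y = 0) : mollify φ g x = 0 := by
  rw [mollify, convolution_def]
  refine integral_eq_zero_of_ae (Eventually.of_forall fun t => ?_)
  by_cases ht : t ∈ Metric.ball (0 : Sp n) φ.rOut
  · have : g (x - t) = 0 := h _ (by simpa [dist_eq_norm] using ht)
    simp [this]
  · have : φ.normed volume t = 0 := by
      rw [← Function.notMem_support, φ.support_normed_eq]; exact ht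
    simp [this]

/-- Mollifications converge in `L¹`. -/
lemma tendsto_lintegral_mollify_sub [CompleteSpace F] {φ : ℕ → ContDiffBump (0 : Sp n)}
    (hφ : Tendsto (fun j => (φ j).rOut) atTop (𝓝 0)) {g : Sp n → F} (hg : Integrable g) :
    Tendsto (fun j => ∫⁻ x, ‖mollify (φ j) g x - g x‖ₑ) atTop (𝓝 0) := by
  rw [ENNReal.tendsto_atTop_zero]
  intro ε hε
  by_cases hεt : ε = ⊤
  · exact ⟨0, fun j _ => hεt ▸ le_top⟩
  obtain ⟨h, hhc, hgh, hhcont, hhi⟩ := hg.exists_hasCompactSupport_lintegral_sub_le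
    (ε := ε / 3) (by simpa using hε.ne')
  set K := Metric.cthickening 1 (tsupport h) with hK
  have hKc : IsCompact K := hhc.isCompact.cthickening
  have hKv : volume K < ⊤ := hKc.measure_lt_top
  obtain ⟨δ, hδ0, hδ⟩ : ∃ δ : ℝ, 0 < δ ∧ ENNReal.ofReal δ * volume K ≤ ε / 3 := by
    have h3 : ε / 3 ≠ 0 := by simpa using hε.ne'
    have h3t : ε / 3 ≠ ⊤ := ENNReal.div_ne_top hεt (by simp)
    refine ⟨(ε / 3 / (volume K + 1)).toReal, ENNReal.toReal_pos ?_ ?_, ?_⟩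
    · exact (ENNReal.div_pos h3 (by simp [hKv.ne])).ne'
    · exact ENNReal.div_ne_top h3t (by simp)
    · rw [ENNReal.ofReal_toReal (ENNReal.div_ne_top h3t (by simp))]
      calc ε / 3 / (volume K + 1) * volume K ≤ ε / 3 / (volume K + 1) * (volume K + 1) := by
            gcongr; exact le_self_add
        _ = ε / 3 := ENNReal.div_mul_cancel (by simp) (by simp [hKv.ne])
  obtain ⟨η, hη0, hη⟩ := Metric.uniformContinuous_iff.1
    (hhc.uniformContinuous_of_continuous hhcont) δ hδ0
  have hev : ∀ᶠ j in atTop, (φ j).rOut < min η 1 := hφ.eventually_lt_const (by positivity)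
  obtain ⟨J, hJ⟩ := eventually_atTop.1 hev
  refine ⟨J, fun j hj => ?_⟩
  have hr := hJ j hj
  have hgl := hg.locallyIntegrable
  have hhl := hhi.locallyIntegrable
  have hpt : ∀ x, ‖mollify (φ j) h x - h x‖ₑ ≤ K.indicator (fun _ => ENNReal.ofReal δ) x := by
    intro x
    by_cases hx : x ∈ K
    · rw [indicator_of_mem hx, ← ofReal_norm, ← dist_eq_norm]
      refine ENNReal.ofReal_le_ofReal ?_
      refine (φ j).dist_normed_convolution_le hhcont.aestronglyMeasurable fun y hy => ?_
      exact (hη (lt_of_lt_of_le (Metric.mem_ball.1 hy) (hr.le.trans (min_le_left _ _)))).le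
    · have h0 : ∀ y ∈ Metric.ball x (φ j).rOut, h y = 0 := by
        intro y hy
        by_contra hne
        refine hx (Metric.mem_cthickening_of_dist_le x y 1 _ (subset_tsupport _ hne) ?_)
        rw [dist_comm]
        exact (Metric.mem_ball.1 hy).le.trans (hr.le.trans (min_le_right _ _))
      rw [indicator_of_notMem hx, mollify_eq_zero _ h0,
        h0 x (Metric.mem_ball_self (φ j).rOut_pos)]
      simp
  have m1 : AEStronglyMeasurable (fun x => mollify (φ j) (fun x => g x - h x) x) volume :=
    (contDiff_mollify (φ j) (hgl.sub hhl)).continuous.aestronglyMeasurable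
  have m2 : AEStronglyMeasurable (fun x => mollify (φ j) h x - h x) volume :=
    ((contDiff_mollify (φ j) hhl).continuous.sub hhcont).aestronglyMeasurable
  calc ∫⁻ x, ‖mollify (φ j) g x - g x‖ₑ
      ≤ ∫⁻ x, (‖mollify (φ j) (fun x => g x - h x) x‖ₑ + ‖mollify (φ j) h x - h x‖ₑ) +
          ‖g x - h x‖ₑ := by
        refine lintegral_mono fun x => ?_
        have : mollify (φ j) g x - g x = mollify (φ j) (fun x => g x - h x) x +
            (mollify (φ j) h x - h x) - (g x - h x) := by
          rw [mollify_sub _ hgl hhl]; abel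
        rw [this]
        exact enorm_sub_le.trans (by gcongr; exact enorm_add_le _ _)
    _ = (∫⁻ x, ‖mollify (φ j) (fun x => g x - h x) x‖ₑ) + (∫⁻ x, ‖mollify (φ j) h x - h x‖ₑ) +
          ∫⁻ x, ‖g x - h x‖ₑ := by
        have m12 : AEMeasurable (fun x => ‖mollify (φ j) (fun x => g x - h x) x‖ₑ +
            ‖mollify (φ j) h x - h x‖ₑ) volume := m1.enorm.add m2.enorm
        rw [lintegral_add_left' m12, lintegral_add_left' m1.enorm]
    _ ≤ ε / 3 + ε / 3 + ε / 3 := by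
        gcongr
        · exact (lintegral_enorm_mollify_le _ (hg.sub hhi).aestronglyMeasurable).trans hgh
        · calc _ ≤ ∫⁻ x, K.indicator (fun _ => ENNReal.ofReal δ) x := lintegral_mono hpt
            _ = ENNReal.ofReal δ * volume K := by
              rw [lintegral_indicator_const hKc.measurableSet]
            _ ≤ _ := hδ
    _ = ε := ENNReal.add_thirds ε

lemma exists_bump_seq (n : ℕ) {r : ℝ} (hr : 0 < r) : ∃ φ : ℕ → ContDiffBump (0 : Sp n),
    Tendsto (fun j => (φ j).rOut) atTop (𝓝 0) ∧ ∀ j, (φ j).rOut ≤ r := by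
  refine ⟨fun j => ⟨r / (j + 1) / 2, r / (j + 1), by positivity, half_lt_self (by positivity)⟩,
    ?_, fun j => ?_⟩
  · have := tendsto_one_div_add_atTop_nhds_zero_nat (𝕜 := ℝ) |>.const_mul r
    simpa [div_eq_mul_inv] using this
  · exact div_le_self hr.le (by simp)

end Mollify

/-! ### Cutoff functions and compactly supported Sobolev functions -/

section Cutoff

open scoped Convolution
open ContinuousLinearMap (lsmul)

variable {n N : ℕ} {O : Set (Sp n)}

lemma multiD_comp_smul {h : Sp n → ℝ} (hh : ContDiff ℝ ∞ h) (c : ℝ) (γ : Fin n → ℕ) (x : Sp n) :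
    multiD γ (fun x => h (c • x)) x = c ^ (∑ i, γ i) * multiD γ h (c • x) := by
  have hs : ContDiff ℝ ∞ (fun x => h (c • x)) := hh.comp (contDiff_const_smul c)
  induction γ using multiIndex_induction generalizing x with
  | h0 => simp [multiD_zero]
  | hs γ i ih =>
    have hd : Differentiable ℝ (multiD γ h) := (contDiff_multiD hh γ).differentiable (by simp)
    rw [multiD_add_unitIdx hs, multiD_add_unitIdx hh, sum_add_unitIdx]
    have e : multiD γ (fun x => h (c • x)) =
        fun x => c ^ (∑ i, γ i) * (multiD γ h) (c • x) := funext ih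
    rw [e]
    have h1 : HasFDerivAt (fun x : Sp n => c • x) (c • ContinuousLinearMap.id ℝ (Sp n)) x :=
      (hasFDerivAt_id x).const_smul c
    have h2 := ((hd (c • x)).hasFDerivAt.comp x h1).const_mul (c ^ (∑ i, γ i))
    have h3 := h2.fderiv
    simp only [partialD]
    simp only [Function.comp_def] at h3
    rw [h3]
    simp [pow_succ]
    ring

/-- Cutoff functions with the natural bounds: smoothing of the indicator of `E` at scale `ε`. -/
lemma exists_smooth_indicator (n : ℕ) : ∃ C : (Fin n → ℕ) → ℝ, (∀ γ, 0 ≤ C γ) ∧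
    ∀ (E : Set (Sp n)) (ε : ℝ), MeasurableSet E → 0 < ε → ∃ η : Sp n → ℝ, ContDiff ℝ ∞ η ∧
      (∀ x, 0 ≤ η x ∧ η x ≤ 1) ∧ (∀ x, Metric.ball x ε ⊆ E → η x = 1) ∧
      (∀ x, Disjoint (Metric.ball x ε) E → η x = 0) ∧
      ∀ γ x, |multiD γ η x| ≤ C γ * ε⁻¹ ^ (∑ i, γ i) := by
  let φ : ContDiffBump (0 : Sp n) := ⟨1 / 2, 1, by norm_num, by norm_num⟩
  have hρ : ContDiff ℝ ∞ (φ.normed (volume : Measure (Sp n))) := φ.contDiff_normed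
  have hρc : HasCompactSupport (φ.normed (volume : Measure (Sp n))) := φ.hasCompactSupport_normed
  have ht : IsTest univ (φ.normed (volume : Measure (Sp n))) := ⟨hρ, hρc, subset_univ _⟩
  refine ⟨fun γ => ∫ y, ‖multiD γ (φ.normed (volume : Measure (Sp n))) y‖,
    fun γ => integral_nonneg fun _ => norm_nonneg _, fun E ε hE hε => ?_⟩
  set E' : Set (Sp n) := (fun x => ε • x) ⁻¹' E with hE'
  have hE'm : MeasurableSet E' := hE.preimage (measurable_const_smul ε)
  set g : Sp n → ℝ := E'.indicator (fun _ => 1) with hg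
  have hg01 : ∀ x, 0 ≤ g x ∧ g x ≤ 1 := fun x => by
    by_cases hx : x ∈ E' <;> simp [hg, hx]
  have hgm : AEStronglyMeasurable g volume :=
    (measurable_const.indicator hE'm).aestronglyMeasurable
  have hgl : LocallyIntegrable g :=
    (locallyIntegrable_const (1 : ℝ)).mono hgm (Eventually.of_forall fun x => by
      rw [Real.norm_eq_abs, abs_of_nonneg (hg01 x).1]; simpa using (hg01 x).2)
  set h : Sp n → ℝ := mollify φ g with hh
  have hhs : ContDiff ℝ ∞ h := contDiff_mollify φ hgl
  have hρi := φ.integrable_normed (μ := (volume : Measure (Sp n)))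
  have hh01 : ∀ x, 0 ≤ h x ∧ h x ≤ 1 := by
    intro x
    have hx : h x = ∫ t, φ.normed volume t * g (x - t) := rfl
    have h0 : ∀ t, 0 ≤ φ.normed volume t * g (x - t) := fun t =>
      mul_nonneg (φ.nonneg_normed t) (hg01 _).1
    refine ⟨hx ▸ integral_nonneg h0, ?_⟩
    rw [hx, ← φ.integral_normed (μ := (volume : Measure (Sp n)))]
    exact integral_mono_of_nonneg (Eventually.of_forall h0) hρi (Eventually.of_forall fun t =>
      mul_le_of_le_one_right (φ.nonneg_normed t) (hg01 _).2)
  have hball : ∀ x y : Sp n, y ∈ Metric.ball (ε⁻¹ • x) φ.rOut → ε • y ∈ Metric.ball x ε := by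
    intro x y hy
    rw [Metric.mem_ball, dist_eq_norm] at hy ⊢
    have : ε • y - x = ε • (y - ε⁻¹ • x) := by
      rw [smul_sub, smul_inv_smul₀ hε.ne']
    rw [this, norm_smul, Real.norm_eq_abs, abs_of_pos hε]
    have hy' : ‖y - ε⁻¹ • x‖ < 1 := hy
    nlinarith
  refine ⟨fun x : Sp n => h (ε⁻¹ • x), hhs.comp (contDiff_const_smul _),
    fun x => hh01 _, fun x hx => ?_, fun x hx => ?_, fun γ x => ?_⟩
  · have hone : ∀ y ∈ Metric.ball (ε⁻¹ • x) φ.rOut, g y = 1 := fun y hy => by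
      have : y ∈ E' := hx (hball x y hy)
      simp [hg, this]
    have h1 := hone _ (Metric.mem_ball_self φ.rOut_pos)
    have := φ.normed_convolution_eq_right (μ := (volume : Measure (Sp n))) (g := g)
      (x₀ := ε⁻¹ • x) fun y hy => by rw [hone y hy, h1]
    rw [h1] at this
    exact this
  · exact mollify_eq_zero φ fun y hy => by
      have : y ∉ E' := fun hyE => disjoint_left.1 hx (hball x y hy) hyE
      simp [hg, this]
  · rw [multiD_comp_smul hhs, mul_comm, abs_mul, abs_of_nonneg (a := ε⁻¹ ^ _) (by positivity)]
    gcongr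
    rw [hh, mollify, multiD_convolution hρ hρc hgl, convolution_def, ← Real.norm_eq_abs]
    refine norm_integral_le_of_norm_le ?_ (Eventually.of_forall fun t => ?_)
    · exact ((ht.multiD γ).smooth.continuous.integrable_of_hasCompactSupport
        (ht.multiD γ).compact).norm
    · simp only [ContinuousLinearMap.lsmul_apply, smul_eq_mul, norm_mul]
      refine mul_le_of_le_one_right (norm_nonneg _) ?_
      rw [Real.norm_eq_abs, abs_of_nonneg (hg01 _).1]
      exact (hg01 _).2

/-- Cutoff functions between concentric balls. -/
lemma exists_ball_cutoff (n m : ℕ) : ∃ A : ℝ, 0 ≤ A ∧ ∀ (x₀ : Sp n) (t s : ℝ), t < s →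
    ∃ η : Sp n → ℝ, ContDiff ℝ ∞ η ∧ (∀ x, 0 ≤ η x ∧ η x ≤ 1) ∧
      (∀ x ∈ Metric.closedBall x₀ t, η x = 1) ∧ (∀ x ∉ Metric.closedBall x₀ s, η x = 0) ∧
      ∀ γ x, ∑ i, γ i ≤ m → |multiD γ η x| ≤ A * (s - t)⁻¹ ^ (∑ i, γ i) := by
  obtain ⟨C, hC0, hC⟩ := exists_smooth_indicator n
  have hA0 : ∀ k, 0 ≤ ∑ γ ∈ indices n k, C γ * 2 ^ k :=
    fun k => Finset.sum_nonneg fun γ _ => mul_nonneg (hC0 γ) (by positivity)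
  refine ⟨∑ k ∈ Finset.range (m + 1), ∑ γ ∈ indices n k, C γ * 2 ^ k,
    Finset.sum_nonneg fun k _ => hA0 k, fun x₀ t s hts => ?_⟩
  obtain ⟨η, h1, h2, h3, h4, h5⟩ := hC (Metric.ball x₀ ((s + t) / 2)) ((s - t) / 2)
    Metric.isOpen_ball.measurableSet (by linarith)
  refine ⟨η, h1, h2, fun x hx => h3 x ?_, fun x hx => h4 x ?_, fun γ x hγ => (h5 γ x).trans ?_⟩
  · refine Metric.ball_subset_ball' ?_
    rw [Metric.mem_closedBall] at hx
    linarith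
  · refine Metric.ball_disjoint_ball ?_
    rw [Metric.mem_closedBall, not_le] at hx
    linarith
  · have e : C γ * ((s - t) / 2)⁻¹ ^ (∑ i, γ i) =
        C γ * 2 ^ (∑ i, γ i) * (s - t)⁻¹ ^ (∑ i, γ i) := by
      rw [mul_assoc, ← mul_pow, inv_div, div_eq_mul_inv]
    rw [e]
    have hs : 0 ≤ (s - t)⁻¹ := inv_nonneg.2 (by linarith)
    gcongr
    refine le_trans ?_ (Finset.single_le_sum (fun k _ => hA0 k)
      (Finset.mem_range.2 (Nat.lt_succ_of_le hγ)))
    exact Finset.single_le_sum (f := fun β => C β * 2 ^ (∑ i, γ i))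
      (fun β _ => mul_nonneg (hC0 β) (by positivity)) (mem_indices.2 rfl)

lemma exists_compact_cutoff (hO : IsOpen O) {K : Set (Sp n)} (hK : IsCompact K) (hKO : K ⊆ O) :
    ∃ χ : Sp n → ℝ, IsTest O χ ∧ ∃ U, IsOpen U ∧ K ⊆ U ∧ ∀ x ∈ U, χ x = 1 := by
  obtain ⟨δ, hδ, hδO⟩ := hK.exists_cthickening_subset_open hO hKO
  obtain ⟨C, -, hC⟩ := exists_smooth_indicator n
  obtain ⟨χ, h1, -, h3, h4, -⟩ := hC (Metric.thickening (δ / 2) K) (δ / 4)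
    Metric.isOpen_thickening.measurableSet (by linarith)
  have hsupp : tsupport χ ⊆ Metric.cthickening δ K := by
    refine closure_minimal (fun x hx => ?_) Metric.isClosed_cthickening
    by_contra hx'
    refine hx (h4 x (disjoint_left.2 fun y hy hy' => hx' ?_))
    obtain ⟨z, hz, hyz⟩ := Metric.mem_thickening_iff.1 hy'
    refine Metric.mem_cthickening_of_dist_le x z δ K hz ?_
    have := dist_triangle x y z
    rw [Metric.mem_ball, dist_comm] at hy
    linarith
  refine ⟨χ, ⟨h1, (hK.cthickening (r := δ)).of_isClosed_subset (isClosed_tsupport _) hsupp,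
    hsupp.trans hδO⟩, Metric.thickening (δ / 4) K, Metric.isOpen_thickening,
    Metric.self_subset_thickening (by linarith) K, fun x hx => h3 x fun y hy => ?_⟩
  obtain ⟨z, hz, hxz⟩ := Metric.mem_thickening_iff.1 hx
  refine Metric.mem_thickening_iff.2 ⟨z, hz, ?_⟩
  have := dist_triangle y x z
  rw [Metric.mem_ball] at hy
  linarith

lemma IsWeakDeriv.mono {O' : Set (Sp n)} (hO : O' ⊆ O) {α : Fin n → ℕ} {u v : Sp n → Sp N}
    (h : IsWeakDeriv O α u v) : IsWeakDeriv O' α u v := by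
  refine ⟨h.locInt.mono_set hO, h.locInt_deriv.mono_set hO, fun ψ hψ => ?_⟩
  have := h.integral_eq ψ (hψ.mono hO)
  rwa [setIntegral_test_smul _ ((hψ.multiD α).support.trans hO),
    setIntegral_test_smul _ (hψ.support.trans hO), ← setIntegral_test_smul _ (hψ.multiD α).support,
    ← setIntegral_test_smul _ hψ.support] at this

/-- Weak derivatives vanish where the function does. -/
lemma IsWeakDeriv.ae_eq_zero (hO : IsOpen O) {α : Fin n → ℕ} {u v : Sp n → Sp N}
    (h : IsWeakDeriv O α u v) (hu : ∀ᵐ x ∂(volume.restrict O), u x = 0) :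
    ∀ᵐ x ∂(volume.restrict O), v x = 0 := by
  have h0 : IsWeakDeriv O α (fun _ => (0 : Sp N)) (fun _ => 0) :=
    ⟨locallyIntegrableOn_zero, locallyIntegrableOn_zero, fun ψ _ => by simp⟩
  exact h.ae_eq hO (h0.congr hO (by filter_upwards [hu] with x hx using hx.symm)
    (Eventually.of_forall fun _ => rfl))

/-- Extension by zero of a weakly differentiable function which vanishes outside a compact set. -/
lemma IsWeakDeriv.extend (hO : IsOpen O) {K : Set (Sp n)} (hK : IsCompact K) (hKO : K ⊆ O)
    {α : Fin n → ℕ} {g v : Sp n → Sp N} (h : IsWeakDeriv O α g v) (hg : ∀ x ∉ K, g x = 0) :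
    IsWeakDeriv univ α g (K.indicator v) ∧
      ∀ᵐ x ∂(volume.restrict O), K.indicator v x = v x := by
  have hv0 : ∀ᵐ x ∂(volume.restrict O), x ∉ K → v x = 0 := by
    have hOK : IsOpen (O \ K) := hO.sdiff hK.isClosed
    have h1 := (h.mono sdiff_subset : IsWeakDeriv (O \ K) α g v).ae_eq_zero hOK
      ((ae_restrict_iff' hOK.measurableSet).2 (Eventually.of_forall fun x hx => hg x hx.2))
    rw [ae_restrict_iff' hOK.measurableSet] at h1
    rw [ae_restrict_iff' hO.measurableSet]
    filter_upwards [h1] with x hx hxO hxK using hx ⟨hxO, hxK⟩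
  have hv1 : ∀ᵐ x ∂(volume.restrict O), K.indicator v x = v x := by
    filter_upwards [hv0] with x hx
    by_cases hxK : x ∈ K
    · simp [hxK]
    · simp [hxK, hx hxK]
  refine ⟨⟨?_, ?_, fun ψ hψ => ?_⟩, hv1⟩
  · refine Integrable.locallyIntegrable ?_ |>.locallyIntegrableOn univ
    rw [← integrableOn_iff_integrable_of_support_subset (s := K)]
    · exact h.locInt.integrableOn_compact_subset hKO hK
    · intro x hx
      by_contra hxK
      exact hx (hg x hxK)
  · exact ((integrable_indicator_iff hK.measurableSet).2
      (h.locInt_deriv.integrableOn_compact_subset hKO hK)).locallyIntegrable.locallyIntegrableOn _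
  · obtain ⟨χ, hχ, U, hU, hKU, hχU⟩ := exists_compact_cutoff hO hK hKO
    have hχψ : IsTest O (fun x => χ x • ψ x) :=
      ⟨hχ.smooth.smul hψ.smooth, hχ.compact.smul_right,
        (tsupport_smul_subset_left χ ψ).trans hχ.support⟩
    have e := h.integral_eq _ hχψ
    rw [setIntegral_test_smul _ (hχψ.multiD α).support] at e
    rw [Measure.restrict_univ]
    have e1 : ∫ x, multiD α ψ x • g x = ∫ x, multiD α (fun x => χ x • ψ x) x • g x := by
      congr 1; funext x
      by_cases hx : x ∈ K
      · rw [multiD_congr_of_eventuallyEq hψ.smooth hχψ.smooth α hU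
          (fun y hy => by simp [hχU y hy]) x (hKU hx)]
      · simp [hg x hx]
    have e2 : ∫ x in O, (χ x • ψ x) • v x = ∫ x in O, ψ x • K.indicator v x := by
      refine integral_congr_ae ?_
      filter_upwards [hv0] with x hx
      by_cases hxK : x ∈ K
      · simp [hxK, hχU x (hKU hxK)]
      · simp [hxK, hx hxK]
    have e3 : ∫ x in O, ψ x • K.indicator v x = ∫ x, ψ x • K.indicator v x := by
      refine setIntegral_eq_integral_of_forall_compl_eq_zero fun x hx => ?_
      rw [indicator_of_notMem fun h => hx (hKO h), smul_zero]
    rw [e1, e, e2, e3]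

/-- A function in `W^{m,1}_loc(O)` with compact support in `O` belongs to `W^{m,1}_0(O)`. -/
lemma memSobolevZero_of_compact (hO : IsOpen O) {m : ℕ} {K : Set (Sp n)} (hK : IsCompact K)
    (hKO : K ⊆ O) {φ : Sp n → Sp N} (hφ : MemSobolevLoc O m φ) (h0 : ∀ x ∉ K, φ x = 0) :
    MemSobolevZero O m φ := by
  have hind : ∀ {w : Sp n → Sp N}, LocallyIntegrableOn w O → Integrable (K.indicator w) := fun hw =>
    (integrable_indicator_iff hK.measurableSet).2 (hw.integrableOn_compact_subset hKO hK)
  have hext := fun α hα => (hφ.isWeakDeriv α hα).extend hO hK hKO h0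
  have hint : ∀ α, ∑ i, α i ≤ m → Integrable (K.indicator (weakD O α φ)) := fun α hα =>
    hind (hφ.isWeakDeriv α hα).locInt_deriv
  have hφK : K.indicator φ = φ := by
    funext x
    by_cases hx : x ∈ K <;> simp [hx, h0]
  have hφi : Integrable φ := by
    rw [← hφK]; exact hind (hφ.isWeakDeriv 0 (by simp)).locInt
  refine ⟨⟨hφi.integrableOn, fun α hα => ⟨_, hφ.isWeakDeriv α hα,
    (hint α hα).integrableOn.congr_fun_ae (hext α hα).2⟩⟩, ?_⟩
  -- the jet of the extension by zero, with `φ` itself as entry of order zero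
  let V : (Fin n → ℕ) → Sp n → Sp N := fun α =>
    if α = 0 then φ else K.indicator (weakD O α φ)
  have hVae : ∀ α, ∑ i, α i ≤ m → ∀ᵐ x, V α x = K.indicator (weakD O α φ) x := by
    intro α hα
    by_cases h : α = 0
    · subst h
      have := (hext 0 hα).1.ae_eq isOpen_univ (isWeakDeriv_zero
        (hφi.locallyIntegrable.locallyIntegrableOn univ))
      rw [Measure.restrict_univ] at this
      filter_upwards [this] with x hx
      simp [V, hx]
    · simp [V, h]
  have hVw : ∀ α, ∑ i, α i ≤ m → IsWeakDeriv univ α φ (V α) := fun α hα =>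
    (hext α hα).1.congr isOpen_univ (Eventually.of_forall fun _ => rfl) (by
      rw [Measure.restrict_univ]
      filter_upwards [hVae α hα] with x hx using hx.symm)
  have hV : IsJet univ m V := ⟨fun α hα => (hVw α hα).locInt_deriv, fun α i hα =>
    (hVw α hα.le).of_add_unitIdx (hVw _ (by rw [sum_add_unitIdx]; omega))⟩
  have hV0 : V 0 = φ := by simp [V]
  obtain ⟨δ, hδ, hδO⟩ := hK.exists_cthickening_subset_open hO hKO
  obtain ⟨ρ, hρ, hρδ⟩ := exists_bump_seq n hδ
  refine ⟨fun j => mollify (ρ j) φ, fun j => ?_, fun α hα => ?_⟩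
  · have hsupp : tsupport (mollify (ρ j) φ) ⊆ Metric.cthickening δ K := by
      refine closure_minimal (fun x hx => ?_) Metric.isClosed_cthickening
      by_contra hx'
      refine hx (mollify_eq_zero _ fun y hy => h0 y fun hyK => hx' ?_)
      refine Metric.mem_cthickening_of_dist_le x y δ K hyK ?_
      rw [dist_comm]
      exact (Metric.mem_ball.1 hy).le.trans (hρδ j)
    exact ⟨contDiff_mollify _ hφi.locallyIntegrable,
      (hK.cthickening (r := δ)).of_isClosed_subset (isClosed_tsupport _) hsupp, hsupp.trans hδO⟩
  · have hVi : Integrable (V α) := (hint α hα).congr (by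
      filter_upwards [hVae α hα] with x hx using hx.symm)
    have ht := tendsto_lintegral_mollify_sub hρ hVi
    have ht2 := (ENNReal.tendsto_toReal (by simp : (0 : ℝ≥0∞) ≠ ⊤)).comp ht
    simp only [Function.comp_def, ENNReal.toReal_zero] at ht2
    have hms : ∀ j, AEStronglyMeasurable (fun x => mollify (ρ j) (V α) x - V α x) volume :=
      fun j => (contDiff_mollify _ hVi.locallyIntegrable).continuous.aestronglyMeasurable.sub
        hVi.aestronglyMeasurable
    refine squeeze_zero' (Eventually.of_forall fun j => integral_nonneg fun _ => norm_nonneg _) ?_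
      ht2
    have hfin : ∀ᶠ j in atTop, ∫⁻ x, ‖mollify (ρ j) (V α) x - V α x‖ₑ < ⊤ :=
      ht.eventually_lt_const (by simp)
    filter_upwards [hfin] with j hj
    have hji : Integrable (fun x => mollify (ρ j) (V α) x - V α x) := ⟨hms j, hj⟩
    calc ∫ x in O, ‖multiD α (mollify (ρ j) φ) x - weakD O α φ x‖
        = ∫ x in O, ‖mollify (ρ j) (V α) x - V α x‖ := by
          refine integral_congr_ae ?_
          filter_upwards [(hext α hα).2, ae_restrict_of_ae (hVae α hα)] with x hx1 hx2
          rw [hx2, hx1, ← hV.multiD_mollify _ α hα, hV0]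
      _ ≤ ∫ x, ‖mollify (ρ j) (V α) x - V α x‖ :=
          setIntegral_le_integral hji.norm (Eventually.of_forall fun _ => norm_nonneg _)
      _ = _ := integral_norm_eq_lintegral_enorm (hms j)

end Cutoff

/-! ### Integral operators on Lebesgue spaces -/

section Kernel

variable {X : Type*} [MeasurableSpace X]

/-- Jensen's inequality for the measure with density `f`. -/
lemma rpow_lintegral_mul_le {ν : Measure X} {f g : X → ℝ≥0∞} (hf : AEMeasurable f ν)
    (hg : AEMeasurable g ν) {q : ℝ} (hq : 1 ≤ q) :
    (∫⁻ x, f x * g x ∂ν) ^ q ≤ (∫⁻ x, f x ∂ν) ^ (q - 1) * ∫⁻ x, f x * g x ^ q ∂ν := by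
  rcases hq.eq_or_lt with rfl | hq
  · simp
  have hc : (Real.conjExponent q).HolderConjugate q := (Real.HolderConjugate.conjExponent hq).symm
  set p := Real.conjExponent q with hp
  have hp0 : 0 < p := hc.pos
  have hq0 : 0 < q := by linarith
  have h := ENNReal.lintegral_mul_le_Lp_mul_Lq ν hc (f := fun x => f x ^ (1 / p))
    (g := fun x => f x ^ (1 / q) * g x) (hf.pow_const _) ((hf.pow_const _).mul hg)
  have e1 : ∀ x, f x ^ (1 / p) * (f x ^ (1 / q) * g x) = f x * g x := fun x => by
    rw [← mul_assoc, ← ENNReal.rpow_add_of_nonneg _ _ (by positivity) (by positivity)]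
    have : 1 / p + 1 / q = 1 := by simpa using hc.inv_add_inv_eq_one
    rw [this, ENNReal.rpow_one]
  have e2 : ∀ x, (f x ^ (1 / p)) ^ p = f x := fun x => by
    rw [← ENNReal.rpow_mul, one_div_mul_cancel hp0.ne', ENNReal.rpow_one]
  have e3 : ∀ x, (f x ^ (1 / q) * g x) ^ q = f x * g x ^ q := fun x => by
    rw [ENNReal.mul_rpow_of_nonneg _ _ hq0.le, ← ENNReal.rpow_mul, one_div_mul_cancel hq0.ne',
      ENNReal.rpow_one]
  simp only [Pi.mul_apply, e1, e2, e3] at h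
  have hpq : 1 / p * q = q - 1 := by
    have h1 : p⁻¹ + q⁻¹ = 1 := hc.inv_add_inv_eq_one
    have h2 : q⁻¹ * q = 1 := inv_mul_cancel₀ hq0.ne'
    rw [one_div]; linear_combination q * h1 - h2
  calc (∫⁻ x, f x * g x ∂ν) ^ q
      ≤ ((∫⁻ x, f x ∂ν) ^ (1 / p) * (∫⁻ x, f x * g x ^ q ∂ν) ^ (1 / q)) ^ q := by gcongr
    _ = _ := by
      rw [ENNReal.mul_rpow_of_nonneg _ _ hq0.le, ← ENNReal.rpow_mul, ← ENNReal.rpow_mul, hpq,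
        one_div_mul_cancel hq0.ne', ENNReal.rpow_one]

/-- An integral operator with kernel `K` maps `L^q` to `L^{qτ}` if `K` is in `L¹` in the second and
in `L^τ` in the first variable, uniformly in the other one. -/
lemma lintegral_rpow_kernel_le {ν : Measure X} [SFinite ν] {K : X → X → ℝ≥0∞}
    (hK : Measurable (Function.uncurry K)) {h : X → ℝ≥0∞} (hh : AEMeasurable h ν)
    {A : ℝ≥0∞} {q τ : ℝ} (hq : 1 ≤ q) (hτ : 1 ≤ τ)
    (h1 : ∀ᵐ x ∂ν, ∫⁻ z, K x z ∂ν ≤ A) (h2 : ∀ᵐ z ∂ν, ∫⁻ x, K x z ^ τ ∂ν ≤ A) :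
    ∫⁻ x, (∫⁻ z, h z * K x z ∂ν) ^ (q * τ) ∂ν ≤
      A ^ ((q - 1) * τ + 1) * (∫⁻ z, h z ^ q ∂ν) ^ τ := by
  have hq0 : 0 < q := by linarith
  have hτ0 : 0 < τ := by linarith
  have hKx : ∀ x, Measurable (K x) := fun x => hK.comp measurable_prodMk_left
  have hKz : ∀ z, Measurable fun x => K x z := fun z => hK.comp measurable_prodMk_right
  have hhq : AEMeasurable (fun z => h z ^ q) ν := hh.pow_const q
  have step : ∀ᵐ x ∂ν, (∫⁻ z, h z * K x z ∂ν) ^ (q * τ) ≤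
      A ^ ((q - 1) * τ) * ((∫⁻ z, h z ^ q ∂ν) ^ (τ - 1) * ∫⁻ z, h z ^ q * K x z ^ τ ∂ν) := by
    filter_upwards [h1] with x hx
    have s1 : (∫⁻ z, h z * K x z ∂ν) ^ q ≤ A ^ (q - 1) * ∫⁻ z, h z ^ q * K x z ∂ν := by
      have := rpow_lintegral_mul_le (hKx x).aemeasurable hh hq (ν := ν)
      simp only [mul_comm (K x _)] at this
      refine this.trans ?_
      gcongr
    calc (∫⁻ z, h z * K x z ∂ν) ^ (q * τ) = ((∫⁻ z, h z * K x z ∂ν) ^ q) ^ τ := by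
          rw [ENNReal.rpow_mul]
      _ ≤ (A ^ (q - 1) * ∫⁻ z, h z ^ q * K x z ∂ν) ^ τ := by gcongr
      _ = A ^ ((q - 1) * τ) * (∫⁻ z, h z ^ q * K x z ∂ν) ^ τ := by
          rw [ENNReal.mul_rpow_of_nonneg _ _ hτ0.le, ← ENNReal.rpow_mul]
      _ ≤ _ := by
          gcongr
          exact rpow_lintegral_mul_le hhq (hKx x).aemeasurable hτ
  have hm : AEMeasurable (fun p : X × X => h p.2 ^ q * K p.1 p.2 ^ τ) (ν.prod ν) :=
    (hhq.comp_snd).mul (hK.pow_const τ).aemeasurable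
  calc ∫⁻ x, (∫⁻ z, h z * K x z ∂ν) ^ (q * τ) ∂ν
      ≤ ∫⁻ x, A ^ ((q - 1) * τ) *
          ((∫⁻ z, h z ^ q ∂ν) ^ (τ - 1) * ∫⁻ z, h z ^ q * K x z ^ τ ∂ν) ∂ν := lintegral_mono_ae step
    _ = A ^ ((q - 1) * τ) * ((∫⁻ z, h z ^ q ∂ν) ^ (τ - 1) *
          ∫⁻ x, ∫⁻ z, h z ^ q * K x z ^ τ ∂ν ∂ν) := by
        have hm2 : AEMeasurable (fun x => ∫⁻ z, h z ^ q * K x z ^ τ ∂ν) ν :=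
          hm.lintegral_prod_right'
        rw [lintegral_const_mul'' _ (hm2.const_mul _), lintegral_const_mul'' _ hm2]
    _ ≤ A ^ ((q - 1) * τ) * ((∫⁻ z, h z ^ q ∂ν) ^ (τ - 1) * ((∫⁻ z, h z ^ q ∂ν) * A)) := by
        gcongr
        rw [lintegral_lintegral_swap hm, ← lintegral_mul_const'' _ hhq]
        refine lintegral_mono_ae ?_
        filter_upwards [h2] with z hz
        rw [lintegral_const_mul _ ((hKz z).pow_const τ)]
        gcongr
    _ = A ^ ((q - 1) * τ + 1) * (∫⁻ z, h z ^ q ∂ν) ^ τ := by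
        rw [ENNReal.rpow_add_of_nonneg _ _ (mul_nonneg (by linarith) hτ0.le) zero_le_one,
          ENNReal.rpow_one]
        have : (∫⁻ z, h z ^ q ∂ν) ^ τ = (∫⁻ z, h z ^ q ∂ν) ^ (τ - 1) * ∫⁻ z, h z ^ q ∂ν := by
          conv_lhs => rw [show τ = (τ - 1) + 1 by ring]
          rw [ENNReal.rpow_add_of_nonneg _ _ (by linarith) zero_le_one, ENNReal.rpow_one]
        rw [this]
        ring

end Kernel

/-! ### The Riesz potential of order one on balls -/

section Potential

variable {n N : ℕ}

/-- The Riesz kernel `(|x - z| / 2r)^{1-n}`, normalized for balls of radius `r`. -/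
noncomputable def riesz (n : ℕ) (r : ℝ) (x z : Sp n) : ℝ≥0∞ :=
  ENNReal.ofReal (‖z - x‖ / (2 * r)) ^ (-((n : ℝ) - 1))

lemma measurable_riesz (n : ℕ) (r : ℝ) : Measurable (Function.uncurry (riesz n r)) := by
  unfold riesz Function.uncurry
  fun_prop

lemma measurable_riesz_left (n : ℕ) (r : ℝ) (x : Sp n) : Measurable (riesz n r x) := by
  unfold riesz
  fun_prop

lemma riesz_comm (r : ℝ) (x z : Sp n) : riesz n r x z = riesz n r z x := by
  unfold riesz; rw [norm_sub_rev]

lemma lintegral_comp_add_smul (x : Sp n) {t : ℝ} (ht : 0 < t) {G : Sp n → ℝ≥0∞}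
    (hG : Measurable G) :
    ∫⁻ y, G (x + t • (y - x)) = ENNReal.ofReal (t ^ n)⁻¹ * ∫⁻ z, G z := by
  rw [lintegral_sub_right_eq_self (fun y => G (x + t • y)) x]
  have e : ∫⁻ y, G (x + t • y) = ∫⁻ y, G (x + y) ∂(Measure.map (t • ·) volume) := by
    rw [lintegral_map (f := fun y => G (x + y)) (hG.comp (measurable_const_add x))
      (measurable_const_smul t)]
  rw [e, Measure.map_addHaar_smul _ ht.ne', lintegral_smul_measure,
    lintegral_add_left_eq_self G x, finrank_euclideanSpace_fin, abs_of_pos (by positivity)]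
  rfl

/-- The Riesz kernel is integrable to powers less than `n / (n - 1)`. -/
lemma exists_lintegral_riesz_le (hn : 2 ≤ n) : ∃ A : ℝ, 1 ≤ A ∧ ∀ (x₀ : Sp n) (r : ℝ), 0 < r →
    ∀ τ : ℝ, 1 ≤ τ → ((n : ℝ) - 1) * τ ≤ n - 1 / 2 → ∀ x ∈ Metric.ball x₀ r,
      ∫⁻ z in Metric.ball x₀ r, riesz n r x z ^ τ ≤
        ENNReal.ofReal A * volume (Metric.ball x₀ r) := by
  have hn0 : (2 : ℝ) ≤ n := by exact_mod_cast hn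
  have : Nonempty (Fin n) := ⟨⟨0, by omega⟩⟩
  have : Nontrivial (Sp n) := inferInstance
  set s : ℝ := -((n : ℝ) - 1 / 2) with hs
  -- the kernel of the largest admissible power on the unit ball
  set I : ℝ≥0∞ := ∫⁻ y in Metric.ball (0 : Sp n) 1, ENNReal.ofReal ‖y‖ ^ s with hI
  have hIfin : I < ⊤ := by
    have h1 : IntegrableOn (fun y : Sp n => ‖y‖ ^ s) (Metric.ball 0 1) := by
      rw [integrableOn_fun_norm_addHaar (μ := (volume : Measure (Sp n))) (f := fun a => a ^ s)]
      rw [finrank_euclideanSpace_fin]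
      refine ((intervalIntegral.integrableOn_Ioo_rpow_iff (s := -(1 / 2)) one_pos).2
        (by norm_num)).congr_fun (fun y hy => ?_) measurableSet_Ioo
      have hy0 : 0 < y := hy.1
      simp only [smul_eq_mul]
      rw [← Real.rpow_natCast, ← Real.rpow_add hy0, Nat.cast_sub (by omega), hs]
      congr 1; push_cast; ring
    refine lt_of_eq_of_lt ?_ h1.2
    refine setLIntegral_congr_fun_ae Metric.isOpen_ball.measurableSet ?_
    have hne : ∀ᵐ y : Sp n, y ≠ 0 := by simp [ae_iff]
    filter_upwards [hne] with y hy _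
    have hy0 : 0 < ‖y‖ := norm_pos_iff.2 hy
    rw [ENNReal.ofReal_rpow_of_pos hy0, Real.enorm_of_nonneg (by positivity)]
  set v : ℝ≥0∞ := volume (Metric.ball (0 : Sp n) 1) with hv
  have hv0 : v ≠ 0 := (Metric.measure_ball_pos _ _ one_pos).ne'
  have hvt : v ≠ ⊤ := measure_ball_lt_top.ne
  refine ⟨max 1 (2 ^ n * I / v).toReal, le_max_left _ _, fun x₀ r hr τ hτ1 hτ x hx => ?_⟩
  have h2r : 0 < 2 * r := by linarith
  have hG : Measurable (fun y : Sp n =>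
      (Metric.ball (0 : Sp n) 1).indicator (fun y => ENNReal.ofReal ‖y‖ ^ s) y) :=
    (by fun_prop : Measurable fun y : Sp n => ENNReal.ofReal ‖y‖ ^ s).indicator
      Metric.isOpen_ball.measurableSet
  have hbd : ∀ z ∈ Metric.ball x₀ r, riesz n r x z ^ τ ≤
      (Metric.ball (0 : Sp n) 1).indicator (fun y => ENNReal.ofReal ‖y‖ ^ s)
        ((2 * r)⁻¹ • (z - x)) := by
    intro z hz
    have hzx : ‖z - x‖ < 2 * r := by
      rw [← dist_eq_norm]
      have := dist_triangle_right z x x₀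
      rw [Metric.mem_ball] at hx hz
      linarith
    have hnorm : ‖(2 * r)⁻¹ • (z - x)‖ = ‖z - x‖ / (2 * r) := by
      rw [norm_smul, Real.norm_eq_abs, abs_of_pos (inv_pos.2 h2r)]; field_simp
    have hlt : ‖z - x‖ / (2 * r) < 1 := (div_lt_one h2r).2 hzx
    rw [indicator_of_mem (by rw [mem_ball_zero_iff, hnorm]; exact hlt), hnorm, riesz,
      ← ENNReal.rpow_mul]
    refine ENNReal.rpow_le_rpow_of_exponent_ge ?_ (by rw [hs]; nlinarith)
    rw [← ENNReal.ofReal_one]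
    exact ENNReal.ofReal_le_ofReal hlt.le
  have hvol : volume (Metric.ball x₀ r) = ENNReal.ofReal (r ^ n) * v := by
    rw [Measure.addHaar_ball _ _ hr.le, finrank_euclideanSpace_fin]
  calc ∫⁻ z in Metric.ball x₀ r, riesz n r x z ^ τ
      ≤ ∫⁻ z in Metric.ball x₀ r, (Metric.ball (0 : Sp n) 1).indicator
          (fun y => ENNReal.ofReal ‖y‖ ^ s) ((2 * r)⁻¹ • (z - x)) :=
        setLIntegral_mono' Metric.isOpen_ball.measurableSet hbd
    _ ≤ ∫⁻ z, (Metric.ball (0 : Sp n) 1).indicator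
          (fun y => ENNReal.ofReal ‖y‖ ^ s) (0 + (2 * r)⁻¹ • ((z - x + 0) - 0)) := by
        simp only [zero_add, add_zero, sub_zero]
        exact setLIntegral_le_lintegral _ _
    _ = ENNReal.ofReal ((2 * r)⁻¹ ^ n)⁻¹ * I := by
        rw [lintegral_sub_right_eq_self (fun z => (Metric.ball (0 : Sp n) 1).indicator
          (fun y => ENNReal.ofReal ‖y‖ ^ s) (0 + (2 * r)⁻¹ • ((z + 0) - 0))) x]
        simp only [add_zero]
        rw [lintegral_comp_add_smul 0 (inv_pos.2 h2r) hG,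
          lintegral_indicator Metric.isOpen_ball.measurableSet]
    _ = (2 ^ n * I / v) * volume (Metric.ball x₀ r) := by
        have e1 : ENNReal.ofReal ((2 * r)⁻¹ ^ n)⁻¹ = 2 ^ n * ENNReal.ofReal (r ^ n) := by
          rw [inv_pow, inv_inv, mul_pow, ENNReal.ofReal_mul (by positivity),
            ENNReal.ofReal_pow (by norm_num)]
          norm_num
        rw [hvol, e1, div_eq_mul_inv]
        calc _ = (2 ^ n * I * ENNReal.ofReal (r ^ n)) * 1 := by ring
          _ = (2 ^ n * I * ENNReal.ofReal (r ^ n)) * (v⁻¹ * v) := by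
              rw [ENNReal.inv_mul_cancel hv0 hvt]
          _ = _ := by ring
    _ ≤ _ := by
        gcongr
        refine (ENNReal.ofReal_toReal (a := 2 ^ n * I / v)
          (ENNReal.div_ne_top (ENNReal.mul_ne_top (by simp) hIfin.ne) hv0)).ge.trans ?_
        exact ENNReal.ofReal_le_ofReal (le_max_right _ _)

lemma lintegral_inner_le (hn : 2 ≤ n) {r a : ℝ} (hr : 0 < r) (ha : 0 < a) :
    ∫⁻ t in Ioo (0 : ℝ) 1, ENNReal.ofReal (t ^ n)⁻¹ *
      (if a ≤ 2 * r * t then ENNReal.ofReal (t⁻¹ * a) else 0) ≤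
      ENNReal.ofReal (2 * r) * ENNReal.ofReal (a / (2 * r)) ^ (-((n : ℝ) - 1)) := by
  have hn0 : (2 : ℝ) ≤ n := by exact_mod_cast hn
  set b := a / (2 * r) with hb
  have h2r : 0 < 2 * r := by linarith
  have hb0 : 0 < b := by positivity
  have hab : a = 2 * r * b := by rw [hb]; field_simp
  have hexp : -((n : ℝ) + 1) < -1 := by linarith
  calc ∫⁻ t in Ioo (0 : ℝ) 1, ENNReal.ofReal (t ^ n)⁻¹ *
        (if a ≤ 2 * r * t then ENNReal.ofReal (t⁻¹ * a) else 0)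
      ≤ ∫⁻ t in Ioo (0 : ℝ) 1, (Ici b).indicator
          (fun t => ENNReal.ofReal (a * t ^ (-((n : ℝ) + 1)))) t := by
        refine setLIntegral_mono' measurableSet_Ioo fun t ht => ?_
        have ht0 : 0 < t := ht.1
        split_ifs with h
        · have hbt : b ≤ t := by rw [hab] at h; exact le_of_mul_le_mul_left h h2r
          rw [indicator_of_mem (mem_Ici.2 hbt), ← ENNReal.ofReal_mul (by positivity)]
          refine ENNReal.ofReal_le_ofReal (le_of_eq ?_)
          rw [Real.rpow_neg ht0.le, Real.rpow_add ht0, Real.rpow_natCast, Real.rpow_one]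
          field_simp
        · simp
    _ ≤ ∫⁻ t, (Ici b).indicator (fun t => ENNReal.ofReal (a * t ^ (-((n : ℝ) + 1)))) t :=
        setLIntegral_le_lintegral _ _
    _ = ∫⁻ t in Ioi b, ENNReal.ofReal (a * t ^ (-((n : ℝ) + 1))) := by
        rw [lintegral_indicator measurableSet_Ici]
        exact setLIntegral_congr Ioi_ae_eq_Ici.symm
    _ = ENNReal.ofReal (∫ t in Ioi b, a * t ^ (-((n : ℝ) + 1))) := by
        rw [ofReal_integral_eq_lintegral_ofReal]
        · exact (integrableOn_Ioi_rpow_of_lt hexp hb0).const_mul a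
        · filter_upwards [ae_restrict_mem measurableSet_Ioi] with t ht
          have : 0 < t := hb0.trans ht
          positivity
    _ ≤ ENNReal.ofReal (2 * r * b ^ (-((n : ℝ) - 1))) := by
        refine ENNReal.ofReal_le_ofReal ?_
        rw [integral_const_mul, integral_Ioi_rpow_of_lt hexp hb0, hab]
        have e1 : b ^ (-((n : ℝ) - 1)) = b * b ^ (-((n : ℝ) + 1) + 1) := by
          rw [← Real.rpow_one_add' hb0.le (by linarith)]
          congr 1; ring
        have hpos : 0 < b ^ (-((n : ℝ) + 1) + 1) := by positivity
        rw [e1]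
        have e2 : -b ^ (-((n : ℝ) + 1) + 1) / (-((n : ℝ) + 1) + 1) =
            b ^ (-((n : ℝ) + 1) + 1) / n := by
          rw [show -((n : ℝ) + 1) + 1 = -n by ring, neg_div_neg_eq]
        rw [e2, mul_assoc]
        have : b ^ (-((n : ℝ) + 1) + 1) / n ≤ b ^ (-((n : ℝ) + 1) + 1) :=
          div_le_self hpos.le (by linarith)
        gcongr
    _ = _ := by
        rw [ENNReal.ofReal_mul h2r.le, ENNReal.ofReal_rpow_of_pos hb0]

end Potential

/-! ### The Sobolev–Poincaré inequality on balls -/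

section Poincare

variable {n N : ℕ}

lemma enorm_sub_le_lintegral_segment {F : Type*} [NormedAddCommGroup F] [NormedSpace ℝ F]
    [CompleteSpace F] {w : Sp n → F} (hw : ContDiff ℝ ∞ w) (x y : Sp n) :
    ‖w x - w y‖ₑ ≤ ∫⁻ t in Ioo (0 : ℝ) 1, ‖fderiv ℝ w (x + t • (y - x))‖ₑ * ‖y - x‖ₑ := by
  have hd : ∀ t : ℝ, HasDerivAt (fun t : ℝ => w (x + t • (y - x)))
      (fderiv ℝ w (x + t • (y - x)) (y - x)) t := by
    intro t
    have h1 : HasDerivAt (fun t : ℝ => x + t • (y - x)) (y - x) t := by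
      simpa using ((hasDerivAt_id t).smul_const (y - x)).const_add x
    exact ((hw.differentiable (by simp) _).hasFDerivAt).comp_hasDerivAt t h1
  have hc : Continuous fun t : ℝ => fderiv ℝ w (x + t • (y - x)) (y - x) := by
    have := hw.continuous_fderiv (by simp)
    fun_prop
  have h := intervalIntegral.integral_eq_sub_of_hasDerivAt (a := 0) (b := 1) (fun t _ => hd t)
    (hc.intervalIntegrable _ _)
  simp only [one_smul, add_sub_cancel, zero_smul, add_zero] at h
  rw [enorm_sub_rev, ← h, intervalIntegral.integral_of_le zero_le_one,
    integral_Ioc_eq_integral_Ioo]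
  refine (enorm_integral_le_lintegral_enorm _).trans (lintegral_mono fun t => ?_)
  exact ContinuousLinearMap.le_opENorm _ _

/-- The oscillation of a smooth function is bounded by the Riesz potential of its gradient. -/
lemma lintegral_enorm_sub_le_riesz_smooth (hn : 2 ≤ n) {F : Type*} [NormedAddCommGroup F]
    [NormedSpace ℝ F] [CompleteSpace F] {w : Sp n → F} (hw : ContDiff ℝ ∞ w) {x₀ : Sp n} {r : ℝ}
    (hr : 0 < r) {x : Sp n} (hx : x ∈ Metric.ball x₀ r) :
    ∫⁻ y in Metric.ball x₀ r, ‖w x - w y‖ₑ ≤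
      ENNReal.ofReal (2 * r) * ∫⁻ z in Metric.ball x₀ r, ‖fderiv ℝ w z‖ₑ * riesz n r x z := by
  set B := Metric.ball x₀ r with hB
  have hBm : MeasurableSet B := Metric.isOpen_ball.measurableSet
  set h : Sp n → ℝ≥0∞ := B.indicator fun z => ‖fderiv ℝ w z‖ₑ with hh
  have hhm : Measurable h :=
    (hw.continuous_fderiv (by simp)).enorm.measurable.indicator hBm
  obtain ⟨G, hG⟩ : ∃ G : ℝ → Sp n → ℝ≥0∞, ∀ t z, G t z =
      h z * (if ‖z - x‖ ≤ 2 * r * t then ENNReal.ofReal (t⁻¹ * ‖z - x‖) else 0) :=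
    ⟨_, fun _ _ => rfl⟩
  have hGm : Measurable (Function.uncurry G) := by
    have e : Function.uncurry G = fun p : ℝ × Sp n => h p.2 *
        (if ‖p.2 - x‖ ≤ 2 * r * p.1 then ENNReal.ofReal (p.1⁻¹ * ‖p.2 - x‖) else 0) := by
      funext p
      exact hG p.1 p.2
    rw [e]
    refine (hhm.comp measurable_snd).mul (Measurable.ite ?_ (by fun_prop) measurable_const)
    exact measurableSet_le (by fun_prop) (by fun_prop)
  have hseg : ∀ y ∈ B, ∀ t ∈ Ioo (0 : ℝ) 1,
      ‖fderiv ℝ w (x + t • (y - x))‖ₑ * ‖y - x‖ₑ ≤ G t (x + t • (y - x)) := by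
    intro y hy t ht
    have hmem : x + t • (y - x) ∈ B :=
      (convex_ball x₀ r).add_smul_sub_mem hx hy ⟨ht.1.le, ht.2.le⟩
    have hn1 : ‖x + t • (y - x) - x‖ = t * ‖y - x‖ := by
      rw [add_sub_cancel_left, norm_smul, Real.norm_eq_abs, abs_of_pos ht.1]
    have hyx : ‖y - x‖ ≤ 2 * r := by
      rw [← dist_eq_norm]
      have := dist_triangle_right y x x₀
      rw [hB, Metric.mem_ball] at hx hy
      linarith
    rw [hG, hh, indicator_of_mem hmem, hn1, if_pos (by nlinarith [ht.1]),
          inv_mul_cancel_left₀ ht.1.ne', ofReal_norm]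
  calc ∫⁻ y in B, ‖w x - w y‖ₑ
      ≤ ∫⁻ y in B, ∫⁻ t in Ioo (0 : ℝ) 1, G t (x + t • (y - x)) := by
        refine setLIntegral_mono' hBm fun y hy => (enorm_sub_le_lintegral_segment hw x y).trans ?_
        exact setLIntegral_mono' measurableSet_Ioo fun t ht => hseg y hy t ht
    _ ≤ ∫⁻ y, ∫⁻ t in Ioo (0 : ℝ) 1, G t (x + t • (y - x)) := setLIntegral_le_lintegral _ _
    _ = ∫⁻ t in Ioo (0 : ℝ) 1, ∫⁻ y, G t (x + t • (y - x)) := by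
        have m : Measurable fun p : Sp n × ℝ => Function.uncurry G (p.2, x + p.2 • (p.1 - x)) :=
          hGm.comp (by fun_prop)
        exact lintegral_lintegral_swap m.aemeasurable
    _ = ∫⁻ t in Ioo (0 : ℝ) 1, ∫⁻ z, ENNReal.ofReal (t ^ n)⁻¹ * G t z := by
        refine setLIntegral_congr_fun measurableSet_Ioo fun t ht => ?_
        have hGt : Measurable (G t) := hGm.comp measurable_prodMk_left
        rw [lintegral_comp_add_smul x ht.1 hGt, lintegral_const_mul _ hGt]
    _ = ∫⁻ z, ∫⁻ t in Ioo (0 : ℝ) 1, ENNReal.ofReal (t ^ n)⁻¹ * G t z := by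
        have m : Measurable fun p : ℝ × Sp n =>
            ENNReal.ofReal (p.1 ^ n)⁻¹ * Function.uncurry G p := Measurable.mul (by fun_prop) hGm
        exact lintegral_lintegral_swap m.aemeasurable
    _ ≤ ∫⁻ z, ENNReal.ofReal (2 * r) * (h z * riesz n r x z) := by
        have hne : ∀ᵐ z : Sp n, z ≠ x := by
          have : (Nonempty (Fin n)) := ⟨⟨0, by omega⟩⟩
          simp [ae_iff]
        refine lintegral_mono_ae ?_
        filter_upwards [hne] with z hz
        have hz0 : 0 < ‖z - x‖ := norm_pos_iff.2 (sub_ne_zero.2 hz)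
        have e : ∀ t : ℝ, ENNReal.ofReal (t ^ n)⁻¹ * G t z = h z * (ENNReal.ofReal (t ^ n)⁻¹ *
            (if ‖z - x‖ ≤ 2 * r * t then ENNReal.ofReal (t⁻¹ * ‖z - x‖) else 0)) :=
          fun t => by rw [hG]; exact mul_left_comm _ _ _
        simp only [e]
        rw [lintegral_const_mul]
        · calc _ ≤ h z * (ENNReal.ofReal (2 * r) *
              ENNReal.ofReal (‖z - x‖ / (2 * r)) ^ (-((n : ℝ) - 1))) := by
                gcongr
                exact lintegral_inner_le hn hr hz0
            _ = _ := by rw [riesz]; exact mul_left_comm _ _ _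
        · refine Measurable.mul (by fun_prop) (Measurable.ite ?_ (by fun_prop) measurable_const)
          exact measurableSet_le (by fun_prop) (by fun_prop)
    _ = ENNReal.ofReal (2 * r) * ∫⁻ z in B, ‖fderiv ℝ w z‖ₑ * riesz n r x z := by
        rw [lintegral_const_mul' _ _ ENNReal.ofReal_ne_top, ← lintegral_indicator hBm]
        congr 2
        funext z
        by_cases hz : z ∈ B <;> simp [hh, hz]

lemma enorm_fderiv_le_sum {F : Type*} [NormedAddCommGroup F] [NormedSpace ℝ F] (w : Sp n → F)
    (x : Sp n) : ‖fderiv ℝ w x‖ₑ ≤ ∑ i, ‖partialD i w x‖ₑ := by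
  have h : ‖fderiv ℝ w x‖ ≤ ∑ i, ‖partialD i w x‖ := by
    refine ContinuousLinearMap.opNorm_le_bound _ (Finset.sum_nonneg fun _ _ => norm_nonneg _)
      fun v => ?_
    have hv : v = ∑ i, v i • EuclideanSpace.single i (1 : ℝ) := by
      ext j
      simp [Finset.sum_apply, Pi.single_apply]
    conv_lhs => rw [hv]
    rw [map_sum, Finset.sum_mul]
    refine (norm_sum_le _ _).trans (Finset.sum_le_sum fun i _ => ?_)
    rw [map_smul, norm_smul, mul_comm]
    exact mul_le_mul_of_nonneg_left (PiLp.norm_apply_le v i) (norm_nonneg _)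
  rw [← ofReal_norm]
  refine (ENNReal.ofReal_le_ofReal h).trans ?_
  rw [ENNReal.ofReal_sum_of_nonneg fun _ _ => norm_nonneg _]
  simp

/-- Interior approximation: on a ball `B ⋐ O` a weakly differentiable function and its gradient are
limits in `L¹(B)` of smooth functions and their gradients. -/
lemma exists_smooth_approx {O : Set (Sp n)} (hO : IsOpen O) {w : Sp n → Sp N}
    {v : Fin n → Sp n → Sp N} (hwl : LocallyIntegrableOn w O)
    (hw : ∀ i, IsWeakDeriv O (unitIdx i) w (v i)) {K : Set (Sp n)} (hK : IsCompact K)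
    (hKO : K ⊆ O) :
    ∃ W : ℕ → Sp n → Sp N, (∀ j, ContDiff ℝ ∞ (W j)) ∧
      Tendsto (fun j => ∫⁻ x in K, ‖W j x - w x‖ₑ) atTop (𝓝 0) ∧
      ∀ i, Tendsto (fun j => ∫⁻ x in K, ‖partialD i (W j) x - v i x‖ₑ) atTop (𝓝 0) := by
  obtain ⟨χ, hχ, U, hU, hKU, hχU⟩ := exists_compact_cutoff hO hK hKO
  set g : Sp n → Sp N := fun x => χ x • w x with hg
  have hgi : Integrable g :=
    integrable_test_smul hχ.smooth.continuous hχ.compact hχ.support hwl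
  have hg0 : ∀ x ∉ tsupport χ, g x = 0 := fun x hx => by
    simp [hg, image_eq_zero_of_notMem_tsupport hx]
  have hd : ∀ i, IsWeakDeriv univ (unitIdx i) g ((tsupport χ).indicator
      (fun x => partialD i χ x • w x + χ x • v i x)) := fun i =>
    (((hw i).smul_left hO hχ.smooth).extend hO hχ.compact hχ.support hg0).1
  obtain ⟨ρ, hρ, -⟩ := exists_bump_seq n one_pos
  have hKe : ∀ x ∈ K, χ x = 1 ∧ ∀ i, partialD i χ x = 0 := fun x hx => by
    refine ⟨hχU x (hKU hx), fun i => ?_⟩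
    have : χ =ᶠ[𝓝 x] fun _ => 1 := by
      filter_upwards [hU.mem_nhds (hKU hx)] with y hy using hχU y hy
    simp [partialD, this.fderiv_eq]
  refine ⟨fun j => mollify (ρ j) g, fun j => contDiff_mollify _ hgi.locallyIntegrable, ?_,
    fun i => ?_⟩
  · refine tendsto_of_tendsto_of_tendsto_of_le_of_le tendsto_const_nhds
      (tendsto_lintegral_mollify_sub hρ hgi) (fun _ => zero_le) fun j => ?_
    refine le_trans (le_of_eq ?_) (setLIntegral_le_lintegral K _)
    refine setLIntegral_congr_fun hK.measurableSet fun x hx => ?_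
    simp [hg, (hKe x hx).1]
  · set h := (tsupport χ).indicator (fun x => partialD i χ x • w x + χ x • v i x) with hh
    have hhi : Integrable h := by
      rw [hh, integrable_indicator_iff (isClosed_tsupport χ).measurableSet]
      exact ((hw i).smul_left hO hχ.smooth).locInt_deriv.integrableOn_compact_subset
        hχ.support hχ.compact
    refine tendsto_of_tendsto_of_tendsto_of_le_of_le tendsto_const_nhds
      (tendsto_lintegral_mollify_sub hρ hhi) (fun _ => zero_le) fun j => ?_
    refine le_trans (le_of_eq ?_) (setLIntegral_le_lintegral K _)
    refine setLIntegral_congr_fun hK.measurableSet fun x hx => ?_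
    have hxs : x ∈ tsupport χ := subset_tsupport χ (by simp [(hKe x hx).1])
    simp only
    rw [partialD_mollify _ (hd i), hh, indicator_of_mem hxs (fun x => partialD i χ x • w x +
      χ x • v i x), (hKe x hx).1, (hKe x hx).2 i]
    simp

end Poincare

section Poincare

variable {n N : ℕ}

/-- The oscillation of a weakly differentiable function is bounded almost everywhere by the Riesz
potential of its gradient. -/
lemma lintegral_enorm_sub_le_riesz (hn : 2 ≤ n) {O : Set (Sp n)} (hO : IsOpen O)
    {w : Sp n → Sp N} {v : Fin n → Sp n → Sp N} (hwl : LocallyIntegrableOn w O)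
    (hw : ∀ i, IsWeakDeriv O (unitIdx i) w (v i)) {x₀ : Sp n} {r : ℝ} (hr : 0 < r)
    (hB : Metric.closedBall x₀ r ⊆ O) :
    ∀ᵐ x ∂(volume.restrict (Metric.ball x₀ r)),
      ∫⁻ y in Metric.ball x₀ r, ‖w x - w y‖ₑ ≤
        ENNReal.ofReal (2 * r) * ∫⁻ z in Metric.ball x₀ r, (∑ i, ‖v i z‖ₑ) * riesz n r x z := by
  obtain ⟨A, hA1, hA⟩ := exists_lintegral_riesz_le (n := n) hn
  obtain ⟨W, hWs, hWt, hWdt⟩ := exists_smooth_approx hO hwl hw (isCompact_closedBall x₀ r) hB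
  set B := Metric.ball x₀ r with hBdef
  set ν := volume.restrict B with hν
  have hBm : MeasurableSet B := Metric.isOpen_ball.measurableSet
  have hsub : B ⊆ Metric.closedBall x₀ r := Metric.ball_subset_closedBall
  have hKm := measurable_riesz n r
  have hwm : AEStronglyMeasurable w ν :=
    (hwl.integrableOn_compact_subset hB (isCompact_closedBall x₀ r)).aestronglyMeasurable.mono_set
      hsub
  have hvm : ∀ i, AEStronglyMeasurable (v i) ν := fun i =>
    ((hw i).locInt_deriv.integrableOn_compact_subset hB
      (isCompact_closedBall x₀ r)).aestronglyMeasurable.mono_set hsub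
  have hBfin : volume B ≠ ⊤ := measure_ball_lt_top.ne
  obtain ⟨T, hT⟩ : ∃ T : Sp n → ℝ≥0∞, T = fun x => ∫⁻ y, ‖w x - w y‖ₑ ∂ν := ⟨_, rfl⟩
  obtain ⟨R, hR⟩ : ∃ R : Sp n → ℝ≥0∞, R = fun x => ENNReal.ofReal (2 * r) *
    ∫⁻ z, (∑ i, ‖v i z‖ₑ) * riesz n r x z ∂ν := ⟨_, rfl⟩
  have hTm : AEMeasurable T ν := by
    rw [hT]
    exact AEMeasurable.lintegral_prod_right' (f := fun p : Sp n × Sp n => ‖w p.1 - w p.2‖ₑ)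
      ((hwm.comp_fst.sub hwm.comp_snd).enorm)
  have hRm : AEMeasurable R ν := by
    rw [hR]
    refine AEMeasurable.const_mul (AEMeasurable.lintegral_prod_right'
      (f := fun p : Sp n × Sp n => (∑ i, ‖v i p.2‖ₑ) * riesz n r p.1 p.2) ?_) _
    exact (Finset.aemeasurable_fun_sum _ fun i _ => ((hvm i).comp_snd).enorm).mul hKm.aemeasurable
  -- the error made by replacing `w` by its approximation
  obtain ⟨E, hE⟩ : ∃ E : ℕ → Sp n → ℝ≥0∞, E = fun j x => volume B * ‖W j x - w x‖ₑ +
    (∫⁻ y, ‖W j y - w y‖ₑ ∂ν) + ENNReal.ofReal (2 * r) *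
      ∫⁻ z, (∑ i, ‖partialD i (W j) z - v i z‖ₑ) * riesz n r x z ∂ν := ⟨_, rfl⟩
  have hWm : ∀ j, AEStronglyMeasurable (fun x => W j x - w x) ν := fun j =>
    (hWs j).continuous.aestronglyMeasurable.sub hwm
  have hDm : ∀ j i, AEStronglyMeasurable (fun z => partialD i (W j) z - v i z) ν := fun j i =>
    (contDiff_partialD (hWs j) i).continuous.aestronglyMeasurable.sub (hvm i)
  have hDsm : ∀ j, AEMeasurable (fun z => ∑ i, ‖partialD i (W j) z - v i z‖ₑ) ν := fun j =>
    Finset.aemeasurable_fun_sum _ fun i _ => (hDm j i).enorm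
  have hKx : ∀ x, Measurable (riesz n r x) := fun x => measurable_riesz_left n r x
  have hpt : ∀ j, ∀ x ∈ B, T x - R x ≤ E j x := by
    intro j x hx
    rw [tsub_le_iff_right]
    have s1 : T x ≤ volume B * ‖W j x - w x‖ₑ + (∫⁻ y, ‖W j y - w y‖ₑ ∂ν) +
        ∫⁻ y, ‖W j x - W j y‖ₑ ∂ν := by
      rw [hT]
      calc _ ≤ ∫⁻ y, (‖W j x - w x‖ₑ + ‖W j y - w y‖ₑ + ‖W j x - W j y‖ₑ) ∂ν := by
            refine lintegral_mono fun y => ?_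
            have : w x - w y = (W j x - W j y) - (W j x - w x) + (W j y - w y) := by abel
            rw [this]
            refine (enorm_add_le _ _).trans ?_
            calc _ ≤ ‖W j x - W j y‖ₑ + ‖W j x - w x‖ₑ + ‖W j y - w y‖ₑ := by
                  gcongr; exact enorm_sub_le
              _ = _ := by rw [add_comm, add_comm ‖W j x - W j y‖ₑ, ← add_assoc,
                  add_comm ‖W j y - w y‖ₑ]
        _ = _ := by
            have m1 : AEMeasurable (fun y => ‖W j x - w x‖ₑ + ‖W j y - w y‖ₑ) ν :=
              aemeasurable_const.add (hWm j).enorm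
            rw [lintegral_add_left' m1, lintegral_add_left' aemeasurable_const, lintegral_const,
              hν, Measure.restrict_apply_univ, mul_comm]
    have s2 : ∫⁻ y, ‖W j x - W j y‖ₑ ∂ν ≤ R x + ENNReal.ofReal (2 * r) *
        ∫⁻ z, (∑ i, ‖partialD i (W j) z - v i z‖ₑ) * riesz n r x z ∂ν := by
      refine (lintegral_enorm_sub_le_riesz_smooth hn (hWs j) hr hx).trans ?_
      rw [hR]
      simp only
      have m : AEMeasurable (fun z => (∑ i, ‖partialD i (W j) z - v i z‖ₑ) * riesz n r x z) ν :=
        (hDsm j).mul (hKx x).aemeasurable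
      rw [← mul_add, ← lintegral_add_right' _ m]
      gcongr with z
      rw [← add_mul]
      gcongr
      refine (enorm_fderiv_le_sum _ _).trans ?_
      rw [← Finset.sum_add_distrib]
      refine Finset.sum_le_sum fun i _ => ?_
      calc ‖partialD i (W j) z‖ₑ = ‖v i z + (partialD i (W j) z - v i z)‖ₑ := by congr 1; abel
        _ ≤ _ := enorm_add_le _ _
    calc T x ≤ _ := s1
      _ ≤ _ := add_le_add_right s2 _
      _ = E j x + R x := by rw [hE, ← add_assoc]; exact add_right_comm _ _ _
  have hker : ∀ z ∈ B, ∫⁻ x, riesz n r x z ∂ν ≤ ENNReal.ofReal A * volume B := by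
    intro z hz
    have hn2 : (2 : ℝ) ≤ n := by exact_mod_cast hn
    have := hA x₀ r hr 1 le_rfl (by linarith) z hz
    simpa only [ENNReal.rpow_one, riesz_comm r z] using this
  have hEint : ∀ j, ∫⁻ x, E j x ∂ν ≤ 2 * volume B * (∫⁻ y, ‖W j y - w y‖ₑ ∂ν) +
      ENNReal.ofReal (2 * r) * (ENNReal.ofReal A * volume B) *
        ∑ i, ∫⁻ z, ‖partialD i (W j) z - v i z‖ₑ ∂ν := by
    intro j
    have m1 : AEMeasurable (fun x => volume B * ‖W j x - w x‖ₑ) ν := (hWm j).enorm.const_mul _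
    have m3 : AEMeasurable (fun p : Sp n × Sp n =>
        (∑ i, ‖partialD i (W j) p.2 - v i p.2‖ₑ) * riesz n r p.1 p.2) (ν.prod ν) :=
      ((hDsm j).comp_snd).mul hKm.aemeasurable
    have m12 : AEMeasurable (fun x => volume B * ‖W j x - w x‖ₑ + ∫⁻ y, ‖W j y - w y‖ₑ ∂ν) ν :=
      m1.add aemeasurable_const
    rw [hE]
    simp only
    rw [lintegral_add_left' m12, lintegral_add_left' m1,
      lintegral_const_mul'' _ (hWm j).enorm, lintegral_const,
      lintegral_const_mul'' _ m3.lintegral_prod_right', hν, Measure.restrict_apply_univ, ← hν,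
      lintegral_lintegral_swap m3]
    refine add_le_add (le_of_eq (by rw [two_mul, add_mul, mul_comm (lintegral _ _)])) ?_
    rw [mul_assoc]
    gcongr
    rw [← lintegral_finsetSum' _ fun i _ => (hDm j i).enorm, ← lintegral_const_mul'' _ (hDsm j)]
    refine setLIntegral_mono' hBm fun z hz => ?_
    have e : ∀ x, riesz n r x z = riesz n r z x := fun x => riesz_comm r x z
    have hk := hker z hz
    simp only [e] at hk ⊢
    rw [lintegral_const_mul _ (measurable_riesz_left n r z), mul_comm]
    gcongr
  have hlim : Tendsto (fun j => 2 * volume B * (∫⁻ y, ‖W j y - w y‖ₑ ∂ν) +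
      ENNReal.ofReal (2 * r) * (ENNReal.ofReal A * volume B) *
        ∑ i, ∫⁻ z, ‖partialD i (W j) z - v i z‖ₑ ∂ν) atTop (𝓝 0) := by
    have l1 : Tendsto (fun j => ∫⁻ y, ‖W j y - w y‖ₑ ∂ν) atTop (𝓝 0) :=
      tendsto_of_tendsto_of_tendsto_of_le_of_le tendsto_const_nhds hWt (fun _ => zero_le)
        fun j => lintegral_mono_set hsub
    have l2 : ∀ i, Tendsto (fun j => ∫⁻ z, ‖partialD i (W j) z - v i z‖ₑ ∂ν) atTop (𝓝 0) :=
      fun i => tendsto_of_tendsto_of_tendsto_of_le_of_le tendsto_const_nhds (hWdt i)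
        (fun _ => zero_le) fun j => lintegral_mono_set hsub
    have l3 := tendsto_finsetSum Finset.univ fun i _ => l2 i
    have l4 := (ENNReal.Tendsto.const_mul (a := 2 * volume B) l1 (Or.inr
      (ENNReal.mul_ne_top (by simp) hBfin))).add (ENNReal.Tendsto.const_mul
      (a := ENNReal.ofReal (2 * r) * (ENNReal.ofReal A * volume B)) l3 (Or.inr
      (ENNReal.mul_ne_top ENNReal.ofReal_ne_top (ENNReal.mul_ne_top (by simp) hBfin))))
    simpa only [Finset.sum_const_zero, mul_zero, add_zero] using l4
  have hzero : ∫⁻ x, (T x - R x) ∂ν = 0 := by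
    refine le_antisymm (ge_of_tendsto' hlim fun j => ?_) zero_le
    exact (setLIntegral_mono' hBm (hpt j)).trans (hEint j)
  have := (lintegral_eq_zero_iff' (hTm.sub hRm)).1 hzero
  filter_upwards [this] with x hx
  rw [hT, hR] at hx
  exact tsub_eq_zero_iff_le.1 hx

end Poincare

section Poincare

variable {n N : ℕ}

/-- The Sobolev–Poincaré inequality for functions with mean value zero on a ball, with a gain of
integrability from `q` to `qτ` that is uniform in `q ≥ 1`. -/
lemma exists_sobolev_poincare (hn : 2 ≤ n) : ∃ C : ℝ, 1 ≤ C ∧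
    ∀ {N : ℕ} {O : Set (Sp n)} {w : Sp n → Sp N} {v : Fin n → Sp n → Sp N} {x₀ : Sp n} {r q τ : ℝ},
      IsOpen O → LocallyIntegrableOn w O → (∀ i, IsWeakDeriv O (unitIdx i) w (v i)) →
      0 < r → Metric.closedBall x₀ r ⊆ O → ∫ x in Metric.ball x₀ r, w x = 0 →
      1 ≤ q → 1 ≤ τ → ((n : ℝ) - 1) * τ ≤ n - 1 / 2 →
      ⨍⁻ x in Metric.ball x₀ r, ‖w x‖ₑ ^ (q * τ) ∂volume ≤
        ENNReal.ofReal (C * r) ^ (q * τ) *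
          (⨍⁻ x in Metric.ball x₀ r, (∑ i, ‖v i x‖ₑ) ^ q ∂volume) ^ τ := by
  obtain ⟨A, hA1, hA⟩ := exists_lintegral_riesz_le (n := n) hn
  refine ⟨2 * A, by linarith, ?_⟩
  intro N O w v x₀ r q τ hO hwl hw hr hB hw0 hq hτ hτn
  have hae := lintegral_enorm_sub_le_riesz hn hO hwl hw hr hB
  set B := Metric.ball x₀ r with hBdef
  have hBm : MeasurableSet B := Metric.isOpen_ball.measurableSet
  have hsub : B ⊆ Metric.closedBall x₀ r := Metric.ball_subset_closedBall
  have hV0 : volume B ≠ 0 := (Metric.measure_ball_pos _ _ hr).ne'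
  have hVt : volume B ≠ ⊤ := measure_ball_lt_top.ne
  have hwi : IntegrableOn w B :=
    (hwl.integrableOn_compact_subset hB (isCompact_closedBall x₀ r)).mono_set hsub
  have hvm : ∀ i, AEStronglyMeasurable (v i) (volume.restrict B) := fun i =>
    ((hw i).locInt_deriv.integrableOn_compact_subset hB
      (isCompact_closedBall x₀ r)).aestronglyMeasurable.mono_set hsub
  obtain ⟨ν, hν⟩ : ∃ ν : Measure (Sp n), ν = (volume B)⁻¹ • volume.restrict B := ⟨_, rfl⟩
  have hνl : ∀ f : Sp n → ℝ≥0∞, ∫⁻ x, f x ∂ν = (volume B)⁻¹ * ∫⁻ x in B, f x := fun f => by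
    rw [hν, lintegral_smul_measure]; rfl
  have hνa : ∀ f : Sp n → ℝ≥0∞, ⨍⁻ x in B, f x ∂volume = ∫⁻ x, f x ∂ν := fun f => by
    rw [hνl, setLAverage_eq, ENNReal.div_eq_inv_mul]
  have hνac : ∀ {p : Sp n → Prop}, (∀ᵐ x ∂(volume.restrict B), p x) → ∀ᵐ x ∂ν, p x := fun h => by
    rw [hν]; exact Measure.ae_smul_measure h _
  have hfin : IsFiniteMeasure ν := by
    rw [hν]
    have : IsFiniteMeasure (volume.restrict B) := ⟨by simpa using hVt.lt_top⟩
    exact Measure.smul_finite _ (ENNReal.inv_ne_top.2 hV0)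
  obtain ⟨h, hh⟩ : ∃ h : Sp n → ℝ≥0∞, h = fun z => ∑ i, ‖v i z‖ₑ := ⟨_, rfl⟩
  have hhm : AEMeasurable h ν := by
    have : AEMeasurable h (volume.restrict B) := by
      rw [hh]
      exact Finset.aemeasurable_fun_sum _ fun i _ => (hvm i).enorm
    rw [hν]
    exact this.smul_measure _
  have hcancel : (volume B)⁻¹ * (ENNReal.ofReal A * volume B) = ENNReal.ofReal A := by
    rw [mul_left_comm, ENNReal.inv_mul_cancel hV0 hVt, mul_one]
  have hker : ∀ τ' : ℝ, 1 ≤ τ' → ((n : ℝ) - 1) * τ' ≤ n - 1 / 2 → ∀ᵐ x ∂ν,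
      ∫⁻ z, riesz n r x z ^ τ' ∂ν ≤ ENNReal.ofReal A := fun τ' h1 h2 => by
    refine hνac ?_
    filter_upwards [ae_restrict_mem hBm] with x hx
    rw [hνl, ← hcancel]
    gcongr
    exact hA x₀ r hr τ' h1 h2 x hx
  have hn2 : (2 : ℝ) ≤ n := by exact_mod_cast hn
  have hk1 : ∀ᵐ x ∂ν, ∫⁻ z, riesz n r x z ∂ν ≤ ENNReal.ofReal A := by
    simpa only [ENNReal.rpow_one] using hker 1 le_rfl (by linarith)
  have hk2 : ∀ᵐ z ∂ν, ∫⁻ x, riesz n r x z ^ τ ∂ν ≤ ENNReal.ofReal A := by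
    filter_upwards [hker τ hτ hτn] with z hz
    have e : ∀ x, riesz n r x z = riesz n r z x := fun x => riesz_comm r x z
    simpa only [e] using hz
  have main := lintegral_rpow_kernel_le (measurable_riesz n r) hhm hq hτ hk1 hk2
  have hpt : ∀ᵐ x ∂ν, ‖w x‖ₑ ≤ ENNReal.ofReal (2 * r) * ∫⁻ z, h z * riesz n r x z ∂ν := by
    refine hνac ?_
    filter_upwards [hae] with x hx
    have e1 : (volume.real B) • w x = ∫ y in B, (w x - w y) := by
      rw [integral_sub (integrable_const_iff.2 (Or.inr ⟨by simpa using hVt.lt_top⟩)) hwi, hw0,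
        sub_zero, integral_const]
      simp
    have e2 : volume B * ‖w x‖ₑ ≤ ∫⁻ y in B, ‖w x - w y‖ₑ := by
      have := enorm_integral_le_lintegral_enorm (μ := volume.restrict B) fun y => w x - w y
      rw [← e1, enorm_smul, Real.enorm_of_nonneg measureReal_nonneg,
        ofReal_measureReal hVt] at this
      exact this
    rw [hνl, hh]
    calc ‖w x‖ₑ = (volume B)⁻¹ * (volume B * ‖w x‖ₑ) := by
          rw [← mul_assoc, ENNReal.inv_mul_cancel hV0 hVt, one_mul]
      _ ≤ (volume B)⁻¹ * (ENNReal.ofReal (2 * r) *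
            ∫⁻ z in B, (∑ i, ‖v i z‖ₑ) * riesz n r x z) := by
          exact mul_le_mul_right (e2.trans hx) _
      _ = _ := mul_left_comm _ _ _
  have hqτ : 0 ≤ q * τ := by positivity
  rw [hνa, hνa]
  have hhz : ∀ z, ∑ i, ‖v i z‖ₑ = h z := fun z => by rw [hh]
  simp only [hhz]
  calc ∫⁻ x, ‖w x‖ₑ ^ (q * τ) ∂ν
      ≤ ∫⁻ x, ENNReal.ofReal (2 * r) ^ (q * τ) *
          (∫⁻ z, h z * riesz n r x z ∂ν) ^ (q * τ) ∂ν := by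
        refine lintegral_mono_ae ?_
        filter_upwards [hpt] with x hx
        rw [← ENNReal.mul_rpow_of_nonneg _ _ hqτ]
        gcongr
    _ = ENNReal.ofReal (2 * r) ^ (q * τ) * ∫⁻ x, (∫⁻ z, h z * riesz n r x z ∂ν) ^ (q * τ) ∂ν := by
        rw [lintegral_const_mul' _ _ (ENNReal.rpow_ne_top_of_nonneg hqτ ENNReal.ofReal_ne_top)]
    _ ≤ ENNReal.ofReal (2 * r) ^ (q * τ) * (ENNReal.ofReal A ^ (q * τ) *
          (∫⁻ z, h z ^ q ∂ν) ^ τ) := by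
        gcongr
        refine main.trans ?_
        gcongr
        · simpa using hA1
        · nlinarith
    _ = _ := by
        have : 2 * A * r = 2 * r * A := by ring
        rw [this, ENNReal.ofReal_mul (p := 2 * r) (by positivity),
          ENNReal.mul_rpow_of_nonneg _ _ hqτ, mul_assoc]

end Poincare

/-! ### Polynomials with prescribed mean values of their derivatives -/

section Polynomial

variable {n N : ℕ}

/-- The monomial `x^α`. -/
noncomputable def monomialFun (α : Fin n → ℕ) (x : Sp n) : ℝ := ∏ i, x i ^ α i

lemma contDiff_monomialFun (α : Fin n → ℕ) : ContDiff ℝ ∞ (monomialFun α) := by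
  unfold monomialFun
  fun_prop

lemma partialD_monomialFun (α : Fin n → ℕ) (i : Fin n) (x : Sp n) :
    partialD i (monomialFun α) x = α i * monomialFun (α - unitIdx i) x := by
  have hd : DifferentiableAt ℝ (monomialFun α) x :=
    (contDiff_monomialFun α).differentiable (by simp) x
  unfold partialD
  rw [← hd.lineDeriv_eq_fderiv]
  refine HasLineDerivAt.lineDeriv ?_
  have e : ∀ t : ℝ, monomialFun α (x + t • EuclideanSpace.single i 1) =
      (x i + t) ^ α i * ∏ j ∈ Finset.univ.erase i, x j ^ α j := by
    intro t
    unfold monomialFun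
    rw [← Finset.mul_prod_erase _ _ (Finset.mem_univ i)]
    congr 1
    · simp
    · refine Finset.prod_congr rfl fun j hj => ?_
      have : j ≠ i := Finset.ne_of_mem_erase hj
      simp [this]
  have e2 : monomialFun (α - unitIdx i) x =
      x i ^ (α i - 1) * ∏ j ∈ Finset.univ.erase i, x j ^ α j := by
    unfold monomialFun
    rw [← Finset.mul_prod_erase _ _ (Finset.mem_univ i)]
    congr 1
    · simp
    · refine Finset.prod_congr rfl fun j hj => ?_
      have : j ≠ i := Finset.ne_of_mem_erase hj
      simp [this]
  unfold HasLineDerivAt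
  simp only [e, e2]
  have h1 : HasDerivAt (fun t : ℝ => x i + t) 1 0 := by
    simpa using (hasDerivAt_id (0 : ℝ)).const_add (x i)
  have h2 := (h1.fun_pow (α i)).mul_const (∏ j ∈ Finset.univ.erase i, x j ^ α j)
  rw [add_zero, mul_one, mul_assoc] at h2
  exact h2

lemma partialD_smul_const {F : Type*} [NormedAddCommGroup F] [NormedSpace ℝ F] {h : Sp n → ℝ}
    (hh : ContDiff ℝ ∞ h) (c : F) (i : Fin n) :
    partialD i (fun x => h x • c) = fun x => partialD i h x • c := by
  funext x
  rw [partialD_smul hh contDiff_const]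
  simp [partialD]

lemma multiD_smul_const {F : Type*} [NormedAddCommGroup F] [NormedSpace ℝ F] {h : Sp n → ℝ}
    (hh : ContDiff ℝ ∞ h) (c : F) (β : Fin n → ℕ) :
    multiD β (fun x => h x • c) = fun x => multiD β h x • c := by
  induction β using multiIndex_induction with
  | h0 => simp only [multiD_zero]
  | hs β i ih =>
    have hs : ContDiff ℝ ∞ fun x => h x • c := hh.smul contDiff_const
    rw [multiD_add_unitIdx hs, ih, partialD_smul_const (contDiff_multiD hh β),
      multiD_add_unitIdx hh]

lemma multiD_smul_const_apply {F : Type*} [NormedAddCommGroup F] [NormedSpace ℝ F] {h : Sp n → ℝ}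
    (hh : ContDiff ℝ ∞ h) (c : F) (β : Fin n → ℕ) (x : Sp n) :
    multiD β (fun x => h x • c) x = multiD β h x • c :=
  congrFun (multiD_smul_const hh c β) x

lemma multiD_monomialFun (α β : Fin n → ℕ) : multiD β (monomialFun α) =
    fun x => monomialFun (α - β) x • ((∏ i, (α i).descFactorial (β i) : ℕ) : ℝ) := by
  induction β using multiIndex_induction with
  | h0 => funext x; simp [multiD_zero]
  | hs β i ih =>
    rw [multiD_add_unitIdx (contDiff_monomialFun α), ih,
      partialD_smul_const (contDiff_monomialFun _)]
    funext x
    have e : ∏ j, (α j).descFactorial ((β + unitIdx i) j) =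
        (α i - β i) * ∏ j, (α j).descFactorial (β j) := by
      rw [← Finset.mul_prod_erase _ _ (Finset.mem_univ i),
        ← Finset.mul_prod_erase _ (fun j => (α j).descFactorial (β j)) (Finset.mem_univ i)]
      have : ∏ j ∈ Finset.univ.erase i, (α j).descFactorial ((β + unitIdx i) j) =
          ∏ j ∈ Finset.univ.erase i, (α j).descFactorial (β j) := by
        refine Finset.prod_congr rfl fun j hj => ?_
        have : j ≠ i := Finset.ne_of_mem_erase hj
        simp [this]
      rw [this]
      simp [Nat.descFactorial_succ, mul_assoc]
    rw [partialD_monomialFun, e, ← tsub_tsub]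
    simp only [smul_eq_mul, Pi.sub_apply]
    push_cast
    ring

lemma multiD_monomialFun_of_ne {α β : Fin n → ℕ} (h : ∑ i, α i ≤ ∑ i, β i) (hne : β ≠ α)
    (x : Sp n) : multiD β (monomialFun α) x = 0 := by
  have : ∃ i, α i < β i := by
    by_contra! hle
    have : ∀ i ∈ Finset.univ, β i = α i :=
      (Finset.sum_eq_sum_iff_of_le fun i _ => hle i).1
        (le_antisymm (Finset.sum_le_sum fun i _ => hle i) h)
    exact hne (funext fun i => this i (Finset.mem_univ i))
  obtain ⟨i, hi⟩ := this
  rw [multiD_monomialFun, Finset.prod_eq_zero (Finset.mem_univ i)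
    (Nat.descFactorial_of_lt hi)]
  simp

lemma multiD_monomialFun_self (α : Fin n → ℕ) (x : Sp n) :
    multiD α (monomialFun α) x = (∏ i, (α i).factorial : ℕ) := by
  rw [multiD_monomialFun]
  simp [monomialFun, Nat.descFactorial_self]

lemma multiD_sum {F : Type*} [NormedAddCommGroup F] [NormedSpace ℝ F] {ι : Type*} (s : Finset ι)
    {g : ι → Sp n → F} (hg : ∀ a, ContDiff ℝ ∞ (g a)) (β : Fin n → ℕ) :
    multiD β (∑ a ∈ s, g a) = ∑ a ∈ s, multiD β (g a) := by
  classical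
  have h0 : ∀ β : Fin n → ℕ, multiD β (0 : Sp n → F) = 0 := by
    intro β
    induction β using multiIndex_induction with
    | h0 => rw [multiD_zero]
    | hs β i ih =>
      rw [multiD_add_unitIdx (show ContDiff ℝ ∞ (0 : Sp n → F) from contDiff_const), ih]
      funext x
      unfold partialD
      simp
  induction s using Finset.induction_on with
  | empty => simp [h0]
  | insert a s ha ih =>
    rw [Finset.sum_insert ha, Finset.sum_insert ha, multiD_add_fun (hg a) ?_, ih]
    have : (∑ a ∈ s, g a) = fun x => ∑ a ∈ s, g a x := by funext x; simp
    rw [this]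
    exact ContDiff.sum fun a _ => hg a

/-- There is a polynomial of degree less than `k + 1` whose derivatives of order `k` are prescribed
constants. -/
lemma exists_polynomial_const_deriv (k : ℕ) (c : (Fin n → ℕ) → Sp N) :
    ∃ Q : Sp n → Sp N, ContDiff ℝ ∞ Q ∧
      (∀ β, ∑ i, β i = k → ∀ x, multiD β Q x = c β) ∧
      ∀ β, k < ∑ i, β i → ∀ x, multiD β Q x = 0 := by
  have hs : ∀ α : Fin n → ℕ, ContDiff ℝ ∞ fun x : Sp n =>
      monomialFun α x • (((∏ i, (α i).factorial : ℕ) : ℝ)⁻¹ • c α) := fun α =>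
    (contDiff_monomialFun α).smul contDiff_const
  refine ⟨∑ α ∈ indices n k, fun x => monomialFun α x •
    (((∏ i, (α i).factorial : ℕ) : ℝ)⁻¹ • c α), ?_, fun β hβ x => ?_, fun β hβ x => ?_⟩
  · have : (∑ α ∈ indices n k, fun x => monomialFun α x •
        (((∏ i, (α i).factorial : ℕ) : ℝ)⁻¹ • c α)) = fun x : Sp n => ∑ α ∈ indices n k,
        monomialFun α x • (((∏ i, (α i).factorial : ℕ) : ℝ)⁻¹ • c α) := by
      funext x; simp
    rw [this]
    exact ContDiff.sum fun α _ => hs α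
  · rw [multiD_sum _ hs, Finset.sum_apply, Finset.sum_eq_single β]
    · rw [multiD_smul_const_apply (contDiff_monomialFun β), multiD_monomialFun_self, smul_smul,
        mul_inv_cancel₀, one_smul]
      exact_mod_cast Finset.prod_ne_zero_iff.2 fun i _ => Nat.factorial_ne_zero _
    · intro α hα hne
      rw [multiD_smul_const_apply (contDiff_monomialFun α),
        multiD_monomialFun_of_ne (by rw [mem_indices.1 hα, hβ]) hne.symm, zero_smul]
    · intro h
      exact absurd (mem_indices.2 hβ) h
  · rw [multiD_sum _ hs, Finset.sum_apply]
    refine Finset.sum_eq_zero fun α hα => ?_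
    rw [multiD_smul_const_apply (contDiff_monomialFun α),
      multiD_monomialFun_of_ne (by rw [mem_indices.1 hα]; exact hβ.le) ?_, zero_smul]
    rintro rfl
    exact hβ.ne' (mem_indices.1 hα)

/-- A polynomial `P` of degree less than `m` such that `U_α - D^α P` has mean value zero on `B` for
all `|α| < m`. -/
lemma exists_polynomial_mean {B : Set (Sp n)} (hB0 : volume B ≠ 0) (hBt : volume B ≠ ⊤)
    (hBb : Bornology.IsBounded B) (m : ℕ) {U : (Fin n → ℕ) → Sp n → Sp N}
    (hU : ∀ α, ∑ i, α i < m → IntegrableOn (U α) B) :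
    ∃ P : Sp n → Sp N, ContDiff ℝ ∞ P ∧ (∀ α, m ≤ ∑ i, α i → ∀ x, multiD α P x = 0) ∧
      ∀ α, ∑ i, α i < m → ∫ x in B, (U α x - multiD α P x) = 0 := by
  have hci : ∀ {g : Sp n → Sp N}, Continuous g → IntegrableOn g B := fun hg =>
    (hg.continuousOn.integrableOn_compact hBb.isCompact_closure).mono_set subset_closure
  have key : ∀ j ≤ m, ∃ P : Sp n → Sp N, ContDiff ℝ ∞ P ∧
      (∀ α, m ≤ ∑ i, α i → ∀ x, multiD α P x = 0) ∧
      ∀ α, m - j ≤ ∑ i, α i → ∑ i, α i < m → ∫ x in B, (U α x - multiD α P x) = 0 := by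
    intro j
    induction j with
    | zero =>
      intro _
      refine ⟨fun _ => 0, contDiff_const, fun α _ x => ?_, fun α h1 h2 => by omega⟩
      have := multiD_smul_const_apply (n := n) (h := fun _ => (0 : ℝ)) contDiff_const
        (0 : Sp N) α x
      simpa using this
    | succ j ih =>
      intro hj
      obtain ⟨P, hP, hP0, hPm⟩ := ih (by omega)
      obtain ⟨Q, hQ, hQc, hQ0⟩ := exists_polynomial_const_deriv (n := n) (m - j - 1)
        fun α => (volume.real B)⁻¹ • ∫ x in B, (U α x - multiD α P x)
      have hD : ∀ α, multiD α (P + Q) = multiD α P + multiD α Q := multiD_add_fun hP hQ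
      refine ⟨P + Q, hP.add hQ, fun α hα x => ?_, fun α h1 h2 => ?_⟩
      · rw [hD, Pi.add_apply, hP0 α hα, hQ0 α (by omega), add_zero]
      · have hi : IntegrableOn (fun x => U α x - multiD α P x) B :=
          (hU α h2).sub (hci (contDiff_multiD hP α).continuous)
        have e : ∀ x, U α x - multiD α (P + Q) x = (U α x - multiD α P x) - multiD α Q x := by
          intro x
          rw [hD, Pi.add_apply]; abel
        simp only [e]
        rw [integral_sub hi (hci (contDiff_multiD hQ α).continuous)]
        rcases Nat.lt_or_ge (m - j - 1) (∑ i, α i) with h3 | h3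
        · simp only [hQ0 α h3, integral_zero, sub_zero]
          exact hPm α (by omega) h2
        · simp only [hQc α (by omega)]
          rw [integral_const, smul_smul]
          have : (volume.restrict B).real univ * (volume.real B)⁻¹ = 1 := by
            rw [measureReal_restrict_apply_univ, mul_inv_cancel₀]
            exact (ENNReal.toReal_ne_zero.2 ⟨hB0, hBt⟩)
          rw [this, one_smul, sub_self]
  obtain ⟨P, h1, h2, h3⟩ := key m le_rfl
  exact ⟨P, h1, h2, fun α hα => h3 α (by omega) hα⟩

end Polynomial

/-! ### The Sobolev–Poincaré inequality for jets -/

section JetPoincare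

variable {n N : ℕ}

/-- The sum of the norms of the entries of order `k` of a jet, with values in `[0, ∞]`. -/
noncomputable def jetESum (U : (Fin n → ℕ) → Sp n → Sp N) (k : ℕ) (x : Sp n) : ℝ≥0∞ :=
  ∑ α ∈ indices n k, ‖U α x‖ₑ

lemma jetESum_eq (U : (Fin n → ℕ) → Sp n → Sp N) (k : ℕ) (x : Sp n) :
    jetESum U k x = ENNReal.ofReal (jetSum U k x) := by
  rw [jetESum, jetSum, ENNReal.ofReal_sum_of_nonneg fun _ _ => norm_nonneg _]
  simp

lemma sum_enorm_add_unitIdx_le (U : (Fin n → ℕ) → Sp n → Sp N) {k : ℕ} {β : Fin n → ℕ}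
    (hβ : ∑ i, β i = k) (x : Sp n) : ∑ i, ‖U (β + unitIdx i) x‖ₑ ≤ jetESum U (k + 1) x := by
  unfold jetESum
  rw [← Finset.sum_image (s := Finset.univ) (g := fun i => β + unitIdx i)
    (f := fun α => ‖U α x‖ₑ) (fun i _ j _ h => ?_)]
  · refine Finset.sum_le_sum_of_subset fun γ hγ => ?_
    obtain ⟨i, -, rfl⟩ := Finset.mem_image.1 hγ
    rw [mem_indices, sum_add_unitIdx, hβ]
  · have h1 : unitIdx i = unitIdx j := add_left_cancel h
    by_contra hij
    have := congrFun h1 i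
    simp [hij] at this

lemma IsJet.aemeasurable_jetESum {O : Set (Sp n)} {m k : ℕ} {V : (Fin n → ℕ) → Sp n → Sp N}
    (hV : IsJet O m V) (hk : k ≤ m) {B : Set (Sp n)} (hB : B ⊆ O) :
    AEMeasurable (jetESum V k) (volume.restrict B) := by
  unfold jetESum
  exact Finset.aemeasurable_fun_sum _ fun α hα =>
    ((hV.locInt α (by rw [mem_indices.1 hα]; exact hk)).aestronglyMeasurable.mono_set hB).enorm

lemma laverage_const_mul' {B : Set (Sp n)} {c : ℝ≥0∞} (hc : c ≠ ⊤) (f : Sp n → ℝ≥0∞) :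
    ⨍⁻ x in B, c * f x ∂volume = c * ⨍⁻ x in B, f x ∂volume := by
  rw [setLAverage_eq, setLAverage_eq, lintegral_const_mul' _ _ hc, mul_div_assoc]

lemma laverage_mono_ae {B : Set (Sp n)} {f g : Sp n → ℝ≥0∞}
    (h : ∀ᵐ x ∂(volume.restrict B), f x ≤ g x) :
    ⨍⁻ x in B, f x ∂volume ≤ ⨍⁻ x in B, g x ∂volume := by
  rw [setLAverage_eq, setLAverage_eq]
  exact ENNReal.div_le_div_right (lintegral_mono_ae h) _

/-- The Sobolev–Poincaré inequality for jets of order `m` whose entries of order less than `m` have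
mean value zero. -/
lemma exists_jet_sobolev_poincare (hn : 2 ≤ n) (m : ℕ) : ∃ C : ℝ, 1 ≤ C ∧
    ∀ {N : ℕ} {O : Set (Sp n)} {V : (Fin n → ℕ) → Sp n → Sp N} {x₀ : Sp n} {r q τ : ℝ},
      IsOpen O → IsJet O m V → 0 < r → Metric.closedBall x₀ r ⊆ O →
      (∀ α, ∑ i, α i < m → ∫ x in Metric.ball x₀ r, V α x = 0) →
      1 ≤ q → 1 ≤ τ → ((n : ℝ) - 1) * τ ≤ n - 1 / 2 → ∀ k < m,
      ⨍⁻ x in Metric.ball x₀ r, jetESum V k x ^ (q * τ) ∂volume ≤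
        (ENNReal.ofReal (C * r) ^ (m - k)) ^ (q * τ) *
          (⨍⁻ x in Metric.ball x₀ r, jetESum V m x ^ q ∂volume) ^ τ := by
  obtain ⟨C₀, hC₀, hSP⟩ := exists_sobolev_poincare (n := n) hn
  set c : ℝ := 1 + ∑ k ∈ Finset.range m, ((indices n k).card : ℝ) with hc
  have hc1 : 1 ≤ c := by
    rw [hc]
    have : 0 ≤ ∑ k ∈ Finset.range m, ((indices n k).card : ℝ) :=
      Finset.sum_nonneg fun _ _ => by positivity
    linarith
  have hck : ∀ k < m, ((indices n k).card : ℝ) ≤ c := fun k hk => by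
    rw [hc]
    have := Finset.single_le_sum (f := fun k => ((indices n k).card : ℝ))
      (fun _ _ => by positivity) (Finset.mem_range.2 hk)
    linarith
  refine ⟨C₀ * c, by nlinarith, ?_⟩
  intro N O V x₀ r q τ hO hV hr hB hV0 hq hτ hτn
  set B := Metric.ball x₀ r with hBdef
  have hBO : B ⊆ O := Metric.ball_subset_closedBall.trans hB
  set a := ENNReal.ofReal (C₀ * c * r) with ha
  have ha' : a = ENNReal.ofReal c * ENNReal.ofReal (C₀ * r) := by
    rw [ha, ← ENNReal.ofReal_mul (by linarith)]; congr 1; ring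
  have step : ∀ τ : ℝ, 1 ≤ τ → ((n : ℝ) - 1) * τ ≤ n - 1 / 2 → ∀ k < m,
      ⨍⁻ x in B, jetESum V k x ^ (q * τ) ∂volume ≤
        a ^ (q * τ) * (⨍⁻ x in B, jetESum V (k + 1) x ^ q ∂volume) ^ τ := by
    intro τ hτ hτn k hk
    have hqτ : 1 ≤ q * τ := by nlinarith
    set X := ENNReal.ofReal (C₀ * r) ^ (q * τ) *
      (⨍⁻ x in B, jetESum V (k + 1) x ^ q ∂volume) ^ τ with hX
    have hone : ∀ β ∈ indices n k, ⨍⁻ x in B, ‖V β x‖ₑ ^ (q * τ) ∂volume ≤ X := by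
      intro β hβ
      have hβ' := mem_indices.1 hβ
      refine (hSP hO (hV.locInt β (by omega)) (fun i => hV.deriv β i (by omega)) hr hB
        (hV0 β (by omega)) hq hτ hτn).trans ?_
      rw [hX]
      gcongr
      refine Eventually.of_forall fun x => ?_
      dsimp only
      gcongr
      exact sum_enorm_add_unitIdx_le V hβ' x
    have hcard : ((indices n k).card : ℝ≥0∞) ≤ ENNReal.ofReal c := by
      rw [← ENNReal.ofReal_natCast]
      exact ENNReal.ofReal_le_ofReal (hck k hk)
    have hcard_top : ((indices n k).card : ℝ≥0∞) ^ (q * τ - 1) ≠ ⊤ :=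
      ENNReal.rpow_ne_top_of_nonneg (by linarith) (ENNReal.natCast_ne_top _)
    calc ⨍⁻ x in B, jetESum V k x ^ (q * τ) ∂volume
        ≤ ⨍⁻ x in B, ((indices n k).card : ℝ≥0∞) ^ (q * τ - 1) *
            ∑ β ∈ indices n k, ‖V β x‖ₑ ^ (q * τ) ∂volume :=
          laverage_mono_ae (Eventually.of_forall fun x =>
            ENNReal.rpow_sum_le_const_mul_sum_rpow _ _ hqτ)
      _ = ((indices n k).card : ℝ≥0∞) ^ (q * τ - 1) *
            ∑ β ∈ indices n k, ⨍⁻ x in B, ‖V β x‖ₑ ^ (q * τ) ∂volume := by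
          rw [laverage_const_mul' hcard_top]
          congr 1
          simp only [setLAverage_eq, ENNReal.div_eq_inv_mul]
          rw [← Finset.mul_sum, lintegral_finsetSum']
          intro β hβ
          exact ((hV.locInt β (by rw [mem_indices.1 hβ]; omega)).aestronglyMeasurable.mono_set
            hBO).enorm.pow_const _
      _ ≤ ENNReal.ofReal c ^ (q * τ - 1) * (ENNReal.ofReal c * X) := by
          refine mul_le_mul' (ENNReal.rpow_le_rpow hcard (by linarith)) ?_
          refine (Finset.sum_le_sum hone).trans ?_
          rw [Finset.sum_const, nsmul_eq_mul]
          gcongr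
      _ = a ^ (q * τ) * (⨍⁻ x in B, jetESum V (k + 1) x ^ q ∂volume) ^ τ := by
          have : ENNReal.ofReal c ^ (q * τ - 1) * ENNReal.ofReal c =
              ENNReal.ofReal c ^ (q * τ) := by
            conv_rhs => rw [show q * τ = (q * τ - 1) + 1 by ring]
            rw [ENNReal.rpow_add_of_nonneg _ _ (by linarith) zero_le_one, ENNReal.rpow_one]
          rw [← mul_assoc, this, hX, ← mul_assoc, ha',
            ENNReal.mul_rpow_of_nonneg _ _ (by linarith)]
  have hq0 : 0 ≤ q := by linarith
  have hτ0 : 0 ≤ τ := by linarith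
  -- without gain of integrability the inequality can be iterated
  have chain : ∀ j k, k + j = m → ⨍⁻ x in B, jetESum V k x ^ q ∂volume ≤
      (a ^ j) ^ q * ⨍⁻ x in B, jetESum V m x ^ q ∂volume := by
    intro j
    induction j with
    | zero => rintro k rfl; simp
    | succ j ih =>
      intro k hk
      have hn2 : (2 : ℝ) ≤ n := by exact_mod_cast hn
      have h1 := step 1 le_rfl (by linarith) k (by omega)
      simp only [mul_one, ENNReal.rpow_one] at h1
      refine h1.trans ?_
      calc _ ≤ a ^ q * ((a ^ j) ^ q * ⨍⁻ x in B, jetESum V m x ^ q ∂volume) :=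
            mul_le_mul_right (ih (k + 1) (by omega)) _
        _ = _ := by rw [← mul_assoc, ← ENNReal.mul_rpow_of_nonneg _ _ hq0, pow_succ']
  intro k hk
  refine (step τ hτ hτn k hk).trans ?_
  have h2 := chain (m - k - 1) (k + 1) (by omega)
  calc _ ≤ a ^ (q * τ) * ((a ^ (m - k - 1)) ^ q *
        ⨍⁻ x in B, jetESum V m x ^ q ∂volume) ^ τ := by gcongr
    _ = _ := by
      rw [ENNReal.mul_rpow_of_nonneg _ _ hτ0, ← ENNReal.rpow_mul, ← mul_assoc,
        ← ENNReal.mul_rpow_of_nonneg _ _ (by positivity), ← pow_succ',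
        show m - k - 1 + 1 = m - k by omega]

end JetPoincare

/-! ### Gehring's lemma -/

section Iteration

/-- The hole-filling iteration lemma: a bounded `φ` with `φ t ≤ θ φ s + A ((b - a) / (s - t))^κ` for
`t < s` and `θ < 1` satisfies `φ a ≤ C A`, where `C` does not depend on the bound `M`. -/
lemma exists_iteration_const {θ κ : ℝ} (hθ0 : 0 ≤ θ) (hθ1 : θ < 1) (hκ : 0 ≤ κ) :
    ∃ C : ℝ, 0 < C ∧ ∀ (φ : ℝ → ℝ) (a b A M : ℝ), a < b → 0 ≤ A →
      (∀ t ∈ Icc a b, φ t ≤ M) →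
      (∀ t s, a ≤ t → t < s → s ≤ b → φ t ≤ θ * φ s + A * ((b - a) / (s - t)) ^ κ) →
      φ a ≤ C * A := by
  -- the radii approach `b` geometrically with ratio `l`, where `l` is so close to `1` that
  -- `θ l^{-κ} < 1`
  obtain ⟨l, hl0, hl1, hl⟩ : ∃ l : ℝ, 0 < l ∧ l < 1 ∧ θ < l ^ κ := by
    have h1 : 0 < (1 + θ) / 2 := by linarith
    have h2 : (1 + θ) / 2 < 1 := by linarith
    refine ⟨((1 + θ) / 2) ^ (1 / (κ + 1)), by positivity,
      Real.rpow_lt_one h1.le h2 (by positivity), ?_⟩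
    rw [← Real.rpow_mul h1.le]
    have h3 : 1 / (κ + 1) * κ ≤ 1 := by
      rw [one_div_mul_eq_div, div_le_one (by linarith)]; linarith
    calc θ < (1 + θ) / 2 := by linarith
      _ = ((1 + θ) / 2) ^ (1 : ℝ) := (Real.rpow_one _).symm
      _ ≤ _ := Real.rpow_le_rpow_of_exponent_ge h1 h2.le h3
  have hlκ : 0 < l ^ κ := by positivity
  set μ := θ * (l ^ κ)⁻¹ with hμ
  have hμ0 : 0 ≤ μ := by positivity
  have hμ1 : μ < 1 := by
    rw [hμ, ← div_eq_mul_inv, div_lt_one hlκ]; exact hl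
  have h1l : 0 < 1 - l := by linarith
  set D := ((1 - l) ^ κ)⁻¹ with hD
  have hD0 : 0 < D := by positivity
  refine ⟨D * (1 - μ)⁻¹, mul_pos hD0 (inv_pos.2 (by linarith)), ?_⟩
  intro φ a b A M hab hA hM h
  have hba : 0 < b - a := by linarith
  set t : ℕ → ℝ := fun i => b - l ^ i * (b - a) with ht
  have hl_le : ∀ i : ℕ, l ^ i ≤ 1 := fun i => pow_le_one₀ hl0.le hl1.le
  have ht_mem : ∀ i, t i ∈ Icc a b := fun i => by
    have h1 := hl_le i
    have h2 : 0 < l ^ i := by positivity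
    constructor <;> simp only [ht] <;> nlinarith
  have ht0 : t 0 = a := by simp [ht]
  have key : ∀ k, φ a ≤ θ ^ k * φ (t k) + A * D * ∑ i ∈ Finset.range k, μ ^ i := by
    intro k
    induction k with
    | zero => simp [ht0]
    | succ k ih =>
      have hlk : 0 < l ^ k := by positivity
      have hdiff : t (k + 1) - t k = (1 - l) * l ^ k * (b - a) := by simp only [ht]; ring
      have hlt : t k < t (k + 1) := by
        have : 0 < (1 - l) * l ^ k * (b - a) := by positivity
        linarith
      have h1 := h (t k) (t (k + 1)) (ht_mem k).1 hlt (ht_mem (k + 1)).2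
      have h2 : ((b - a) / (t (k + 1) - t k)) ^ κ = D * ((l ^ κ)⁻¹) ^ k := by
        have e : (b - a) / (t (k + 1) - t k) = ((1 - l) * l ^ k)⁻¹ := by
          rw [hdiff]; field_simp
        rw [e, Real.inv_rpow (by positivity), Real.mul_rpow h1l.le hlk.le, mul_inv, hD, inv_pow]
        congr 2
        rw [← Real.rpow_natCast, ← Real.rpow_mul hl0.le, mul_comm, Real.rpow_mul hl0.le,
          Real.rpow_natCast]
      rw [h2] at h1
      have h3 : θ ^ k * φ (t k) ≤ θ ^ k * (θ * φ (t (k + 1)) + A * (D * ((l ^ κ)⁻¹) ^ k)) :=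
        mul_le_mul_of_nonneg_left h1 (by positivity)
      rw [Finset.sum_range_succ, mul_add]
      have h4 : θ ^ k * (A * (D * ((l ^ κ)⁻¹) ^ k)) = A * D * μ ^ k := by
        rw [hμ, mul_pow]; ring
      have h5 : θ ^ (k + 1) * φ (t (k + 1)) = θ ^ k * (θ * φ (t (k + 1))) := by ring
      linarith [mul_add (θ ^ k) (θ * φ (t (k + 1))) (A * (D * ((l ^ κ)⁻¹) ^ k))]
  have key2 : ∀ k, φ a ≤ θ ^ k * M + D * (1 - μ)⁻¹ * A := by
    intro k
    have h1 : ∑ i ∈ Finset.range k, μ ^ i ≤ (1 - μ)⁻¹ := by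
      rw [← tsum_geometric_of_lt_one hμ0 hμ1]
      exact (summable_geometric_of_lt_one hμ0 hμ1).sum_le_tsum _ fun i _ => by positivity
    have h2 : θ ^ k * φ (t k) ≤ θ ^ k * M :=
      mul_le_mul_of_nonneg_left (hM _ (ht_mem k)) (by positivity)
    have h3 : A * D * ∑ i ∈ Finset.range k, μ ^ i ≤ A * D * (1 - μ)⁻¹ := by gcongr
    linarith [key k]
  have hlim : Tendsto (fun k => θ ^ k * M + D * (1 - μ)⁻¹ * A) atTop
      (𝓝 (0 * M + D * (1 - μ)⁻¹ * A)) :=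
    ((tendsto_pow_atTop_nhds_zero_of_lt_one hθ0 hθ1).mul_const M).add_const _
  rw [zero_mul, zero_add] at hlim
  exact ge_of_tendsto' hlim key2

end Iteration

section Gehring

variable {n : ℕ}

lemma ball_ae_eq_closedBall [Nonempty (Fin n)] (x : Sp n) (r : ℝ) :
    Metric.ball x r =ᵐ[volume] Metric.closedBall x r :=
  ae_eq_of_subset_of_measure_ge Metric.ball_subset_closedBall
    (Measure.addHaar_closedBall_eq_addHaar_ball volume x r).le
    Metric.isOpen_ball.measurableSet.nullMeasurableSet measure_closedBall_lt_top.ne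

/-- Lebesgue's differentiation theorem for open balls. -/
lemma ae_tendsto_laverage_ball [Nonempty (Fin n)] {F : Sp n → ℝ≥0∞} (hF : Measurable F)
    (hFi : ∫⁻ x, F x ≠ ⊤) :
    ∀ᵐ x, Tendsto (fun ρ => ⨍⁻ y in Metric.ball x ρ, F y ∂volume) (𝓝[>] 0) (𝓝 (F x)) := by
  filter_upwards [(Besicovitch.vitaliFamily (volume : Measure (Sp n))).ae_tendsto_lintegral_div
    hF.aemeasurable hFi] with x hx
  have h1 := hx.comp (Besicovitch.tendsto_filterAt volume x)
  refine h1.congr fun ρ => ?_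
  simp only [Function.comp_apply, setLAverage_eq]
  rw [setLIntegral_congr (ball_ae_eq_closedBall x ρ), measure_congr (ball_ae_eq_closedBall x ρ)]

lemma volume_ball_mul [Nonempty (Fin n)] (x y : Sp n) {r : ℝ} (hr : 0 < r) {c : ℝ} (hc : 0 < c) :
    volume (Metric.ball x (c * r)) = ENNReal.ofReal (c ^ n) * volume (Metric.ball y r) := by
  rw [Measure.addHaar_ball _ _ (by positivity), Measure.addHaar_ball _ _ hr.le,
    finrank_euclideanSpace_fin, mul_pow, ENNReal.ofReal_mul (by positivity), mul_assoc]

/-- The stopping-time selection of a ball on which the mean value of `F` exceeds `l`, while it does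
not exceed `l` on the ball of `11` times the radius. The factor `11` leaves room for the enlargement
by `5` of the closed balls of radius `2ρ` in Vitali's covering lemma. -/
lemma exists_stopping_ball {F : Sp n → ℝ≥0∞} {x : Sp n} {l : ℝ≥0∞} {d : ℝ}
    (hex : ∃ ρ, 0 < ρ ∧ ρ ≤ d ∧ l < ⨍⁻ y in Metric.ball x ρ, F y ∂volume)
    (hbig : ∀ ρ, d < ρ → ρ ≤ 11 * d → ⨍⁻ y in Metric.ball x ρ, F y ∂volume ≤ l) :
    ∃ ρ, 0 < ρ ∧ ρ ≤ d ∧ l < ⨍⁻ y in Metric.ball x ρ, F y ∂volume ∧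
      ⨍⁻ y in Metric.ball x (11 * ρ), F y ∂volume ≤ l := by
  set T : Set ℝ := {ρ | 0 < ρ ∧ ρ ≤ d ∧ l < ⨍⁻ y in Metric.ball x ρ, F y ∂volume} with hT
  have hTne : T.Nonempty := hex
  have hTb : BddAbove T := ⟨d, fun ρ hρ => hρ.2.1⟩
  obtain ⟨ρ₀, hρ₀⟩ := id hTne
  have hs : 0 < sSup T := hρ₀.1.trans_le (le_csSup hTb hρ₀)
  obtain ⟨ρ, hρ, hρs⟩ := exists_lt_of_lt_csSup hTne (half_lt_self hs)
  refine ⟨ρ, hρ.1, hρ.2.1, hρ.2.2, ?_⟩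
  have hρ0 := hρ.1
  rcases le_or_gt (11 * ρ) d with h | h
  · by_contra hlt
    have : 11 * ρ ∈ T := ⟨by linarith, h, not_le.1 hlt⟩
    have := le_csSup hTb this
    linarith
  · exact hbig _ h (by linarith [hρ.2.1])

/-- The consequence of a reverse Hölder inequality on a ball where the mean value exceeds `l`. -/
lemma level_le_of_reverse_holder {F : Sp n → ℝ≥0∞} (hF : Measurable F) {K s : ℝ} (hK : 1 ≤ K)
    (hs0 : 0 < s) {l A V : ℝ≥0∞} (hl : ENNReal.ofReal (2 * K) ≤ l) (hlt : l ≠ ⊤)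
    {B : Set (Sp n)} (hB : MeasurableSet B) (hV : V = volume B) (hV0 : V ≠ 0) (hVt : V ≠ ⊤)
    (hA : A = ⨍⁻ y in B, F y ^ s ∂volume)
    (h : l ≤ ENNReal.ofReal K * (A ^ (1 / s) + 1)) {k : ℝ} (hk : k = (2 * K)⁻¹ * 2 ^ (-(1 / s))) :
    l ^ s * V ≤ ENNReal.ofReal (2 * (2 * K) ^ s) *
      ∫⁻ y in B ∩ {y | ENNReal.ofReal k * l < F y}, F y ^ s := by
  have hK0 : 0 < K := by linarith
  have hk0 : 0 < k := by rw [hk]; positivity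
  have h1 : l / 2 ≤ ENNReal.ofReal K * A ^ (1 / s) := by
    have h2 : ENNReal.ofReal K ≤ l / 2 := by
      rw [ENNReal.le_div_iff_mul_le (by simp) (by simp)]
      refine le_trans (le_of_eq ?_) hl
      rw [mul_comm 2 K, ENNReal.ofReal_mul hK0.le]; norm_num
    have h3 : l / 2 + l / 2 ≤ ENNReal.ofReal K * A ^ (1 / s) + l / 2 := by
      rw [ENNReal.add_halves]
      refine h.trans ?_
      rw [mul_add, mul_one]
      gcongr
    exact (ENNReal.add_le_add_iff_right (ENNReal.div_ne_top hlt (by simp))).1 h3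
  have h2 : l ^ s ≤ ENNReal.ofReal ((2 * K) ^ s) * A := by
    have : l ≤ ENNReal.ofReal (2 * K) * A ^ (1 / s) := by
      rw [ENNReal.ofReal_mul (by norm_num)]
      calc l = 2 * (l / 2) := (ENNReal.mul_div_cancel (by simp) (by simp)).symm
        _ ≤ 2 * (ENNReal.ofReal K * A ^ (1 / s)) := by gcongr
        _ = _ := by norm_num [mul_assoc]
    calc l ^ s ≤ (ENNReal.ofReal (2 * K) * A ^ (1 / s)) ^ s := by gcongr
      _ = _ := by
        rw [ENNReal.mul_rpow_of_nonneg _ _ hs0.le, ← ENNReal.rpow_mul,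
          one_div_mul_cancel hs0.ne', ENNReal.rpow_one, ENNReal.ofReal_rpow_of_pos (by positivity)]
  set S := {y | ENNReal.ofReal k * l < F y} with hS
  have hSm : MeasurableSet S := measurableSet_lt measurable_const hF
  have h3 : A * V ≤ (∫⁻ y in B ∩ S, F y ^ s) + (ENNReal.ofReal k * l) ^ s * V := by
    have e : A * V = ∫⁻ y in B, F y ^ s := by
      rw [hA, setLAverage_eq, hV, ENNReal.div_mul_cancel (hV ▸ hV0) (hV ▸ hVt)]
    rw [e, ← lintegral_inter_add_sdiff (fun y => F y ^ s) B hSm]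
    gcongr
    calc ∫⁻ y in B \ S, F y ^ s ≤ ∫⁻ y in B \ S, (ENNReal.ofReal k * l) ^ s := by
          refine setLIntegral_mono' (hB.diff hSm) fun y hy => ?_
          have : F y ≤ ENNReal.ofReal k * l := not_lt.1 hy.2
          gcongr
      _ ≤ (ENNReal.ofReal k * l) ^ s * V := by
          rw [setLIntegral_const, hV]
          gcongr
          exact sdiff_subset
  have hks : k ^ s = ((2 * K) ^ s)⁻¹ * 2⁻¹ := by
    rw [hk, Real.mul_rpow (by positivity) (by positivity), Real.inv_rpow (by positivity),
      ← Real.rpow_mul (by norm_num), neg_mul, one_div_mul_cancel hs0.ne', Real.rpow_neg_one]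
  set Q := (2 * K) ^ s with hQ
  have hQ0 : 0 < Q := by positivity
  have h4 : l ^ s * V ≤ ENNReal.ofReal Q * (∫⁻ y in B ∩ S, F y ^ s) + l ^ s * V / 2 := by
    calc l ^ s * V ≤ ENNReal.ofReal Q * A * V := by gcongr
      _ ≤ ENNReal.ofReal Q * ((∫⁻ y in B ∩ S, F y ^ s) + (ENNReal.ofReal k * l) ^ s * V) := by
          rw [mul_assoc]; gcongr
      _ = _ := by
          rw [mul_add]
          congr 1
          rw [ENNReal.mul_rpow_of_nonneg _ _ hs0.le, ENNReal.ofReal_rpow_of_pos hk0, hks,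
            ← mul_assoc, ← mul_assoc, ← ENNReal.ofReal_mul hQ0.le, ← mul_assoc,
            mul_inv_cancel₀ hQ0.ne', one_mul, ENNReal.div_eq_inv_mul, mul_assoc]
          congr 1
          rw [ENNReal.ofReal_inv_of_pos (by norm_num)]
          norm_num
  have hfin : l ^ s * V / 2 ≠ ⊤ := ENNReal.div_ne_top
    (ENNReal.mul_ne_top (ENNReal.rpow_ne_top_of_nonneg hs0.le hlt) hVt) (by simp)
  have h5 : l ^ s * V / 2 ≤ ENNReal.ofReal Q * ∫⁻ y in B ∩ S, F y ^ s := by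
    refine (ENNReal.add_le_add_iff_right hfin).1 ?_
    rw [ENNReal.add_halves]
    exact h4
  calc l ^ s * V = 2 * (l ^ s * V / 2) := (ENNReal.mul_div_cancel (by simp) (by simp)).symm
    _ ≤ 2 * (ENNReal.ofReal Q * ∫⁻ y in B ∩ S, F y ^ s) := by gcongr
    _ = _ := by
      rw [ENNReal.ofReal_mul (by norm_num), ← mul_assoc]; norm_num

end Gehring

section GehringLevel

variable {n : ℕ}

/-- The mean values over small balls are controlled by the mean value over a larger ball. -/
lemma laverage_ball_le_of_subset [Nonempty (Fin n)] (F : Sp n → ℝ≥0∞) {x₀ x : Sp n} {R ρ d : ℝ}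
    (hd : 0 < d) (hdρ : d ≤ ρ) (hR : 0 < R) (hsub : Metric.ball x ρ ⊆ Metric.ball x₀ R) :
    ⨍⁻ y in Metric.ball x ρ, F y ∂volume ≤
      ENNReal.ofReal ((R / d) ^ n) * ⨍⁻ y in Metric.ball x₀ R, F y ∂volume := by
  have hρ : 0 < ρ := hd.trans_le hdρ
  have e : volume (Metric.ball x₀ R) =
      ENNReal.ofReal ((R / ρ) ^ n) * volume (Metric.ball x ρ) := by
    rw [← volume_ball_mul x₀ x hρ (by positivity), div_mul_cancel₀ _ hρ.ne']
  have hV0 : volume (Metric.ball x ρ) ≠ 0 := (Metric.measure_ball_pos _ _ hρ).ne'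
  have hVt : volume (Metric.ball x ρ) ≠ ⊤ := measure_ball_lt_top.ne
  have hc0 : ENNReal.ofReal ((R / ρ) ^ n) ≠ 0 := by
    rw [Ne, ENNReal.ofReal_eq_zero, not_le]; positivity
  rw [setLAverage_eq, setLAverage_eq, e]
  calc (∫⁻ y in Metric.ball x ρ, F y) / volume (Metric.ball x ρ)
      ≤ (∫⁻ y in Metric.ball x₀ R, F y) / volume (Metric.ball x ρ) := by
        gcongr
    _ = ENNReal.ofReal ((R / ρ) ^ n) * ((∫⁻ y in Metric.ball x₀ R, F y) /
          (ENNReal.ofReal ((R / ρ) ^ n) * volume (Metric.ball x ρ))) := by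
        rw [← mul_div_assoc, ENNReal.mul_div_mul_left _ _ hc0 ENNReal.ofReal_ne_top]
    _ ≤ _ := by gcongr

/-- The level-set inequality behind Gehring's lemma: where `F` is large its integral is controlled
by the integral of the smaller power `F ^ s` over a superlevel set. -/
lemma lintegral_superlevel_le [Nonempty (Fin n)] {F : Sp n → ℝ≥0∞} (hF : Measurable F) {K s : ℝ}
    (hK : 1 ≤ K) (hs0 : 0 < s) {k : ℝ} (hk : k = (2 * K)⁻¹ * 2 ^ (-(1 / s)))
    {x₀ : Sp n} {R : ℝ} (hR : 0 < R)
    (hFi : ∫⁻ y in Metric.ball x₀ R, F y ≠ ⊤)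
    (hRH : ∀ y ρ, 0 < ρ → Metric.closedBall y (2 * ρ) ⊆ Metric.ball x₀ R →
      ⨍⁻ z in Metric.ball y ρ, F z ∂volume ≤
        ENNReal.ofReal K * ((⨍⁻ z in Metric.ball y (2 * ρ), F z ^ s ∂volume) ^ (1 / s) + 1))
    {a b : ℝ} (hab : a < b) (hbR : b ≤ R) {l : ℝ≥0∞} (hlt : l ≠ ⊤)
    (hlK : ENNReal.ofReal (2 * K) ≤ l)
    (hl : ENNReal.ofReal ((11 * R / (b - a)) ^ n) * ⨍⁻ y in Metric.ball x₀ R, F y ∂volume ≤ l) :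
    ∫⁻ y in Metric.ball x₀ a ∩ {y | l < F y}, F y ≤
      ENNReal.ofReal ((11 / 2) ^ n * (2 * (2 * K) ^ s)) * l ^ (1 - s) *
        ∫⁻ y in Metric.ball x₀ b ∩ {y | ENNReal.ofReal k * l < F y}, F y ^ s := by
  obtain ⟨d, hd⟩ : ∃ d, d = (b - a) / 11 := ⟨_, rfl⟩
  have hd0 : 0 < d := by rw [hd]; linarith
  have hl0 : l ≠ 0 := fun h => by
    rw [h, nonpos_iff_eq_zero, ENNReal.ofReal_eq_zero] at hlK; linarith
  have hdR : R / d = 11 * R / (b - a) := by rw [hd]; field_simp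
  -- the good points, at which the stopping-time argument applies
  set A : Set (Sp n) := {x | x ∈ Metric.ball x₀ a ∧ ∃ ρ, 0 < ρ ∧ ρ ≤ d ∧
    l < ⨍⁻ y in Metric.ball x ρ, F y ∂volume ∧
    ⨍⁻ y in Metric.ball x (11 * ρ), F y ∂volume ≤ l} with hA
  have hAae : ∀ᵐ x, x ∈ Metric.ball x₀ a ∩ {y | l < F y} → x ∈ A := by
    have hm : Measurable ((Metric.ball x₀ R).indicator F) :=
      hF.indicator Metric.isOpen_ball.measurableSet
    filter_upwards [ae_tendsto_laverage_ball hm (by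
      rwa [lintegral_indicator Metric.isOpen_ball.measurableSet])] with x hx hxa
    have hxa1 : dist x x₀ < a := hxa.1
    have hsub : ∀ ρ, ρ ≤ 11 * d → Metric.ball x ρ ⊆ Metric.ball x₀ R := fun ρ hρ =>
      Metric.ball_subset_ball' (by rw [hd] at hρ; linarith)
    have hxR : x ∈ Metric.ball x₀ R := Metric.mem_ball.2 (by linarith)
    rw [indicator_of_mem hxR] at hx
    have h1 : ∀ᶠ ρ in 𝓝[>] (0 : ℝ),
        l < ⨍⁻ y in Metric.ball x ρ, (Metric.ball x₀ R).indicator F y ∂volume :=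
      hx.eventually (lt_mem_nhds hxa.2)
    obtain ⟨ρ, hρl, hρ⟩ := (h1.and (Ioo_mem_nhdsGT hd0)).exists
    refine ⟨hxa.1, exists_stopping_ball ⟨ρ, hρ.1, hρ.2.le, hρl.trans_le (le_of_eq ?_)⟩ ?_⟩
    · rw [setLAverage_eq, setLAverage_eq]
      congr 1
      refine setLIntegral_congr_fun Metric.isOpen_ball.measurableSet fun y hy => ?_
      exact indicator_of_mem (hsub ρ (by linarith [hρ.2]) hy) F
    · intro ρ hρ1 hρ2
      refine (laverage_ball_le_of_subset F hd0 hρ1.le hR (hsub ρ hρ2)).trans ?_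
      rw [hdR]; exact hl
  choose! ρ hρ using fun x (hx : x ∈ A) => hx.2
  -- the balls of radius `2ρ` are made disjoint, since the reverse Hölder inequality bounds the mean
  -- value over radius `ρ` by one over radius `2ρ`
  obtain ⟨u, huA, hud, hcov⟩ := Vitali.exists_disjoint_subfamily_covering_enlargement_closedBall A
    id (fun x => 2 * ρ x) (2 * d) (fun x hx => by linarith [(hρ x hx).2.1]) 5 (by norm_num)
  have huc : u.Countable := hud.countable_of_nonempty_interior fun x hx => by
    refine ⟨x, ?_⟩
    exact interior_mono Metric.ball_subset_closedBall
      (by rw [Metric.isOpen_ball.interior_eq]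
          exact Metric.mem_ball_self (by linarith [(hρ x (huA hx)).1]))
  have hud' : u.PairwiseDisjoint fun x =>
      Metric.ball x (2 * ρ x) ∩ {y | ENNReal.ofReal k * l < F y} :=
    fun x hx y hy hxy => (hud hx hy hxy).mono
      (inter_subset_left.trans Metric.ball_subset_closedBall)
      (inter_subset_left.trans Metric.ball_subset_closedBall)
  have hSm : MeasurableSet {y | ENNReal.ofReal k * l < F y} := measurableSet_lt measurable_const hF
  have hballb : ∀ x ∈ u, Metric.closedBall x (2 * ρ x) ⊆ Metric.ball x₀ b := fun x hx =>
    Metric.closedBall_subset_ball' (by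
      have h1 : dist x x₀ < a := (huA hx).1
      have h2 := (hρ x (huA hx)).2.1
      rw [hd] at h2
      linarith)
  have hcov' : A ⊆ ⋃ x ∈ u, Metric.ball x (11 * ρ x) := fun x hx => by
    obtain ⟨y, hy, hxy⟩ := hcov x hx
    refine mem_biUnion hy (Metric.closedBall_subset_ball ?_ (hxy (Metric.mem_closedBall_self ?_)))
    · linarith [(hρ y (huA hy)).1]
    · linarith [(hρ x hx).1]
  have hterm : ∀ x : u, ∫⁻ y in Metric.ball x.1 (11 * ρ x), F y ≤
      ENNReal.ofReal ((11 / 2) ^ n * (2 * (2 * K) ^ s)) * l ^ (1 - s) *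
        ∫⁻ y in Metric.ball x.1 (2 * ρ x) ∩ {y | ENNReal.ofReal k * l < F y}, F y ^ s := by
    rintro ⟨x, hx⟩
    obtain ⟨hρ0, -, hlx, hxl⟩ := hρ x (huA hx)
    have hB : MeasurableSet (Metric.ball x (2 * ρ x)) := Metric.isOpen_ball.measurableSet
    have hV0 : volume (Metric.ball x (2 * ρ x)) ≠ 0 :=
      (Metric.measure_ball_pos _ _ (by linarith)).ne'
    have hV0' : volume (Metric.ball x (11 * ρ x)) ≠ 0 :=
      (Metric.measure_ball_pos _ _ (by linarith)).ne'
    have key := level_le_of_reverse_holder hF hK hs0 hlK hlt hB rfl hV0 measure_ball_lt_top.ne rfl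
      (hlx.le.trans (hRH x (ρ x) hρ0
        ((hballb x hx).trans (Metric.ball_subset_ball hbR)))) hk
    have hvol : volume (Metric.ball x (11 * ρ x)) =
        ENNReal.ofReal ((11 / 2) ^ n) * volume (Metric.ball x (2 * ρ x)) := by
      rw [← volume_ball_mul x x (by linarith) (by norm_num)]
      congr 2; ring
    have e : l = l ^ (1 - s) * l ^ s := by
      rw [← ENNReal.rpow_add _ _ hl0 hlt]; simp
    calc ∫⁻ y in Metric.ball x (11 * ρ x), F y
        ≤ l * volume (Metric.ball x (11 * ρ x)) := by
          rw [setLAverage_eq, ENNReal.div_le_iff hV0' measure_ball_lt_top.ne] at hxl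
          exact hxl
      _ = ENNReal.ofReal ((11 / 2) ^ n) *
            (l ^ (1 - s) * (l ^ s * volume (Metric.ball x (2 * ρ x)))) := by
          rw [hvol]; nth_rw 1 [e]; rw [mul_left_comm, mul_assoc]
      _ ≤ ENNReal.ofReal ((11 / 2) ^ n) * (l ^ (1 - s) * (ENNReal.ofReal (2 * (2 * K) ^ s) *
            ∫⁻ y in Metric.ball x (2 * ρ x) ∩ {y | ENNReal.ofReal k * l < F y}, F y ^ s)) := by
          gcongr
      _ = _ := by
          rw [ENNReal.ofReal_mul (p := (11 / 2) ^ n) (by positivity), mul_assoc, mul_assoc,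
            mul_left_comm (l ^ (1 - s)) (ENNReal.ofReal (2 * (2 * K) ^ s))]
  have := huc.to_subtype
  calc ∫⁻ y in Metric.ball x₀ a ∩ {y | l < F y}, F y
      ≤ ∫⁻ y in ⋃ x : u, Metric.ball x.1 (11 * ρ x), F y := by
        refine lintegral_mono' (Measure.restrict_mono_ae ?_) le_rfl
        filter_upwards [hAae] with x hx hxa
        have := hcov' (hx hxa)
        rwa [biUnion_eq_iUnion] at this
    _ ≤ ∑' x : u, ∫⁻ y in Metric.ball x.1 (11 * ρ x), F y := lintegral_iUnion_le _ _
    _ ≤ ∑' x : u, ENNReal.ofReal ((11 / 2) ^ n * (2 * (2 * K) ^ s)) * l ^ (1 - s) *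
        ∫⁻ y in Metric.ball x.1 (2 * ρ x) ∩ {y | ENNReal.ofReal k * l < F y}, F y ^ s :=
        ENNReal.tsum_le_tsum hterm
    _ = ENNReal.ofReal ((11 / 2) ^ n * (2 * (2 * K) ^ s)) * l ^ (1 - s) *
        ∫⁻ y in ⋃ x ∈ u, (Metric.ball x (2 * ρ x) ∩ {y | ENNReal.ofReal k * l < F y}), F y ^ s := by
        rw [ENNReal.tsum_mul_left, lintegral_biUnion huc
          (fun x _ => Metric.isOpen_ball.measurableSet.inter hSm) hud']
    _ ≤ _ := by
        gcongr
        exact iUnion₂_subset fun x hx => inter_subset_inter_left _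
          (Metric.ball_subset_closedBall.trans (hballb x hx))

end GehringLevel

section GehringLayer

lemma lintegral_Ioc_rpow {δ a : ℝ} (hδ : 0 < δ) (ha : 0 ≤ a) :
    ∫⁻ t in Ioc 0 a, ENNReal.ofReal (t ^ (δ - 1)) = ENNReal.ofReal (a ^ δ / δ) := by
  have hi : IntegrableOn (fun t : ℝ => t ^ (δ - 1)) (Ioc 0 a) :=
    (intervalIntegrable_iff_integrableOn_Ioc_of_le ha).1
      (intervalIntegral.intervalIntegrable_rpow' (by linarith))
  rw [← ofReal_integral_eq_lintegral_ofReal hi, ← intervalIntegral.integral_of_le ha,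
    integral_rpow (Or.inl (by linarith))]
  · rw [sub_add_cancel, Real.zero_rpow hδ.ne', sub_zero]
  · filter_upwards [ae_restrict_mem measurableSet_Ioc] with t ht
    exact Real.rpow_nonneg ht.1.le _

/-- The layer-cake argument that turns a level-set inequality into a bound for a slightly higher
power; the truncation `min (G x) Λ` keeps the quantities finite. -/
lemma lintegral_mul_rpow_le_of_level {X : Type*} [MeasurableSpace X] {ν : Measure X}
    [SFinite ν] {G : X → ℝ} (hG : Measurable G) (hG0 : ∀ x, 0 ≤ G x) {A B : Set X}
    {s k C₁ l₀ Λ δ : ℝ} (hs0 : 0 < s) (hs1 : s < 1)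
    (hk0 : 0 < k) (hk1 : k ≤ 1) (hC₁ : 0 ≤ C₁) (hl₀ : 0 ≤ l₀) (hΛ : 0 ≤ Λ) (hδ0 : 0 < δ)
    (hδ1 : δ ≤ 1)
    (h : ∀ l, l₀ ≤ l → ∫⁻ x in A ∩ {x | l < G x}, ENNReal.ofReal (G x) ∂ν ≤
      ENNReal.ofReal (C₁ * l ^ (1 - s)) *
        ∫⁻ x in B ∩ {x | k * l < G x}, ENNReal.ofReal (G x ^ s) ∂ν) :
    ∫⁻ x in A, ENNReal.ofReal (G x * min (G x) Λ ^ δ) ∂ν ≤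
      ENNReal.ofReal (l₀ ^ δ) * (∫⁻ x in A, ENNReal.ofReal (G x) ∂ν) +
        ENNReal.ofReal (δ * (C₁ * (k ^ 2)⁻¹ / (1 - s))) *
          ∫⁻ x in B, ENNReal.ofReal (G x * min (G x) Λ ^ δ) ∂ν := by
  have hGE : Measurable fun x => ENNReal.ofReal (G x) := hG.ennreal_ofReal
  have hGs : Measurable fun x => ENNReal.ofReal (G x ^ s) := (hG.pow_const s).ennreal_ofReal
  have hf : Measurable fun x => min (G x) Λ := hG.min measurable_const
  have hg : Measurable fun x => min (G x / k) Λ := (hG.div_const k).min measurable_const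
  have hf0 : ∀ x, 0 ≤ min (G x) Λ := fun x => le_min (hG0 x) hΛ
  have hg0 : ∀ x, 0 ≤ min (G x / k) Λ := fun x => le_min (div_nonneg (hG0 x) hk0.le) hΛ
  set ν₁ := (ν.restrict A).withDensity fun x => ENNReal.ofReal (G x) with hν₁
  set ν₂ := (ν.restrict B).withDensity fun x => ENNReal.ofReal (G x ^ s) with hν₂
  have h1s : 0 < 1 - s := by linarith
  set I := ∫⁻ x in A, ENNReal.ofReal (G x) ∂ν with hI
  set J := ∫⁻ x in B, ENNReal.ofReal (G x * min (G x) Λ ^ δ) ∂ν with hJ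
  have hlc1 : ∫⁻ x in A, ENNReal.ofReal (G x * min (G x) Λ ^ δ) ∂ν =
      ENNReal.ofReal δ *
        ∫⁻ t in Ioi 0, ν₁ {x | t < min (G x) Λ} * ENNReal.ofReal (t ^ (δ - 1)) := by
    rw [← lintegral_rpow_eq_lintegral_meas_lt_mul ν₁ (Eventually.of_forall hf0) hf.aemeasurable hδ0,
      hν₁, lintegral_withDensity_eq_lintegral_mul _ hGE (hf.pow_const δ).ennreal_ofReal]
    refine lintegral_congr fun x => ?_
    rw [Pi.mul_apply, ENNReal.ofReal_mul (hG0 x)]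
  have hlc2 : ∫⁻ x in B, ENNReal.ofReal (G x ^ s * min (G x / k) Λ ^ (δ + (1 - s))) ∂ν =
      ENNReal.ofReal (δ + (1 - s)) *
        ∫⁻ t in Ioi 0, ν₂ {x | t < min (G x / k) Λ} *
          ENNReal.ofReal (t ^ (δ + (1 - s) - 1)) := by
    rw [← lintegral_rpow_eq_lintegral_meas_lt_mul ν₂ (Eventually.of_forall hg0) hg.aemeasurable
      (by linarith), hν₂, lintegral_withDensity_eq_lintegral_mul _ hGs
      (hg.pow_const _).ennreal_ofReal]
    refine lintegral_congr fun x => ?_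
    rw [Pi.mul_apply, ENNReal.ofReal_mul (Real.rpow_nonneg (hG0 x) _)]
  -- below the level `l₀` the measure of the superlevel sets is bounded by the total mass
  have hsmall : ∫⁻ t in Ioc 0 l₀, ν₁ {x | t < min (G x) Λ} * ENNReal.ofReal (t ^ (δ - 1)) ≤
      I * ENNReal.ofReal (l₀ ^ δ / δ) := by
    have hm : Measurable fun t : ℝ => ENNReal.ofReal (t ^ (δ - 1)) := by fun_prop
    rw [← lintegral_Ioc_rpow hδ0 hl₀, ← lintegral_const_mul _ hm]
    refine lintegral_mono fun t => ?_
    gcongr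
    refine (measure_mono (subset_univ _)).trans (le_of_eq ?_)
    rw [hν₁, withDensity_apply _ MeasurableSet.univ, Measure.restrict_univ]
  -- above `l₀` the hypothesis applies; superlevel sets of the truncation are empty beyond `Λ`
  have hlarge : ∫⁻ t in Ioi l₀, ν₁ {x | t < min (G x) Λ} * ENNReal.ofReal (t ^ (δ - 1)) ≤
      ENNReal.ofReal C₁ * ∫⁻ t in Ioi 0, ν₂ {x | t < min (G x / k) Λ} *
          ENNReal.ofReal (t ^ (δ + (1 - s) - 1)) := by
    rw [← lintegral_const_mul' _ _ ENNReal.ofReal_ne_top]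
    refine (setLIntegral_mono' measurableSet_Ioi fun t ht => ?_).trans
      (lintegral_mono_set (Ioi_subset_Ioi hl₀))
    have ht0 : 0 < t := hl₀.trans_lt ht
    rw [hν₁, hν₂, withDensity_apply _ (measurableSet_lt measurable_const hf),
      withDensity_apply _ (measurableSet_lt measurable_const hg),
      Measure.restrict_restrict (measurableSet_lt measurable_const hf),
      Measure.restrict_restrict (measurableSet_lt measurable_const hg)]
    rcases le_or_gt Λ t with htΛ | htΛ
    · have : {x | t < min (G x) Λ} = ∅ := by
        ext x; simp [htΛ]
      rw [this, empty_inter, Measure.restrict_empty, lintegral_zero_measure, zero_mul]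
      exact zero_le
    · have e1 : {x | t < min (G x) Λ} = {x | t < G x} := by
        ext x; simp [htΛ]
      have e2 : {x | t < min (G x / k) Λ} = {x | k * t < G x} := by
        ext x; simp [htΛ, lt_div_iff₀ hk0, mul_comm]
      rw [e1, e2, inter_comm, inter_comm _ B]
      calc _ ≤ ENNReal.ofReal (C₁ * t ^ (1 - s)) *
            (∫⁻ x in B ∩ {x | k * t < G x}, ENNReal.ofReal (G x ^ s) ∂ν) *
              ENNReal.ofReal (t ^ (δ - 1)) := by
            gcongr
            exact h t ht.le
        _ = _ := by
            have e3 : t ^ (δ + (1 - s) - 1) = t ^ (1 - s) * t ^ (δ - 1) := by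
              rw [← Real.rpow_add ht0]; ring_nf
            rw [e3, ENNReal.ofReal_mul hC₁, ENNReal.ofReal_mul (by positivity), mul_assoc,
              mul_assoc, mul_left_comm (ENNReal.ofReal (t ^ (1 - s)))]
  have hcmp : ∫⁻ x in B, ENNReal.ofReal (G x ^ s * min (G x / k) Λ ^ (δ + (1 - s))) ∂ν ≤
      ENNReal.ofReal ((k ^ 2)⁻¹) * J := by
    rw [hJ, ← lintegral_const_mul' _ _ ENNReal.ofReal_ne_top]
    refine lintegral_mono fun x => ?_
    rw [← ENNReal.ofReal_mul (by positivity)]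
    refine ENNReal.ofReal_le_ofReal ?_
    have h1 : min (G x / k) Λ ≤ k⁻¹ * min (G x) Λ := by
      rw [mul_min_of_nonneg _ _ (by positivity)]
      refine min_le_min (by rw [div_eq_inv_mul]) ?_
      exact le_mul_of_one_le_left hΛ ((one_le_inv₀ hk0).2 hk1)
    have h2 : min (G x) Λ ^ (δ + (1 - s)) ≤ min (G x) Λ ^ δ * G x ^ (1 - s) := by
      rw [Real.rpow_add_of_nonneg (hf0 x) hδ0.le h1s.le]
      have := hf0 x
      gcongr
      exact min_le_left _ _
    have h3 : (k⁻¹) ^ (δ + (1 - s)) ≤ (k ^ 2)⁻¹ := by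
      rw [← inv_pow, ← Real.rpow_natCast]
      exact Real.rpow_le_rpow_of_exponent_le ((one_le_inv₀ hk0).2 hk1) (by push_cast; linarith)
    have hGx := hG0 x
    have hfx := hf0 x
    calc G x ^ s * min (G x / k) Λ ^ (δ + (1 - s))
        ≤ G x ^ s * (k⁻¹ * min (G x) Λ) ^ (δ + (1 - s)) := by
          have := hg0 x
          gcongr
      _ = G x ^ s * (k⁻¹ ^ (δ + (1 - s)) * min (G x) Λ ^ (δ + (1 - s))) := by
          rw [Real.mul_rpow (by positivity) hfx]
      _ ≤ G x ^ s * ((k ^ 2)⁻¹ * (min (G x) Λ ^ δ * G x ^ (1 - s))) := by gcongr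
      _ = (k ^ 2)⁻¹ * ((G x ^ s * G x ^ (1 - s)) * min (G x) Λ ^ δ) := by ring
      _ = _ := by
          rw [← Real.rpow_add_of_nonneg hGx hs0.le h1s.le, add_sub_cancel, Real.rpow_one]
  rw [hlc1, ← Ioc_union_Ioi_eq_Ioi hl₀, lintegral_union measurableSet_Ioi
    (Ioc_disjoint_Ioi le_rfl), mul_add]
  refine add_le_add ?_ ?_
  · calc _ ≤ ENNReal.ofReal δ * (I * ENNReal.ofReal (l₀ ^ δ / δ)) := by gcongr
      _ = _ := by
        rw [mul_left_comm, ← ENNReal.ofReal_mul hδ0.le, mul_div_cancel₀ _ hδ0.ne', mul_comm]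
  · have hD : (0 : ℝ) < δ + (1 - s) := by linarith
    have h5 : ∫⁻ t in Ioi 0, ν₂ {x | t < min (G x / k) Λ} *
          ENNReal.ofReal (t ^ (δ + (1 - s) - 1)) ≤
        ENNReal.ofReal ((1 - s)⁻¹) * (ENNReal.ofReal ((k ^ 2)⁻¹) * J) := by
      obtain ⟨T, hT⟩ : ∃ T, T = ∫⁻ t in Ioi 0, ν₂ {x | t < min (G x / k) Λ} *
          ENNReal.ofReal (t ^ (δ + (1 - s) - 1)) := ⟨_, rfl⟩
      rw [← hT] at hlc2 ⊢
      calc T = ENNReal.ofReal ((1 - s)⁻¹) * (ENNReal.ofReal (1 - s) * T) := by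
            rw [← mul_assoc, ← ENNReal.ofReal_mul (by positivity), inv_mul_cancel₀ h1s.ne',
              ENNReal.ofReal_one, one_mul]
        _ ≤ ENNReal.ofReal ((1 - s)⁻¹) * (ENNReal.ofReal (δ + (1 - s)) * T) := by
            gcongr; linarith
        _ ≤ _ := by
            rw [← hlc2]; gcongr
    calc _ ≤ ENNReal.ofReal δ * (ENNReal.ofReal C₁ *
          (ENNReal.ofReal ((1 - s)⁻¹) * (ENNReal.ofReal ((k ^ 2)⁻¹) * J))) := by
          gcongr; exact hlarge.trans (by gcongr)
      _ = _ := by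
          rw [← mul_assoc, ← mul_assoc, ← mul_assoc, ← ENNReal.ofReal_mul hδ0.le,
            ← ENNReal.ofReal_mul (by positivity), ← ENNReal.ofReal_mul (by positivity)]
          congr 2
          ring

end GehringLayer

section GehringConclusion

variable {n : ℕ}

/-- Gehring's lemma on a ball, for a reverse Hölder inequality with an additive constant that is
known only for the balls inside the given one. -/
theorem exists_gehring (n : ℕ) [Nonempty (Fin n)] {K s : ℝ} (hK : 1 ≤ K) (hs0 : 0 < s)
    (hs1 : s < 1) :
    ∃ δ C : ℝ, 0 < δ ∧ 0 < C ∧ ∀ (x₀ : Sp n) (R : ℝ) (G : Sp n → ℝ), 0 < R → Measurable G →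
      (∀ x, 0 ≤ G x) → ∫⁻ y in Metric.ball x₀ R, ENNReal.ofReal (G y) ≠ ⊤ →
      (∀ y ρ, 0 < ρ → Metric.closedBall y (2 * ρ) ⊆ Metric.ball x₀ R →
        ⨍⁻ z in Metric.ball y ρ, ENNReal.ofReal (G z) ∂volume ≤
          ENNReal.ofReal K *
            ((⨍⁻ z in Metric.ball y (2 * ρ), ENNReal.ofReal (G z) ^ s ∂volume) ^ (1 / s) + 1)) →
      ∫⁻ y in Metric.ball x₀ (R / 2), ENNReal.ofReal (G y ^ (1 + δ)) ≤
        ENNReal.ofReal C * volume (Metric.ball x₀ R) *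
          ((⨍⁻ y in Metric.ball x₀ R, ENNReal.ofReal (G y) ∂volume) + 1) ^ (1 + δ) := by
  have hK0 : 0 < K := by linarith
  have h1s : 0 < 1 - s := by linarith
  obtain ⟨k, hk⟩ : ∃ k : ℝ, k = (2 * K)⁻¹ * 2 ^ (-(1 / s)) := ⟨_, rfl⟩
  have hk0 : 0 < k := by rw [hk]; positivity
  have hk1 : k ≤ 1 := by
    rw [hk]
    refine mul_le_one₀ (inv_le_one_of_one_le₀ (by linarith)) (by positivity) ?_
    exact Real.rpow_le_one_of_one_le_of_nonpos (by norm_num) (by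
      have : 0 < 1 / s := by positivity
      linarith)
  obtain ⟨C₁, hC₁⟩ : ∃ C₁ : ℝ, C₁ = (11 / 2) ^ n * (2 * (2 * K) ^ s) := ⟨_, rfl⟩
  have hC₁0 : 0 < C₁ := by rw [hC₁]; positivity
  obtain ⟨C₂, hC₂⟩ : ∃ C₂ : ℝ, C₂ = C₁ * (k ^ 2)⁻¹ / (1 - s) := ⟨_, rfl⟩
  have hC₂0 : 0 < C₂ := by rw [hC₂]; positivity
  -- `δ C₂ ≤ 1 / 2` allows the absorption of the higher power by the iteration lemma
  obtain ⟨δ, hδ⟩ : ∃ δ : ℝ, δ = min 1 (1 / (2 * C₂)) := ⟨_, rfl⟩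
  have hδ0 : 0 < δ := by rw [hδ]; positivity
  have hδ1 : δ ≤ 1 := by rw [hδ]; exact min_le_left _ _
  have hδC : δ * C₂ ≤ 1 / 2 := by
    calc δ * C₂ ≤ 1 / (2 * C₂) * C₂ := by
          gcongr; rw [hδ]; exact min_le_right _ _
      _ = 1 / 2 := by field_simp
  obtain ⟨Ci, hCi0, hCi⟩ := exists_iteration_const (θ := 1 / 2) (κ := (n : ℝ)) (by norm_num)
    (by norm_num) (by positivity)
  refine ⟨δ, Ci * (22 ^ n * (2 * K)), hδ0, by positivity, ?_⟩
  intro x₀ R G hR hG hG0 hFi hRH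
  have hF : Measurable fun y => ENNReal.ofReal (G y) := hG.ennreal_ofReal
  set V := volume (Metric.ball x₀ R) with hV
  have hV0 : V ≠ 0 := (Metric.measure_ball_pos _ _ hR).ne'
  have hVt : V ≠ ⊤ := measure_ball_lt_top.ne
  set m := ⨍⁻ y in Metric.ball x₀ R, ENNReal.ofReal (G y) ∂volume with hm
  have hIm : ∫⁻ y in Metric.ball x₀ R, ENNReal.ofReal (G y) = m * V := by
    rw [hm, setLAverage_eq, ENNReal.div_mul_cancel hV0 hVt]
  have hmt : m ≠ ⊤ := by
    rw [hm, setLAverage_eq]; exact ENNReal.div_ne_top hFi hV0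
  obtain ⟨E, hE⟩ : ∃ E : ℝ, E = m.toReal + 1 := ⟨_, rfl⟩
  have hE1 : 1 ≤ E := by rw [hE]; linarith [m.toReal_nonneg]
  have hEm : m + 1 = ENNReal.ofReal E := by
    rw [hE, ENNReal.ofReal_add ENNReal.toReal_nonneg zero_le_one, ENNReal.ofReal_toReal hmt,
      ENNReal.ofReal_one]
  obtain ⟨I, hI⟩ : ∃ I : ℝ, I = (∫⁻ y in Metric.ball x₀ R, ENNReal.ofReal (G y)).toReal := ⟨_, rfl⟩
  have hI0 : 0 ≤ I := by rw [hI]; exact ENNReal.toReal_nonneg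
  have hIE : ENNReal.ofReal I = ∫⁻ y in Metric.ball x₀ R, ENNReal.ofReal (G y) := by
    rw [hI, ENNReal.ofReal_toReal hFi]
  -- truncation makes the iterated quantity finite; the bound does not depend on the level `Λ`
  have htrunc : ∀ Λ : ℝ, 0 ≤ Λ →
      ∫⁻ y in Metric.ball x₀ (R / 2), ENNReal.ofReal (G y * min (G y) Λ ^ δ) ≤
        ENNReal.ofReal (Ci * (22 ^ n * (2 * K) * E ^ δ * I)) := by
    intro Λ hΛ
    obtain ⟨Φ, hΦ⟩ : ∃ Φ : ℝ → ℝ≥0∞, Φ = fun t => ∫⁻ y in Metric.ball x₀ t,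
      ENNReal.ofReal (G y * min (G y) Λ ^ δ) := ⟨_, rfl⟩
    have hmono : ∀ t ≤ R, Φ t ≤ Φ R := fun t ht => by
      rw [hΦ]; exact lintegral_mono_set (Metric.ball_subset_ball ht)
    have hΦR : Φ R ≠ ⊤ := by
      have : Φ R ≤ ENNReal.ofReal (Λ ^ δ) * ∫⁻ y in Metric.ball x₀ R, ENNReal.ofReal (G y) := by
        rw [hΦ, ← lintegral_const_mul _ hF]
        refine lintegral_mono fun y => ?_
        rw [← ENNReal.ofReal_mul (by positivity), mul_comm]
        refine ENNReal.ofReal_le_ofReal (mul_le_mul_of_nonneg_right ?_ (hG0 y))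
        exact Real.rpow_le_rpow (le_min (hG0 y) hΛ) (min_le_right _ _) hδ0.le
      exact (this.trans_lt (ENNReal.mul_lt_top ENNReal.ofReal_lt_top hFi.lt_top)).ne
    have hΦt : ∀ t ≤ R, Φ t ≠ ⊤ := fun t ht => ((hmono t ht).trans_lt hΦR.lt_top).ne
    have key := hCi (fun t => (Φ t).toReal) (R / 2) R (22 ^ n * (2 * K) * E ^ δ * I) (Φ R).toReal
      (by linarith) (by positivity)
      (fun t ht => ENNReal.toReal_mono hΦR (hmono t ht.2)) ?_
    · have := ENNReal.ofReal_le_ofReal key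
      rwa [ENNReal.ofReal_toReal (hΦt _ (by linarith)), hΦ] at this
    · intro a b ha hab hb
      obtain ⟨q, hq⟩ : ∃ q : ℝ, q = 11 * R / (b - a) := ⟨_, rfl⟩
      have hba : 0 < b - a := by linarith
      have hq1 : 1 ≤ q := by
        rw [hq, le_div_iff₀ hba]; linarith
      obtain ⟨l₀, hl₀⟩ : ∃ l₀ : ℝ, l₀ = q ^ n * (2 * K * E) := ⟨_, rfl⟩
      have hqn : 1 ≤ q ^ n := one_le_pow₀ hq1
      have hl₀0 : 0 < l₀ := by rw [hl₀]; positivity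
      have hstep := lintegral_mul_rpow_le_of_level (ν := volume) hG hG0
        (A := Metric.ball x₀ a) (B := Metric.ball x₀ b) hs0 hs1 hk0 hk1 hC₁0.le hl₀0.le hΛ hδ0 hδ1
        (fun l hl => by
          have hl0 : 0 ≤ l := hl₀0.le.trans hl
          have h2K : 2 * K ≤ 2 * K * E := le_mul_of_one_le_right (by positivity) hE1
          have := lintegral_superlevel_le hF hK hs0 hk hR hFi hRH hab hb
            (l := ENNReal.ofReal l) ENNReal.ofReal_ne_top
            (ENNReal.ofReal_le_ofReal (by
              refine le_trans ?_ hl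
              rw [hl₀]
              nlinarith)) (by
              calc _ ≤ ENNReal.ofReal (q ^ n) * ENNReal.ofReal E := by
                    rw [← hq]; gcongr
                    rw [← hEm]; exact le_self_add
                _ ≤ ENNReal.ofReal l := by
                    rw [← ENNReal.ofReal_mul (by positivity)]
                    refine ENNReal.ofReal_le_ofReal (le_trans ?_ hl)
                    rw [hl₀]
                    gcongr
                    nlinarith)
          rw [ENNReal.ofReal_mul hC₁0.le, ← ENNReal.ofReal_rpow_of_nonneg hl0 h1s.le, hC₁]
          refine le_trans (le_of_eq ?_) (this.trans (le_of_eq ?_))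
          · congr 3
            ext y
            simp only [mem_ofPred_eq]
            constructor
            · intro h; exact (ENNReal.ofReal_lt_ofReal_iff (hl0.trans_lt h)).2 h
            · intro h; exact (ENNReal.ofReal_lt_ofReal_iff_of_nonneg hl0).1 h
          · congr 1
            have : {y | ENNReal.ofReal k * ENNReal.ofReal l < ENNReal.ofReal (G y)} =
                {y | k * l < G y} := by
              ext y
              have hkl : 0 ≤ k * l := by positivity
              simp only [mem_ofPred_eq, ← ENNReal.ofReal_mul hk0.le]
              exact ENNReal.ofReal_lt_ofReal_iff_of_nonneg hkl
            rw [this]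
            refine lintegral_congr fun y => ?_
            rw [ENNReal.ofReal_rpow_of_nonneg (hG0 y) hs0.le])
      have hstep' : Φ a ≤ ENNReal.ofReal (l₀ ^ δ * I) + ENNReal.ofReal (1 / 2 * (Φ b).toReal) := by
        rw [ENNReal.ofReal_mul (by positivity), ENNReal.ofReal_mul (by norm_num), hIE,
          ENNReal.ofReal_toReal (hΦt b hb)]
        rw [hΦ]
        refine hstep.trans (add_le_add ?_ ?_)
        · gcongr
          linarith
        · gcongr
          rw [← hC₂]; exact hδC
      have h3 : (Φ a).toReal ≤ l₀ ^ δ * I + 1 / 2 * (Φ b).toReal := by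
        rw [← ENNReal.ofReal_add (by positivity) (by positivity)] at hstep'
        exact ENNReal.toReal_le_of_le_ofReal (by positivity) hstep'
      have h4 : l₀ ^ δ ≤ q ^ n * (2 * K * E ^ δ) := by
        rw [hl₀, Real.mul_rpow (by positivity) (by positivity),
          Real.mul_rpow (by positivity) (by positivity)]
        gcongr
        · calc (q ^ n) ^ δ ≤ (q ^ n) ^ (1 : ℝ) := Real.rpow_le_rpow_of_exponent_le hqn hδ1
            _ = q ^ n := Real.rpow_one _
        · calc (2 * K) ^ δ ≤ (2 * K) ^ (1 : ℝ) :=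
                Real.rpow_le_rpow_of_exponent_le (by linarith) hδ1
            _ = 2 * K := Real.rpow_one _
      have h5 : q ^ n = 22 ^ n * ((R - R / 2) / (b - a)) ^ (n : ℝ) := by
        rw [Real.rpow_natCast, ← mul_pow, hq]
        congr 1
        field_simp
        ring
      calc (Φ a).toReal ≤ l₀ ^ δ * I + 1 / 2 * (Φ b).toReal := h3
        _ ≤ q ^ n * (2 * K * E ^ δ) * I + 1 / 2 * (Φ b).toReal := by gcongr
        _ = _ := by rw [h5]; ring
  -- monotone convergence as the truncation level tends to infinity
  have hlim : Tendsto (fun j : ℕ => ∫⁻ y in Metric.ball x₀ (R / 2),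
      ENNReal.ofReal (G y * min (G y) j ^ δ)) atTop
      (𝓝 (∫⁻ y in Metric.ball x₀ (R / 2), ENNReal.ofReal (G y ^ (1 + δ)))) := by
    refine lintegral_tendsto_of_tendsto_of_monotone (fun j => ?_) ?_ ?_
    · exact (hG.mul ((hG.min measurable_const).pow_const δ)).ennreal_ofReal.aemeasurable
    · refine Eventually.of_forall fun y i j hij => ENNReal.ofReal_le_ofReal ?_
      refine mul_le_mul_of_nonneg_left (Real.rpow_le_rpow (le_min (hG0 y) (Nat.cast_nonneg _))
        (min_le_min_left _ (by exact_mod_cast hij)) hδ0.le) (hG0 y)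
    · refine Eventually.of_forall fun y => tendsto_const_nhds.congr' ?_
      filter_upwards [eventually_ge_atTop ⌈G y⌉₊] with j hj
      rw [min_eq_left ((Nat.le_ceil _).trans (by exact_mod_cast hj)),
        Real.rpow_one_add' (hG0 y) (by linarith)]
  refine (le_of_tendsto' hlim fun j => htrunc j (Nat.cast_nonneg _)).trans ?_
  have hE0 : 0 ≤ E := by linarith
  calc ENNReal.ofReal (Ci * (22 ^ n * (2 * K) * E ^ δ * I))
      = ENNReal.ofReal (Ci * (22 ^ n * (2 * K))) * (ENNReal.ofReal (E ^ δ) * ENNReal.ofReal I) := by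
        rw [← ENNReal.ofReal_mul (by positivity), ← ENNReal.ofReal_mul (by positivity)]
        congr 1; ring
    _ ≤ ENNReal.ofReal (Ci * (22 ^ n * (2 * K))) *
          (ENNReal.ofReal (E ^ δ) * (ENNReal.ofReal E * V)) := by
        gcongr
        rw [hIE, hIm, ← hEm]
        gcongr
        exact le_self_add
    _ = _ := by
        rw [hEm, ENNReal.ofReal_rpow_of_pos (by linarith), Real.rpow_one_add' hE0 (by linarith),
          ENNReal.ofReal_mul hE0, mul_left_comm (ENNReal.ofReal (E ^ δ)),
          mul_comm (ENNReal.ofReal (E ^ δ)), mul_assoc, mul_left_comm V,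
          mul_left_comm (ENNReal.ofReal E), mul_comm V, mul_assoc]

end GehringConclusion

/-! ### Quasi-minimality -/

section QuasiMinimality

variable {n N m : ℕ} {O : Set (Sp n)}

/-- A Carathéodory function composed with measurable functions is measurable. -/
lemma IsCaratheodoryFun.aemeasurable_comp {f : Sp n → LowJet n N m → TopJet n N m → ℝ}
    (hf : IsCaratheodoryFun O f) {g : Sp n → LowJet n N m × TopJet n N m}
    (hg : AEMeasurable g (volume.restrict O)) :
    AEMeasurable (fun x => f x (g x).1 (g x).2) (volume.restrict O) := by
  have hsm : StronglyMeasurable (hg.mk g) := hg.measurable_mk.stronglyMeasurable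
  -- for simple functions the composition is measurable, and they are dense by continuity
  have hsimple : ∀ φ : SimpleFunc (Sp n) (LowJet n N m × TopJet n N m),
      AEMeasurable (fun x => f x (φ x).1 (φ x).2) (volume.restrict O) := by
    intro φ
    have e : (fun x => f x (φ x).1 (φ x).2) = fun x =>
        ∑ c ∈ φ.range, (φ ⁻¹' {c}).indicator (fun x => f x c.1 c.2) x := by
      funext x
      rw [Finset.sum_eq_single (φ x)]
      · simp
      · intro c _ hc
        exact indicator_of_notMem (fun h => hc (by simpa using h.symm)) _
      · intro h
        exact absurd (φ.mem_range_self x) h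
    rw [e]
    exact Finset.aemeasurable_fun_sum _ fun c _ =>
      (hf.measurable c.1 c.2).indicator (φ.measurableSet_fiber c)
  have hlim : AEMeasurable (fun x => f x (hg.mk g x).1 (hg.mk g x).2) (volume.restrict O) := by
    refine aemeasurable_of_tendsto_metrizable_ae atTop (fun j => hsimple (hsm.approx j)) ?_
    filter_upwards [hf.continuous] with x hx
    exact (hx.tendsto (hg.mk g x)).comp (hsm.tendsto_approx x)
  refine hlim.congr ?_
  filter_upwards [hg.ae_eq_mk] with x hx
  rw [← hx]

/-- The vector of the entries of order `m` of a jet. -/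
noncomputable def jetVec (m : ℕ) (U : (Fin n → ℕ) → Sp n → Sp N) (x : Sp n) : TopJet n N m :=
  WithLp.toLp 2 fun a => U a.1.1 x a.2

lemma topJet_eq_jetVec (u : Sp n → Sp N) (x : Sp n) :
    topJet O m u x = jetVec m (fun α => weakD O α u) x := rfl

lemma norm_jetVec_sq (U : (Fin n → ℕ) → Sp n → Sp N) (x : Sp n) :
    ‖jetVec m U x‖ ^ 2 = ∑ α ∈ indices n m, ‖U α x‖ ^ 2 := by
  rw [EuclideanSpace.norm_sq_eq, Fintype.sum_prod_type,
    ← Finset.sum_coe_sort (indices n m) fun α => ‖U α x‖ ^ 2]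
  refine Finset.sum_congr rfl fun α _ => ?_
  rw [EuclideanSpace.norm_sq_eq]
  rfl

lemma norm_le_norm_jetVec (U : (Fin n → ℕ) → Sp n → Sp N) (x : Sp n) {α : Fin n → ℕ}
    (hα : ∑ i, α i = m) : ‖U α x‖ ≤ ‖jetVec m U x‖ := by
  refine (sq_le_sq₀ (norm_nonneg _) (norm_nonneg _)).1 ?_
  rw [norm_jetVec_sq]
  exact Finset.single_le_sum (f := fun β => ‖U β x‖ ^ 2) (fun _ _ => by positivity)
    (mem_indices.2 hα)

lemma norm_jetVec_le (U : (Fin n → ℕ) → Sp n → Sp N) (x : Sp n) :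
    ‖jetVec m U x‖ ≤ jetSum U m x := by
  refine (sq_le_sq₀ (norm_nonneg _) (jetSum_nonneg U m x)).1 ?_
  rw [norm_jetVec_sq]
  exact Finset.sum_sq_le_sq_sum_of_nonneg fun _ _ => norm_nonneg _

lemma jetSum_le_card_mul (U : (Fin n → ℕ) → Sp n → Sp N) (x : Sp n) :
    jetSum U m x ≤ (indices n m).card * ‖jetVec m U x‖ := by
  rw [← nsmul_eq_mul]
  exact Finset.sum_le_card_nsmul _ _ _ fun α hα => norm_le_norm_jetVec U x (mem_indices.1 hα)

lemma MemSobolevLoc.aemeasurable_weakD {u : Sp n → Sp N}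
    (hu : MemSobolevLoc O m u) {α : Fin n → ℕ} (hα : ∑ i, α i ≤ m) :
    AEMeasurable (weakD O α u) (volume.restrict O) :=
  (hu.isWeakDeriv α hα).locInt_deriv.aestronglyMeasurable.aemeasurable

lemma MemSobolevLoc.aemeasurable_topJet {u : Sp n → Sp N}
    (hu : MemSobolevLoc O m u) : AEMeasurable (topJet O m u) (volume.restrict O) := by
  refine (WithLp.measurable_toLp 2 _).comp_aemeasurable (aemeasurable_pi_iff.2 fun a => ?_)
  have h := hu.aemeasurable_weakD (mem_indices.1 a.1.2).le
  exact ((EuclideanSpace.proj a.2 : Sp N →L[ℝ] ℝ).continuous.measurable).comp_aemeasurable h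

lemma MemSobolevLoc.aemeasurable_lowJet {u : Sp n → Sp N}
    (hu : MemSobolevLoc O m u) : AEMeasurable (lowJet O m u) (volume.restrict O) := by
  refine (WithLp.measurable_toLp 2 _).comp_aemeasurable (aemeasurable_pi_iff.2 fun a => ?_)
  have h := hu.aemeasurable_weakD
    ((mem_indices.1 a.1.2.2).trans_le a.1.1.2.le)
  exact ((EuclideanSpace.proj a.2 : Sp N →L[ℝ] ℝ).continuous.measurable).comp_aemeasurable h

/-- The derivatives of order `m` vanish almost everywhere on an open set where the function does. -/
lemma MemSobolevLoc.topJet_ae_eq_zero {φ : Sp n → Sp N} (hφ : MemSobolevLoc O m φ)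
    {W : Set (Sp n)} (hW : IsOpen W) (hWO : W ⊆ O) (h0 : ∀ᵐ x ∂(volume.restrict W), φ x = 0) :
    ∀ᵐ x ∂(volume.restrict W), topJet O m φ x = 0 := by
  have : ∀ a : MultiIndex n m, ∀ᵐ x ∂(volume.restrict W), weakD O a.1 φ x = 0 := fun a =>
    ((hφ.isWeakDeriv a.1 (mem_indices.1 a.2).le).mono hWO).ae_eq_zero hW h0
  filter_upwards [ae_all_iff.2 this] with x hx
  ext a
  simp [topJet, hx a.1]

lemma add_rpow_le_two_rpow {a b p γ : ℝ} (ha : 0 ≤ a) (hb : 0 ≤ b) (hp : 0 ≤ p) (hpγ : p ≤ γ) :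
    (a + b) ^ p ≤ 2 ^ γ * (a ^ p + b ^ p) := by
  have h2 : (2 : ℝ) ^ p ≤ 2 ^ γ := Real.rpow_le_rpow_of_exponent_le (by norm_num) hpγ
  have h3 : (max a b) ^ p ≤ a ^ p + b ^ p := by
    rcases max_choice a b with h | h <;> rw [h]
    · linarith [Real.rpow_nonneg hb p]
    · linarith [Real.rpow_nonneg ha p]
  have h4 : 0 ≤ max a b := ha.trans (le_max_left _ _)
  calc (a + b) ^ p ≤ (2 * max a b) ^ p := by
        gcongr
        linarith [le_max_left a b, le_max_right a b]
    _ = 2 ^ p * (max a b) ^ p := Real.mul_rpow (by norm_num) h4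
    _ ≤ _ := by gcongr

/-- The lower growth function dominates `|z|^p`. -/
lemma rpow_le_growth {a μ p : ℝ} (ha : 0 ≤ a) (hp : 0 ≤ p) :
    a ^ p ≤ (μ ^ 2 + a ^ 2) ^ (p / 2) := by
  calc a ^ p = (a ^ 2) ^ (p / 2) := by
        rw [← Real.rpow_natCast, ← Real.rpow_mul ha]; congr 1; push_cast; ring
    _ ≤ _ := by gcongr; nlinarith [sq_nonneg μ]

/-- The upper growth function is dominated by `1 + |z|^p`, uniformly for `0 < μ ≤ 1`. -/
lemma growth_le {a μ p γ : ℝ} (ha : 0 ≤ a) (hμ0 : 0 < μ) (hμ1 : μ ≤ 1) (hp : 0 ≤ p) (hpγ : p ≤ γ) :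
    (μ ^ 2 + a ^ 2) ^ (p / 2) ≤ 2 ^ γ * (1 + a ^ p) := by
  calc (μ ^ 2 + a ^ 2) ^ (p / 2) ≤ ((1 + a) ^ 2) ^ (p / 2) := by
        gcongr; nlinarith
    _ = (1 + a) ^ p := by
        rw [← Real.rpow_natCast, ← Real.rpow_mul (by positivity)]; congr 1; push_cast; ring
    _ ≤ 2 ^ γ * (1 ^ p + a ^ p) := add_rpow_le_two_rpow zero_le_one ha hp hpγ
    _ = _ := by rw [Real.one_rpow]

/-- The support of a function vanishing off a compact subset `C` of `O` is the complement in `C` of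
the largest open set on which the function vanishes almost everywhere; in particular it is compact.
-/
lemma spt_eq_sdiff {C : Set (Sp n)} {φ : Sp n → Sp N} (hCO : C ⊆ O)
    (hC : IsCompact C) (h0 : ∀ x ∉ C, φ x = 0) :
    IsOpen {x | ∃ U ∈ 𝓝 x, ∀ᵐ y ∂(volume.restrict (U ∩ O)), φ y = 0} ∧
      spt O φ = C \ {x | ∃ U ∈ 𝓝 x, ∀ᵐ y ∂(volume.restrict (U ∩ O)), φ y = 0} := by
  constructor
  · rw [isOpen_iff_mem_nhds]
    rintro x ⟨U, hU, h⟩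
    obtain ⟨V, hVU, hV, hxV⟩ := mem_nhds_iff.1 hU
    refine mem_of_superset (hV.mem_nhds hxV) fun y hy =>
      ⟨U, mem_of_superset (hV.mem_nhds hy) hVU, h⟩
  · ext x
    constructor
    · rintro ⟨hxO, hx⟩
      refine ⟨?_, fun ⟨U, hU, h⟩ => hx U hU h⟩
      by_contra hxC
      refine hx Cᶜ (hC.isClosed.isOpen_compl.mem_nhds hxC) ?_
      have : MeasurableSet {y | y ∈ Cᶜ} := hC.isClosed.isOpen_compl.measurableSet
      have h1 : ∀ᵐ y ∂(volume.restrict Cᶜ), φ y = 0 := by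
        filter_upwards [ae_restrict_mem this] with y hy using h0 y hy
      exact ae_mono (Measure.restrict_mono inter_subset_left le_rfl) h1
    · rintro ⟨hxC, hx⟩
      exact ⟨hCO hxC, fun U hU h => hx ⟨U, hU, h⟩⟩

/-- A local minimizer is a quasi-minimizer of the integral of `|D^m u|^{p(x)}`: only the growth of
the integrand enters. -/
lemma IsLocalMinimizer.lintegral_topJet_le (hO : IsOpen O) {p : Sp n → ℝ} {γ μ L : ℝ}
    {f : Sp n → LowJet n N m → TopJet n N m → ℝ} {u : Sp n → Sp N}
    (hγ : 0 ≤ γ) (hp : ∀ x ∈ O, 1 ≤ p x ∧ p x ≤ γ) (hL : 1 ≤ L) (hμ0 : 0 < μ)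
    (hμ1 : μ ≤ 1)
    (hf : IsCaratheodoryFun O f) (hg : HasGrowth O p μ L f) (hu : IsLocalMinimizer O p f u)
    {C : Set (Sp n)} (hC : IsCompact C) (hCO : C ⊆ O) {φ : Sp n → Sp N}
    (hφ : MemSobolevLoc O m φ) (h0 : ∀ x ∉ C, φ x = 0)
    (hφp : LocallyIntegrableOn (fun x => ‖topJet O m φ x‖ ^ p x) O) :
    ∫⁻ x in C, ENNReal.ofReal (‖topJet O m u x‖ ^ p x) ≤
      ENNReal.ofReal (L ^ 2 * 2 ^ γ) * (volume C +
        ∫⁻ x in C, ENNReal.ofReal (‖topJet O m u x + topJet O m φ x‖ ^ p x)) := by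
  obtain ⟨hW, hS⟩ := spt_eq_sdiff hCO hC h0
  set W := {x | ∃ U ∈ 𝓝 x, ∀ᵐ y ∂(volume.restrict (U ∩ O)), φ y = 0} with hWdef
  have hL0 : 0 < L := by linarith
  have hOm := hO.measurableSet
  have hScomp : IsCompact (spt O φ) := by rw [hS]; exact hC.diff hW
  have hSO : spt O φ ⊆ O := fun x hx => hx.1
  have hSm : MeasurableSet (spt O φ) := hScomp.measurableSet
  -- `φ`, and hence its jet, vanishes off its support
  have hWO : IsOpen (W ∩ O) := hW.inter hO
  have hφ0 : ∀ᵐ x ∂(volume.restrict (W ∩ O)), φ x = 0 := by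
    rw [ae_restrict_iff' hWO.measurableSet]
    have : volume {x | x ∈ W ∩ O ∧ φ x ≠ 0} = 0 := by
      refine measure_null_of_locally_null _ fun x hx => ?_
      obtain ⟨U, hU, h⟩ := hx.1.1
      obtain ⟨V, hVU, hV, hxV⟩ := mem_nhds_iff.1 hU
      have h' : ∀ᵐ y ∂(volume.restrict (V ∩ O)), φ y = 0 :=
        ae_mono (Measure.restrict_mono (inter_subset_inter_left _ hVU) le_rfl) h
      rw [ae_restrict_iff' (hV.inter hO).measurableSet] at h'
      refine ⟨{y | y ∈ V ∩ O ∧ φ y ≠ 0}, ?_, ?_⟩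
      · refine mem_of_superset (inter_mem_nhdsWithin _ (hV.mem_nhds hxV)) ?_
        rintro y ⟨hy, hyV⟩
        exact ⟨⟨hyV, hy.1.2⟩, hy.2⟩
      · rw [ae_iff] at h'
        convert h' using 2
        ext y
        simp only [mem_inter_iff, mem_ofPred_eq, Classical.not_imp]
    rw [ae_iff]
    convert this using 2
    ext y
    simp only [mem_inter_iff, mem_ofPred_eq, Classical.not_imp]
  have hjet0 : ∀ᵐ x ∂(volume.restrict (W ∩ O)), topJet O m φ x = 0 :=
    hφ.topJet_ae_eq_zero hWO inter_subset_right hφ0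
  have hmin := hu.minimal φ (memSobolevZero_of_compact hO hC hCO hφ h0) hφp hScomp
  have hfm : AEMeasurable (fun x => f x (lowJet O m u x) (topJet O m u x)) (volume.restrict O) :=
    hf.aemeasurable_comp ((hu.memSobolev.aemeasurable_lowJet).prodMk
      (hu.memSobolev.aemeasurable_topJet))
  have hf0 : ∀ x ∈ O, ∀ ξ z, 0 ≤ f x ξ z := fun x hx ξ z =>
    le_trans (by positivity) (hg x hx ξ z).1
  have hupp : ∀ x ∈ O, ∀ ξ z, f x ξ z ≤ L * (2 ^ γ * (1 + ‖z‖ ^ p x)) := fun x hx ξ z =>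
    (hg x hx ξ z).2.trans (mul_le_mul_of_nonneg_left
      (growth_le (norm_nonneg _) hμ0 hμ1 (by linarith [(hp x hx).1]) (hp x hx).2) hL0.le)
  have hlow : ∀ x ∈ O, ∀ ξ z, ‖z‖ ^ p x ≤ L * f x ξ z := fun x hx ξ z => by
    have h1 := (hg x hx ξ z).1
    rw [inv_mul_le_iff₀ hL0] at h1
    exact (rpow_le_growth (norm_nonneg _) (by linarith [(hp x hx).1])).trans h1
  have hfint : IntegrableOn (fun x => f x (lowJet O m u x) (topJet O m u x)) (spt O φ) := by
    have h1 : IntegrableOn (fun x => ‖topJet O m u x‖ ^ p x) (spt O φ) :=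
      hu.locInt.integrableOn_compact_subset hSO hScomp
    have h2 : IntegrableOn (fun x => L * (2 ^ γ * (1 + ‖topJet O m u x‖ ^ p x))) (spt O φ) :=
      (((integrableOn_const hScomp.measure_lt_top.ne).add h1).const_mul _).const_mul _
    refine Integrable.mono' h2
      (hfm.mono_measure (Measure.restrict_mono hSO le_rfl)).aestronglyMeasurable ?_
    filter_upwards [ae_restrict_mem hSm] with x hx
    rw [Real.norm_of_nonneg (hf0 x (hSO hx) _ _)]
    exact hupp x (hSO hx) _ _
  have hp2 : (1 : ℝ) ≤ L ^ 2 * 2 ^ γ :=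
    one_le_mul_of_one_le_of_one_le (one_le_pow₀ hL) (Real.one_le_rpow (by norm_num) hγ)
  have hCS : C = spt O φ ∪ (C ∩ W) := by rw [hS, sdiff_union_inter]
  have hCWm : MeasurableSet (C ∩ W) := hC.measurableSet.inter hW.measurableSet
  have hdisj : Disjoint (spt O φ) (C ∩ W) := by
    rw [hS]; exact disjoint_sdiff_inter
  set B := L ^ 2 * 2 ^ γ with hB
  have hpart1 : ∫⁻ x in spt O φ, ENNReal.ofReal (‖topJet O m u x‖ ^ p x) ≤
      ENNReal.ofReal B * (volume (spt O φ) +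
        ∫⁻ x in spt O φ, ENNReal.ofReal (‖topJet O m u x + topJet O m φ x‖ ^ p x)) := by
    calc ∫⁻ x in spt O φ, ENNReal.ofReal (‖topJet O m u x‖ ^ p x)
        ≤ ∫⁻ x in spt O φ, ENNReal.ofReal L *
            ENNReal.ofReal (f x (lowJet O m u x) (topJet O m u x)) := by
          refine setLIntegral_mono' hSm fun x hx => ?_
          rw [← ENNReal.ofReal_mul hL0.le]
          exact ENNReal.ofReal_le_ofReal (hlow x (hSO hx) _ _)
      _ = ENNReal.ofReal L *
            ENNReal.ofReal (∫ x in spt O φ, f x (lowJet O m u x) (topJet O m u x)) := by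
          rw [lintegral_const_mul' _ _ ENNReal.ofReal_ne_top,
            ofReal_integral_eq_lintegral_ofReal hfint]
          filter_upwards [ae_restrict_mem hSm] with x hx using hf0 x (hSO hx) _ _
      _ ≤ ENNReal.ofReal L * ∫⁻ x in spt O φ, ENNReal.ofReal
            (f x (lowJet O m u x + lowJet O m φ x) (topJet O m u x + topJet O m φ x)) := by
          gcongr
          refine (ENNReal.ofReal_le_ofReal hmin).trans ?_
          -- if the right-hand side is not integrable its Bochner integral is zero
          by_cases hi : IntegrableOn (fun x => f x (lowJet O m u x + lowJet O m φ x)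
            (topJet O m u x + topJet O m φ x)) (spt O φ)
          · rw [ofReal_integral_eq_lintegral_ofReal hi]
            filter_upwards [ae_restrict_mem hSm] with x hx using hf0 x (hSO hx) _ _
          · rw [integral_undef hi]; simp
      _ ≤ ENNReal.ofReal L * ∫⁻ x in spt O φ, ENNReal.ofReal (L * 2 ^ γ) *
            (1 + ENNReal.ofReal (‖topJet O m u x + topJet O m φ x‖ ^ p x)) := by
          gcongr ENNReal.ofReal L * ?_
          refine setLIntegral_mono' hSm fun x hx => ?_
          rw [← ENNReal.ofReal_one, ← ENNReal.ofReal_add zero_le_one (by positivity),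
            ← ENNReal.ofReal_mul (by positivity)]
          refine ENNReal.ofReal_le_ofReal ((hupp x (hSO hx) _ _).trans (le_of_eq ?_))
          ring
      _ = _ := by
          rw [lintegral_const_mul' _ _ ENNReal.ofReal_ne_top, lintegral_add_left measurable_const,
            setLIntegral_const, one_mul, ← mul_assoc, ← ENNReal.ofReal_mul hL0.le, hB]
          congr 2
          ring
  have hpart2 : ∫⁻ x in C ∩ W, ENNReal.ofReal (‖topJet O m u x‖ ^ p x) ≤
      ENNReal.ofReal B * (volume (C ∩ W) +
        ∫⁻ x in C ∩ W, ENNReal.ofReal (‖topJet O m u x + topJet O m φ x‖ ^ p x)) := by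
    have : ∫⁻ x in C ∩ W, ENNReal.ofReal (‖topJet O m u x‖ ^ p x) =
        ∫⁻ x in C ∩ W, ENNReal.ofReal (‖topJet O m u x + topJet O m φ x‖ ^ p x) := by
      refine lintegral_congr_ae ?_
      have hsub : C ∩ W ⊆ W ∩ O := fun x hx => ⟨hx.2, hCO hx.1⟩
      filter_upwards [ae_mono (Measure.restrict_mono hsub le_rfl) hjet0]
        with x hx
      rw [hx, add_zero]
    rw [this]
    refine le_trans le_add_self (le_mul_of_one_le_left (zero_le) ?_)
    exact ENNReal.one_le_ofReal.2 hp2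
  conv_lhs => rw [hCS]
  rw [lintegral_union hCWm hdisj]
  refine (add_le_add hpart1 hpart2).trans (le_of_eq ?_)
  conv_rhs => rw [hCS]
  rw [lintegral_union hCWm hdisj, measure_union hdisj hCWm, ← mul_add, add_add_add_comm]

end QuasiMinimality

/-! ### Caccioppoli's inequality -/

section Caccioppoli

variable {n N m : ℕ} {O : Set (Sp n)}

/-- The jet of the difference of `u` and a smooth function `P`. -/
noncomputable def diffJet (O : Set (Sp n)) (u P : Sp n → Sp N) (α : Fin n → ℕ) (x : Sp n) : Sp N :=
  weakD O α u x - multiD α P x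

lemma MemSobolevLoc.isJet_diffJet {u P : Sp n → Sp N} (hu : MemSobolevLoc O m u)
    (hP : ContDiff ℝ ∞ P) : IsJet O m (diffJet O u P) :=
  hu.isJet.sub (isJet_of_contDiff m hP)

/-- The size `∑_{j<m} ρ^{-(m-j)} |D^j|` of the derivatives of order less than `m` of a jet, scaled
like a derivative of order `m`. -/
noncomputable def lowSize (m : ℕ) (ρ : ℝ) (V : (Fin n → ℕ) → Sp n → Sp N) (x : Sp n) : ℝ :=
  ∑ j ∈ Finset.range m, ρ⁻¹ ^ (m - j) * jetSum V j x

lemma lowSize_nonneg {ρ : ℝ} (hρ : 0 < ρ) (V : (Fin n → ℕ) → Sp n → Sp N) (x : Sp n) :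
    0 ≤ lowSize m ρ V x :=
  Finset.sum_nonneg fun j _ => by have := jetSum_nonneg V j x; positivity

lemma lowSize_le {ρ d : ℝ} (hd : 0 < d) (hdρ : d ≤ ρ) (V : (Fin n → ℕ) → Sp n → Sp N) (x : Sp n) :
    lowSize m d V x ≤ (ρ / d) ^ m * lowSize m ρ V x := by
  have hρ : 0 < ρ := hd.trans_le hdρ
  unfold lowSize
  rw [Finset.mul_sum]
  refine Finset.sum_le_sum fun j hj => ?_
  rw [← mul_assoc]
  refine mul_le_mul_of_nonneg_right ?_ (jetSum_nonneg V j x)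
  have h1 : 1 ≤ ρ / d := (one_le_div hd).2 hdρ
  calc d⁻¹ ^ (m - j) = (ρ / d) ^ (m - j) * ρ⁻¹ ^ (m - j) := by
        rw [← mul_pow]; congr 1; field_simp
    _ ≤ _ := by
        refine mul_le_mul_of_nonneg_right (pow_le_pow_right₀ h1 (Nat.sub_le _ _)) (by positivity)

/-- The competitor `-η (u - P)`: its derivatives of order `m` differ from those of `-η u` by terms
of lower order. -/
lemma exists_competitor (n m : ℕ) : ∃ A : ℝ, 1 ≤ A ∧ ∀ {N : ℕ} {O : Set (Sp n)} {u P : Sp n → Sp N},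
    IsOpen O → MemSobolevLoc O m u → ContDiff ℝ ∞ P →
    (∀ α : Fin n → ℕ, m ≤ ∑ i, α i → ∀ x, multiD α P x = 0) → ∀ (y : Sp n) (t s : ℝ), t < s →
    ∃ (η : Sp n → ℝ) (φ : Sp n → Sp N), (∀ x, 0 ≤ η x ∧ η x ≤ 1) ∧
      (∀ x ∈ Metric.closedBall y t, η x = 1) ∧ MemSobolevLoc O m φ ∧
      (∀ x ∉ Metric.closedBall y s, φ x = 0) ∧
      ∀ᵐ x ∂(volume.restrict O), ‖topJet O m φ x + η x • topJet O m u x‖ ≤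
        A * lowSize m (s - t) (diffJet O u P) x := by
  obtain ⟨A, hA0, hA⟩ := exists_ball_cutoff n m
  refine ⟨(indices n m).card * (2 ^ m * A) + 1, by
    have : 0 ≤ ((indices n m).card : ℝ) * (2 ^ m * A) := by positivity
    linarith, ?_⟩
  intro N O u P hO hu hP hPm y t s hts
  obtain ⟨η, hη, hη01, hη1, hη0, hηb⟩ := hA y t s hts
  set V := diffJet O u P with hV
  have hVj : IsJet O m V := hu.isJet_diffJet hP
  have hst : 0 < s - t := by linarith
  have key : ∀ α : Fin n → ℕ, ∑ i, α i ≤ m → ∃ z, IsWeakDeriv O α (fun x => η x • V 0 x) z ∧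
      ∀ x, ‖z x - η x • V α x‖ ≤ 2 ^ (∑ i, α i) * A *
        ∑ j ∈ Finset.range (∑ i, α i), (s - t)⁻¹ ^ (∑ i, α i - j) * jetSum V j x := fun α hα =>
    exists_isWeakDeriv_smul hO _ V η A (s - t) α (hVj.mono hα) hη hA0 hst
      (fun γ x hγ => hηb γ x (hγ.trans hα)) rfl
  have hφ : MemSobolevLoc O m fun x => -(η x • V 0 x) := fun α hα => by
    obtain ⟨z, hz, -⟩ := key α hα
    exact ⟨_, hz.neg⟩
  refine ⟨η, fun x => -(η x • V 0 x), hη01, hη1, hφ, fun x hx => by simp [hη0 x hx], ?_⟩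
  have hae : ∀ a : MultiIndex n m, ∀ᵐ x ∂(volume.restrict O),
      ‖weakD O a.1 (fun x => -(η x • V 0 x)) x + η x • weakD O a.1 u x‖ ≤
        2 ^ m * A * lowSize m (s - t) V x := by
    intro a
    have ha := mem_indices.1 a.2
    obtain ⟨z, hz, hb⟩ := key a.1 ha.le
    filter_upwards [hz.neg.weakD_ae_eq hO] with x hx
    have h1 := hb x
    rw [ha] at h1
    have h2 : V a.1 x = weakD O a.1 u x := by
      rw [hV, diffJet, hPm a.1 ha.ge, sub_zero]
    rw [h2] at h1
    rw [hx, neg_add_eq_sub, norm_sub_rev]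
    exact h1
  filter_upwards [ae_all_iff.2 hae] with x hx
  have e : topJet O m (fun x => -(η x • V 0 x)) x + η x • topJet O m u x =
      jetVec m (fun α x => weakD O α (fun x => -(η x • V 0 x)) x + η x • weakD O α u x) x := rfl
  have hlow := lowSize_nonneg (m := m) hst V x
  calc _ ≤ jetSum (fun α x => weakD O α (fun x => -(η x • V 0 x)) x + η x • weakD O α u x) m x := by
        rw [e]; exact norm_jetVec_le _ x
    _ ≤ (indices n m).card • (2 ^ m * A * lowSize m (s - t) V x) :=
        Finset.sum_le_card_nsmul _ _ _ fun α hα => hx ⟨α, hα⟩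
    _ ≤ _ := by
        rw [nsmul_eq_mul, add_mul, one_mul]
        linarith [mul_assoc ((indices n m).card : ℝ) (2 ^ m * A) (lowSize m (s - t) V x)]

/-- One step of the hole-filling argument: testing minimality with the competitor `-η (u - P)`
bounds the energy on a ball by the energy on a surrounding annulus and by lower order terms. -/
lemma exists_hole_filling (n m : ℕ) {γ L : ℝ} (hγ : 1 ≤ γ) (hL : 1 ≤ L) :
    ∃ K : ℝ, 0 < K ∧ ∀ {N : ℕ} {O : Set (Sp n)} {p : Sp n → ℝ} {μ : ℝ}
    {f : Sp n → LowJet n N m → TopJet n N m → ℝ} {u P : Sp n → Sp N}, IsOpen O →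
    ContinuousOn p O → (∀ x ∈ O, 1 ≤ p x ∧ p x ≤ γ) → 0 < μ → μ ≤ 1 → IsCaratheodoryFun O f →
    HasGrowth O p μ L f → IsLocalMinimizer O p f u → ContDiff ℝ ∞ P →
    (∀ α : Fin n → ℕ, m ≤ ∑ i, α i → ∀ x, multiD α P x = 0) →
    ∀ (y : Sp n) (ρ t s : ℝ), 0 < ρ → Metric.closedBall y (2 * ρ) ⊆ O → t < s → s - t ≤ ρ →
    s ≤ 2 * ρ →
    ∫⁻ x in Metric.closedBall y (2 * ρ),
      ENNReal.ofReal (lowSize m ρ (diffJet O u P) x ^ p x) ≠ ⊤ →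
    ∫⁻ x in Metric.closedBall y t, ENNReal.ofReal (‖topJet O m u x‖ ^ p x) ≤
      ENNReal.ofReal K * (∫⁻ x in Metric.closedBall y s \ Metric.closedBall y t,
        ENNReal.ofReal (‖topJet O m u x‖ ^ p x)) +
      ENNReal.ofReal (K * (ρ / (s - t)) ^ (m * γ)) * (volume (Metric.closedBall y (2 * ρ)) +
        ∫⁻ x in Metric.closedBall y (2 * ρ),
          ENNReal.ofReal (lowSize m ρ (diffJet O u P) x ^ p x)) := by
  obtain ⟨A, hA1, hA⟩ := exists_competitor n m
  have hγ0 : 0 ≤ γ := by linarith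
  have hQ1 : 1 ≤ L ^ 2 * 2 ^ γ :=
    one_le_mul_of_one_le_of_one_le (one_le_pow₀ hL) (Real.one_le_rpow (by norm_num) hγ0)
  obtain ⟨Q, hQ⟩ : ∃ Q : ℝ, Q = L ^ 2 * 2 ^ γ := ⟨_, rfl⟩
  rw [← hQ] at hQ1
  have h2γ : (1 : ℝ) ≤ 2 ^ γ := Real.one_le_rpow (by norm_num) hγ0
  have hAγ : (1 : ℝ) ≤ A ^ γ := Real.one_le_rpow hA1 hγ0
  refine ⟨Q * (2 ^ γ * A ^ γ), by positivity, ?_⟩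
  intro N O p μ f u P hO hpc hp hμ0 hμ1 hf hg hu hP hPm y ρ t s hρ hball hts hstρ hs hW
  obtain ⟨η, φ, hη01, hη1, hφ, hφ0, hR⟩ := hA hO hu.memSobolev hP hPm y t s hts
  have hst : 0 < s - t := by linarith
  obtain ⟨q, hq⟩ : ∃ q : ℝ, q = ρ / (s - t) := ⟨_, rfl⟩
  have hq1 : 1 ≤ q := by rw [hq]; exact (one_le_div hst).2 hstρ
  obtain ⟨F, hF⟩ : ∃ F : Sp n → ℝ, F = fun x => ‖topJet O m u x‖ ^ p x := ⟨_, rfl⟩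
  obtain ⟨w, hw⟩ : ∃ w : Sp n → ℝ, w = fun x => lowSize m ρ (diffJet O u P) x ^ p x := ⟨_, rfl⟩
  have hF0 : ∀ x, 0 ≤ F x := fun x => by rw [hF]; positivity
  have hlow : ∀ x, 0 ≤ lowSize m ρ (diffJet O u P) x := fun x => lowSize_nonneg hρ _ x
  have hw0 : ∀ x, 0 ≤ w x := fun x => by rw [hw]; exact Real.rpow_nonneg (hlow x) _
  have hs2 : Metric.closedBall y s ⊆ Metric.closedBall y (2 * ρ) :=
    Metric.closedBall_subset_closedBall hs
  have hCO : Metric.closedBall y s ⊆ O := hs2.trans hball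
  have hC : IsCompact (Metric.closedBall y s) := isCompact_closedBall y s
  obtain ⟨D, hD⟩ : ∃ D : ℝ, D = A ^ γ * q ^ (m * γ) := ⟨_, rfl⟩
  have hD0 : 0 ≤ D := by rw [hD]; positivity
  -- `D^m u + D^m φ` is `(1 - η) D^m u` up to lower order terms, which are bounded here
  have hRp : ∀ᵐ x ∂(volume.restrict O), ‖topJet O m φ x + η x • topJet O m u x‖ ^ p x ≤
      D * w x := by
    filter_upwards [hR, ae_restrict_mem hO.measurableSet] with x hx hxO
    have hpx := hp x hxO
    have hq0 : (0 : ℝ) ≤ q := by linarith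
    have hA0 : (0 : ℝ) ≤ A := by linarith
    have h1 : ‖topJet O m φ x + η x • topJet O m u x‖ ≤
        A * q ^ m * lowSize m ρ (diffJet O u P) x := by
      refine hx.trans ?_
      rw [mul_assoc, hq]
      exact mul_le_mul_of_nonneg_left (lowSize_le hst hstρ _ x) hA0
    calc _ ≤ (A * q ^ m * lowSize m ρ (diffJet O u P) x) ^ p x := by
          have := hpx.1
          gcongr
      _ = (A ^ p x * (q ^ m) ^ p x) * w x := by
          rw [Real.mul_rpow (by positivity) (hlow x), Real.mul_rpow hA0 (by positivity), hw]
      _ ≤ D * w x := by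
          refine mul_le_mul_of_nonneg_right ?_ (hw0 x)
          have e : q ^ (m * γ) = (q ^ m) ^ γ := by
            rw [Real.rpow_mul hq0, Real.rpow_natCast]
          rw [hD, e]
          exact mul_le_mul (Real.rpow_le_rpow_of_exponent_le hA1 hpx.2)
            (Real.rpow_le_rpow_of_exponent_le (one_le_pow₀ hq1) hpx.2) (by positivity)
            (by positivity)
  have hFloc := hu.locInt.integrableOn_compact_subset hCO hC
  have hFm : AEMeasurable (fun x => ENNReal.ofReal (F x))
      (volume.restrict (Metric.closedBall y s)) := by
    rw [hF]; exact hFloc.aestronglyMeasurable.aemeasurable.ennreal_ofReal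
  have hFfin : ∫⁻ x in Metric.closedBall y s, ENNReal.ofReal (F x) ≠ ⊤ := by
    rw [hF]; exact (lintegral_ofReal_le_lintegral_enorm _).trans_lt hFloc.2 |>.ne
  have hWs : ∫⁻ x in Metric.closedBall y s, ENNReal.ofReal (w x) ≤
      ∫⁻ x in Metric.closedBall y (2 * ρ), ENNReal.ofReal (w x) := lintegral_mono_set hs2
  have hW' : ∫⁻ x in Metric.closedBall y (2 * ρ), ENNReal.ofReal (w x) ≠ ⊤ := by rw [hw]; exact hW
  -- the competitor is admissible because the lower order terms have finite energy
  have hφp : LocallyIntegrableOn (fun x => ‖topJet O m φ x‖ ^ p x) O := by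
    have hpm : AEMeasurable p (volume.restrict O) := hpc.aemeasurable hO.measurableSet
    refine IntegrableOn.locallyIntegrableOn
      ⟨(hφ.aemeasurable_topJet.norm.pow hpm).aestronglyMeasurable, ?_⟩
    have hOC : IsOpen (O \ Metric.closedBall y s) := hO.sdiff hC.isClosed
    have hz := hφ.topJet_ae_eq_zero hOC sdiff_subset ((ae_restrict_iff' hOC.measurableSet).2
      (Eventually.of_forall fun x hx => hφ0 x hx.2))
    rw [ae_restrict_iff' hOC.measurableSet] at hz
    have hle : ∀ᵐ x ∂(volume.restrict O), ‖‖topJet O m φ x‖ ^ p x‖ₑ ≤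
        (Metric.closedBall y s).indicator (fun x => ENNReal.ofReal (2 ^ γ) *
          (ENNReal.ofReal (F x) + ENNReal.ofReal D * ENNReal.ofReal (w x))) x := by
      filter_upwards [hRp, ae_restrict_of_ae hz, ae_restrict_mem hO.measurableSet] with x hx hxz hxO
      have hpx := hp x hxO
      have hp0 : 0 < p x := by linarith
      by_cases hxs : x ∈ Metric.closedBall y s
      · rw [indicator_of_mem hxs, Real.enorm_of_nonneg (by positivity), ← ENNReal.ofReal_mul hD0,
          ← ENNReal.ofReal_add (hF0 x) (mul_nonneg hD0 (hw0 x)),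
            ← ENNReal.ofReal_mul (by positivity)]
        refine ENNReal.ofReal_le_ofReal ?_
        have h1 : ‖topJet O m φ x‖ ≤ ‖topJet O m u x‖ +
            ‖topJet O m φ x + η x • topJet O m u x‖ := by
          have e : topJet O m φ x =
              (topJet O m φ x + η x • topJet O m u x) - η x • topJet O m u x := by abel
          calc ‖topJet O m φ x‖ ≤ ‖topJet O m φ x + η x • topJet O m u x‖ +
                ‖η x • topJet O m u x‖ := by
                conv_lhs => rw [e]
                exact norm_sub_le _ _
            _ ≤ _ := by
                rw [add_comm, norm_smul, Real.norm_of_nonneg (hη01 x).1]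
                gcongr
                exact mul_le_of_le_one_left (norm_nonneg _) (hη01 x).2
        calc _ ≤ (‖topJet O m u x‖ + ‖topJet O m φ x + η x • topJet O m u x‖) ^ p x := by gcongr
          _ ≤ 2 ^ γ * (‖topJet O m u x‖ ^ p x +
              ‖topJet O m φ x + η x • topJet O m u x‖ ^ p x) :=
              add_rpow_le_two_rpow (norm_nonneg _) (norm_nonneg _) hp0.le hpx.2
          _ ≤ _ := by rw [hF]; gcongr
      · rw [hxz ⟨hxO, hxs⟩, norm_zero, Real.zero_rpow hp0.ne']
        simp
    refine (lintegral_mono_ae hle).trans_lt ?_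
    rw [lintegral_indicator hC.measurableSet, Measure.restrict_restrict hC.measurableSet,
      inter_eq_self_of_subset_left hCO, lintegral_const_mul' _ _ ENNReal.ofReal_ne_top,
      lintegral_add_left' hFm, lintegral_const_mul' _ _ ENNReal.ofReal_ne_top]
    exact ENNReal.mul_lt_top ENNReal.ofReal_lt_top (ENNReal.add_lt_top.2 ⟨hFfin.lt_top,
      ENNReal.mul_lt_top ENNReal.ofReal_lt_top (hWs.trans_lt hW'.lt_top)⟩)
  have hqm := hu.lintegral_topJet_le hO hγ0 hp hL hμ0 hμ1 hf hg hC hCO hφ hφ0 hφp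
  rw [← hQ] at hqm
  have hcomp : ∫⁻ x in Metric.closedBall y s,
      ENNReal.ofReal (‖topJet O m u x + topJet O m φ x‖ ^ p x) ≤
      ENNReal.ofReal (2 ^ γ) * ((∫⁻ x in Metric.closedBall y s \ Metric.closedBall y t,
        ENNReal.ofReal (F x)) + ENNReal.ofReal D * ∫⁻ x in Metric.closedBall y s,
          ENNReal.ofReal (w x)) := by
    have hms : MeasurableSet (Metric.closedBall y t)ᶜ :=
      Metric.isClosed_closedBall.measurableSet.compl
    have hmi : AEMeasurable ((Metric.closedBall y t)ᶜ.indicator fun x => ENNReal.ofReal (F x))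
      (volume.restrict (Metric.closedBall y s)) := hFm.indicator hms
    rw [sdiff_eq, inter_comm, ← Measure.restrict_restrict hms, ← lintegral_indicator hms,
      ← lintegral_const_mul' _ _ ENNReal.ofReal_ne_top, ← lintegral_add_left' hmi,
      ← lintegral_const_mul' _ _ ENNReal.ofReal_ne_top]
    refine lintegral_mono_ae ?_
    filter_upwards [ae_mono (Measure.restrict_mono hCO le_rfl) hRp,
      ae_restrict_mem Metric.isClosed_closedBall.measurableSet] with x hx hxs
    have hpx := hp x (hCO hxs)
    have hp0 : 0 < p x := by linarith
    have h1 : ‖topJet O m u x + topJet O m φ x‖ ≤ (1 - η x) * ‖topJet O m u x‖ +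
        ‖topJet O m φ x + η x • topJet O m u x‖ := by
      have e : topJet O m u x + topJet O m φ x = (1 - η x) • topJet O m u x +
          (topJet O m φ x + η x • topJet O m u x) := by
        rw [sub_smul, one_smul]; abel
      rw [e]
      refine (norm_add_le _ _).trans (le_of_eq ?_)
      rw [norm_smul, Real.norm_of_nonneg (by linarith [(hη01 x).2])]
    have hη0 : 0 ≤ 1 - η x := by linarith [(hη01 x).2]
    have h2 : ‖topJet O m u x + topJet O m φ x‖ ^ p x ≤
        2 ^ γ * (((1 - η x) * ‖topJet O m u x‖) ^ p x + D * w x) := by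
      calc _ ≤ ((1 - η x) * ‖topJet O m u x‖ +
            ‖topJet O m φ x + η x • topJet O m u x‖) ^ p x := by gcongr
        _ ≤ 2 ^ γ * (((1 - η x) * ‖topJet O m u x‖) ^ p x +
            ‖topJet O m φ x + η x • topJet O m u x‖ ^ p x) :=
            add_rpow_le_two_rpow (by positivity) (norm_nonneg _) hp0.le hpx.2
        _ ≤ _ := by gcongr
    refine (ENNReal.ofReal_le_ofReal h2).trans ?_
    rw [ENNReal.ofReal_mul (by positivity), ENNReal.ofReal_add (by positivity)
      (mul_nonneg hD0 (hw0 x)), ENNReal.ofReal_mul hD0]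
    gcongr
    by_cases hxt : x ∈ Metric.closedBall y t
    · rw [hη1 x hxt, sub_self, zero_mul, Real.zero_rpow hp0.ne']
      simp
    · rw [indicator_of_mem (by exact hxt)]
      refine ENNReal.ofReal_le_ofReal ?_
      rw [hF]
      refine Real.rpow_le_rpow (by positivity) ?_ hp0.le
      exact mul_le_of_le_one_left (norm_nonneg _) (by linarith [(hη01 x).1])
  have hts' : Metric.closedBall y t ⊆ Metric.closedBall y s :=
    Metric.closedBall_subset_closedBall hts.le
  have hQ0 : 0 ≤ Q := by linarith
  have hA0 : (0 : ℝ) ≤ A := by linarith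
  have hq0 : (0 : ℝ) ≤ q := by linarith
  have hqγ : (1 : ℝ) ≤ q ^ (m * γ) := Real.one_le_rpow hq1 (by positivity)
  obtain ⟨X, hX⟩ : ∃ X, X = ∫⁻ x in Metric.closedBall y s \ Metric.closedBall y t,
    ENNReal.ofReal (F x) := ⟨_, rfl⟩
  obtain ⟨Y, hY⟩ : ∃ Y, Y = ∫⁻ x in Metric.closedBall y (2 * ρ), ENNReal.ofReal (w x) := ⟨_, rfl⟩
  have e1 : (∫⁻ x in Metric.closedBall y s \ Metric.closedBall y t,
        ENNReal.ofReal (‖topJet O m u x‖ ^ p x)) = X := by rw [hX, hF]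
  have e2 : (∫⁻ x in Metric.closedBall y (2 * ρ),
        ENNReal.ofReal (lowSize m ρ (diffJet O u P) x ^ p x)) = Y := by rw [hY, hw]
  rw [e1, e2, ← hq]
  calc _ ≤ ∫⁻ x in Metric.closedBall y s, ENNReal.ofReal (‖topJet O m u x‖ ^ p x) :=
        lintegral_mono_set hts'
    _ ≤ ENNReal.ofReal Q * (volume (Metric.closedBall y (2 * ρ)) +
          ENNReal.ofReal (2 ^ γ) * (X + ENNReal.ofReal D * Y)) := by
        refine hqm.trans ?_
        gcongr
        refine hcomp.trans ?_
        rw [← hX]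
        gcongr
        rw [hY]; exact hWs
    _ = ENNReal.ofReal (Q * 2 ^ γ) * X + (ENNReal.ofReal Q * volume (Metric.closedBall y (2 * ρ)) +
          ENNReal.ofReal (Q * (2 ^ γ * D)) * Y) := by
        rw [ENNReal.ofReal_mul hQ0, ENNReal.ofReal_mul hQ0, ENNReal.ofReal_mul (by positivity)]
        ring
    _ ≤ ENNReal.ofReal (Q * (2 ^ γ * A ^ γ)) * X +
          (ENNReal.ofReal (Q * (2 ^ γ * A ^ γ) * q ^ (m * γ)) *
            volume (Metric.closedBall y (2 * ρ)) +
          ENNReal.ofReal (Q * (2 ^ γ * A ^ γ) * q ^ (m * γ)) * Y) := by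
        refine add_le_add (mul_le_mul' (ENNReal.ofReal_le_ofReal ?_) le_rfl)
          (add_le_add (mul_le_mul' (ENNReal.ofReal_le_ofReal ?_) le_rfl)
            (mul_le_mul' (ENNReal.ofReal_le_ofReal ?_) le_rfl))
        · exact mul_le_mul_of_nonneg_left (le_mul_of_one_le_right (by positivity) hAγ) hQ0
        · rw [mul_assoc]
          exact le_mul_of_one_le_right hQ0 (one_le_mul_of_one_le_of_one_le
            (one_le_mul_of_one_le_of_one_le h2γ hAγ) hqγ)
        · rw [hD]; exact le_of_eq (by ring)
    _ = _ := by rw [← mul_add]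

/-- Caccioppoli's inequality for the minimizer, with an arbitrary polynomial of degree less than `m`
subtracted. -/
lemma exists_caccioppoli (n m : ℕ) {γ L : ℝ} (hγ : 1 ≤ γ) (hL : 1 ≤ L) :
    ∃ K : ℝ, 0 < K ∧ ∀ {N : ℕ} {O : Set (Sp n)} {p : Sp n → ℝ} {μ : ℝ}
    {f : Sp n → LowJet n N m → TopJet n N m → ℝ} {u P : Sp n → Sp N}, IsOpen O →
    ContinuousOn p O → (∀ x ∈ O, 1 ≤ p x ∧ p x ≤ γ) → 0 < μ → μ ≤ 1 → IsCaratheodoryFun O f →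
    HasGrowth O p μ L f → IsLocalMinimizer O p f u → ContDiff ℝ ∞ P →
    (∀ α : Fin n → ℕ, m ≤ ∑ i, α i → ∀ x, multiD α P x = 0) →
    ∀ (y : Sp n) (ρ : ℝ), 0 < ρ → Metric.closedBall y (2 * ρ) ⊆ O →
    ∫⁻ x in Metric.closedBall y ρ, ENNReal.ofReal (‖topJet O m u x‖ ^ p x) ≤
      ENNReal.ofReal K * (volume (Metric.closedBall y (2 * ρ)) +
        ∫⁻ x in Metric.closedBall y (2 * ρ),
          ENNReal.ofReal (lowSize m ρ (diffJet O u P) x ^ p x)) := by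
  obtain ⟨K, hK0, hK⟩ := exists_hole_filling n m hγ hL
  have hK1 : 0 < 1 + K := by linarith
  obtain ⟨C, hC0, hC⟩ := exists_iteration_const (θ := K / (1 + K)) (κ := m * γ) (by positivity)
    (by rw [div_lt_one hK1]; linarith) (by positivity)
  refine ⟨C * K, by positivity, ?_⟩
  intro N O p μ f u P hO hpc hp hμ0 hμ1 hf hg hu hP hPm y ρ hρ hball
  obtain ⟨X, hX⟩ : ∃ X, X = ∫⁻ x in Metric.closedBall y (2 * ρ),
          ENNReal.ofReal (lowSize m ρ (diffJet O u P) x ^ p x) := ⟨_, rfl⟩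
  rcases eq_or_ne X ⊤ with hXt | hXt
  · rw [← hX, hXt, add_top, ENNReal.mul_top (by
      rw [Ne, ENNReal.ofReal_eq_zero, not_le]; positivity)]
    exact le_top
  have hVt : volume (Metric.closedBall y (2 * ρ)) ≠ ⊤ := measure_closedBall_lt_top.ne
  obtain ⟨E, hE⟩ : ∃ E, E = volume (Metric.closedBall y (2 * ρ)) + X := ⟨_, rfl⟩
  have hEt : E ≠ ⊤ := by rw [hE]; exact ENNReal.add_ne_top.2 ⟨hVt, hXt⟩
  obtain ⟨Φ, hΦ⟩ : ∃ Φ : ℝ → ℝ≥0∞, Φ = fun t => ∫⁻ x in Metric.closedBall y t,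
    ENNReal.ofReal (‖topJet O m u x‖ ^ p x) := ⟨_, rfl⟩
  have hmono : ∀ t s, t ≤ s → Φ t ≤ Φ s := fun t s hts => by
    rw [hΦ]; exact lintegral_mono_set (Metric.closedBall_subset_closedBall hts)
  have hΦt : ∀ t ≤ 2 * ρ, Φ t ≠ ⊤ := fun t ht => by
    refine ((hmono t _ ht).trans_lt ?_).ne
    rw [hΦ]
    exact (lintegral_ofReal_le_lintegral_enorm _).trans_lt
      (hu.locInt.integrableOn_compact_subset hball (isCompact_closedBall _ _)).2
  have key := hC (fun t => (Φ t).toReal) ρ (2 * ρ) (K * E.toReal) (Φ (2 * ρ)).toReal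
    (by linarith) (by positivity)
    (fun t ht => ENNReal.toReal_mono (hΦt _ le_rfl) (hmono _ _ ht.2)) ?_
  · have h1 := ENNReal.ofReal_le_ofReal key
    rw [ENNReal.ofReal_toReal (hΦt _ (by linarith)), ← mul_assoc,
      ENNReal.ofReal_mul (by positivity), ENNReal.ofReal_toReal hEt, hΦ, hE, hX] at h1
    exact h1
  · intro t s hρt hts hs
    have h1 := hK hO hpc hp hμ0 hμ1 hf hg hu hP hPm y ρ t s hρ hball hts (by linarith) hs
      (by rw [← hX]; exact hXt)
    rw [← hX, ← hE] at h1
    obtain ⟨Z, hZ⟩ : ∃ Z, Z = ∫⁻ x in Metric.closedBall y s \ Metric.closedBall y t,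
      ENNReal.ofReal (‖topJet O m u x‖ ^ p x) := ⟨_, rfl⟩
    have h2 : Φ s = Z + Φ t := by
      rw [hZ, hΦ, add_comm]
      have := lintegral_inter_add_sdiff (μ := volume)
        (fun x => ENNReal.ofReal (‖topJet O m u x‖ ^ p x)) (Metric.closedBall y s)
        (Metric.isClosed_closedBall (x := y) (ε := t)).measurableSet
      rw [inter_eq_self_of_subset_right (Metric.closedBall_subset_closedBall hts.le)] at this
      exact this.symm
    have hΦs := hΦt s hs
    have hZt : Z ≠ ⊤ := fun h => hΦs (by rw [h2, h, top_add])
    have h3 : (Φ s).toReal = Z.toReal + (Φ t).toReal := by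
      rw [h2, ENNReal.toReal_add hZt (hΦt t (hts.le.trans hs))]
    have hst : 0 < s - t := by linarith
    have h4 : (Φ t).toReal ≤ K * Z.toReal + K * (ρ / (s - t)) ^ (m * γ) * E.toReal := by
      refine ENNReal.toReal_le_of_le_ofReal (by positivity) ?_
      rw [ENNReal.ofReal_add (by positivity) (by positivity), ENNReal.ofReal_mul hK0.le,
        ENNReal.ofReal_mul (p := K * (ρ / (s - t)) ^ (m * γ)) (by positivity),
        ENNReal.ofReal_toReal hZt, ENNReal.ofReal_toReal hEt, hZ]
      rw [hΦ]
      exact h1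
    rw [show 2 * ρ - ρ = ρ by ring]
    have h5 : 0 ≤ (ρ / (s - t)) ^ (m * γ) * E.toReal := by positivity
    have h6 : (1 + K) * (Φ t).toReal ≤
        K * (Φ s).toReal + K * ((ρ / (s - t)) ^ (m * γ) * E.toReal) := by
      rw [h3]; linarith [mul_assoc K ((ρ / (s - t)) ^ (m * γ)) E.toReal]
    have h7 : (Φ t).toReal ≤
        (K * (Φ s).toReal + K * ((ρ / (s - t)) ^ (m * γ) * E.toReal)) / (1 + K) := by
      rw [le_div_iff₀ hK1]; linarith
    refine h7.trans ?_
    rw [add_div]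
    refine add_le_add (le_of_eq (by ring)) ?_
    refine (div_le_self (by positivity) (by linarith)).trans (le_of_eq (by ring))

end Caccioppoli

/-! ### The reverse Hölder inequality -/

section LowerOrder

variable {n N m : ℕ} {O : Set (Sp n)}

lemma ofReal_lowSize {ρ : ℝ} (hρ : 0 < ρ) (V : (Fin n → ℕ) → Sp n → Sp N) (x : Sp n) :
    ENNReal.ofReal (lowSize m ρ V x) =
      ∑ j ∈ Finset.range m, ENNReal.ofReal ρ⁻¹ ^ (m - j) * jetESum V j x := by
  unfold lowSize
  rw [ENNReal.ofReal_sum_of_nonneg fun j _ => by have := jetSum_nonneg V j x; positivity]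
  refine Finset.sum_congr rfl fun j _ => ?_
  rw [ENNReal.ofReal_mul (by positivity), ENNReal.ofReal_pow (by positivity), jetESum_eq]

/-- Subtracting a polynomial of degree less than `m` does not change the derivatives of order `m`.
-/
lemma jetESum_diffJet_le {u P : Sp n → Sp N}
    (hPm : ∀ α : Fin n → ℕ, m ≤ ∑ i, α i → ∀ x, multiD α P x = 0) (x : Sp n) :
    jetESum (diffJet O u P) m x ≤
      ((indices n m).card + 1 : ℕ) * ENNReal.ofReal ‖topJet O m u x‖ := by
  have e : jetSum (diffJet O u P) m x = jetSum (fun α => weakD O α u) m x := by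
    refine Finset.sum_congr rfl fun α hα => ?_
    rw [diffJet, hPm α (mem_indices.1 hα).ge, sub_zero]
  rw [jetESum_eq, e, ← ENNReal.ofReal_natCast, ← ENNReal.ofReal_mul (by positivity),
    topJet_eq_jetVec]
  refine ENNReal.ofReal_le_ofReal ((jetSum_le_card_mul _ x).trans ?_)
  gcongr
  exact Nat.le_succ _

/-- The Sobolev–Poincaré inequality for the lower order terms of Caccioppoli's inequality. -/
lemma exists_laverage_lowSize_le (hn : 2 ≤ n) (m : ℕ) {γ : ℝ} (hγ : 0 ≤ γ) :
    ∃ D : ℝ≥0∞, D ≠ ⊤ ∧ ∀ {N : ℕ} {O : Set (Sp n)} {u P : Sp n → Sp N} {y : Sp n} {ρ q τ : ℝ},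
      IsOpen O → MemSobolevLoc O m u → ContDiff ℝ ∞ P →
      (∀ α : Fin n → ℕ, m ≤ ∑ i, α i → ∀ x, multiD α P x = 0) →
      0 < ρ → Metric.closedBall y (2 * ρ) ⊆ O →
      (∀ α, ∑ i, α i < m → ∫ x in Metric.ball y (2 * ρ), diffJet O u P α x = 0) →
      1 ≤ q → 1 ≤ τ → ((n : ℝ) - 1) * τ ≤ n - 1 / 2 → q * τ ≤ γ →
      ⨍⁻ x in Metric.ball y (2 * ρ),
          ENNReal.ofReal (lowSize m ρ (diffJet O u P) x) ^ (q * τ) ∂volume ≤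
        D * (⨍⁻ x in Metric.ball y (2 * ρ), ENNReal.ofReal ‖topJet O m u x‖ ^ q ∂volume) ^ τ := by
  obtain ⟨C, hC1, hC⟩ := exists_jet_sobolev_poincare hn m
  obtain ⟨c, hc⟩ : ∃ c : ℝ≥0∞, c = ((indices n m).card + 1 : ℕ) := ⟨_, rfl⟩
  have hct : c ≠ ⊤ := by rw [hc]; exact ENNReal.natCast_ne_top _
  have hc1 : 1 ≤ c := by rw [hc]; exact_mod_cast Nat.le_add_left _ _
  obtain ⟨d, hd⟩ : ∃ d : ℝ≥0∞, d = ENNReal.ofReal (2 * C) ^ m := ⟨_, rfl⟩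
  have h2C : 1 ≤ ENNReal.ofReal (2 * C) := ENNReal.one_le_ofReal.2 (by linarith)
  have hdt : d ≠ ⊤ := by rw [hd]; exact ENNReal.pow_ne_top ENNReal.ofReal_ne_top
  have hd1 : 1 ≤ d := by rw [hd]; exact one_le_pow₀ h2C
  refine ⟨((m + 1 : ℕ) : ℝ≥0∞) ^ γ * (m * (d ^ γ * c ^ γ)), ?_, ?_⟩
  · exact ENNReal.mul_ne_top (ENNReal.rpow_ne_top_of_nonneg hγ (ENNReal.natCast_ne_top _))
      (ENNReal.mul_ne_top (ENNReal.natCast_ne_top _)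
        (ENNReal.mul_ne_top (ENNReal.rpow_ne_top_of_nonneg hγ hdt)
          (ENNReal.rpow_ne_top_of_nonneg hγ hct)))
  intro N O u P y ρ q τ hO hu hP hPm hρ hball hmean hq hτ hτn hqτ
  obtain ⟨V, hV⟩ : ∃ V, V = diffJet O u P := ⟨_, rfl⟩
  have hVj : IsJet O m V := by rw [hV]; exact hu.isJet_diffJet hP
  have hq0 : 0 ≤ q := by linarith
  have hτ0 : 0 ≤ τ := by linarith
  have hqτ1 : 1 ≤ q * τ := by nlinarith
  have hqτ0 : 0 ≤ q * τ := by linarith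
  set B := Metric.ball y (2 * ρ) with hB
  have hBO : B ⊆ O := Metric.ball_subset_closedBall.trans hball
  obtain ⟨X, hX⟩ : ∃ X, X = (⨍⁻ x in B, ENNReal.ofReal ‖topJet O m u x‖ ^ q ∂volume) ^ τ := ⟨_, rfl⟩
  have htop : (⨍⁻ x in B, jetESum V m x ^ q ∂volume) ^ τ ≤ c ^ γ * X := by
    have h1 : ⨍⁻ x in B, jetESum V m x ^ q ∂volume ≤
        c ^ q * ⨍⁻ x in B, ENNReal.ofReal ‖topJet O m u x‖ ^ q ∂volume := by
      rw [← laverage_const_mul' (ENNReal.rpow_ne_top_of_nonneg hq0 hct)]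
      refine laverage_mono_ae (Eventually.of_forall fun x => ?_)
      rw [← ENNReal.mul_rpow_of_nonneg _ _ hq0, hc, hV]
      exact ENNReal.rpow_le_rpow (jetESum_diffJet_le hPm x) hq0
    calc _ ≤ (c ^ q * ⨍⁻ x in B, ENNReal.ofReal ‖topJet O m u x‖ ^ q ∂volume) ^ τ := by gcongr
      _ = c ^ (q * τ) * X := by rw [ENNReal.mul_rpow_of_nonneg _ _ hτ0, ← ENNReal.rpow_mul, hX]
      _ ≤ c ^ γ * X := by gcongr
  have hterm : ∀ j ∈ Finset.range m, ⨍⁻ x in B,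
      (ENNReal.ofReal ρ⁻¹ ^ (m - j) * jetESum V j x) ^ (q * τ) ∂volume ≤ d ^ γ * c ^ γ * X := by
    intro j hj
    have hjm := Finset.mem_range.1 hj
    have h1 := hC hO hVj (by positivity : 0 < 2 * ρ) hball (by rw [hV]; exact hmean) hq hτ hτn j hjm
    have e : ENNReal.ofReal ρ⁻¹ ^ (m - j) * ENNReal.ofReal (C * (2 * ρ)) ^ (m - j) =
        ENNReal.ofReal (2 * C) ^ (m - j) := by
      rw [← mul_pow, ← ENNReal.ofReal_mul (by positivity)]
      congr 2
      field_simp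
    have hfin : (ENNReal.ofReal ρ⁻¹ ^ (m - j)) ^ (q * τ) ≠ ⊤ :=
      ENNReal.rpow_ne_top_of_nonneg hqτ0 (ENNReal.pow_ne_top ENNReal.ofReal_ne_top)
    calc _ = (ENNReal.ofReal ρ⁻¹ ^ (m - j)) ^ (q * τ) *
            ⨍⁻ x in B, jetESum V j x ^ (q * τ) ∂volume := by
          rw [← laverage_const_mul' hfin]
          simp only [ENNReal.mul_rpow_of_nonneg _ _ hqτ0]
      _ ≤ (ENNReal.ofReal ρ⁻¹ ^ (m - j)) ^ (q * τ) *
            ((ENNReal.ofReal (C * (2 * ρ)) ^ (m - j)) ^ (q * τ) * (c ^ γ * X)) := by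
          gcongr
          exact h1.trans (by gcongr)
      _ = (ENNReal.ofReal (2 * C) ^ (m - j)) ^ (q * τ) * (c ^ γ * X) := by
          rw [← mul_assoc, ← ENNReal.mul_rpow_of_nonneg _ _ hqτ0, e]
      _ ≤ d ^ γ * (c ^ γ * X) := by
          gcongr ?_ * _
          calc _ ≤ d ^ (q * τ) := by
                rw [hd]
                gcongr
                exact Nat.sub_le _ _
            _ ≤ d ^ γ := by gcongr
      _ = _ := (mul_assoc _ _ _).symm
  have hmt : (m : ℝ≥0∞) ^ (q * τ - 1) ≠ ⊤ :=
    ENNReal.rpow_ne_top_of_nonneg (by linarith) (ENNReal.natCast_ne_top _)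
  rw [← hX, ← hV]
  calc ⨍⁻ x in B, ENNReal.ofReal (lowSize m ρ V x) ^ (q * τ) ∂volume
      ≤ ⨍⁻ x in B, (m : ℝ≥0∞) ^ (q * τ - 1) * ∑ j ∈ Finset.range m,
          (ENNReal.ofReal ρ⁻¹ ^ (m - j) * jetESum V j x) ^ (q * τ) ∂volume := by
        refine laverage_mono_ae (Eventually.of_forall fun x => ?_)
        rw [ofReal_lowSize hρ]
        simpa using ENNReal.rpow_sum_le_const_mul_sum_rpow (Finset.range m)
          (fun j => ENNReal.ofReal ρ⁻¹ ^ (m - j) * jetESum V j x) hqτ1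
    _ = (m : ℝ≥0∞) ^ (q * τ - 1) * ∑ j ∈ Finset.range m,
          ⨍⁻ x in B, (ENNReal.ofReal ρ⁻¹ ^ (m - j) * jetESum V j x) ^ (q * τ) ∂volume := by
        rw [laverage_const_mul' hmt]
        congr 1
        simp only [setLAverage_eq, ENNReal.div_eq_inv_mul]
        rw [← Finset.mul_sum, lintegral_finsetSum']
        intro j hj
        exact ((hVj.aemeasurable_jetESum (Finset.mem_range.1 hj).le hBO).const_mul _).pow_const _
    _ ≤ ((m + 1 : ℕ) : ℝ≥0∞) ^ γ * (m * (d ^ γ * c ^ γ * X)) := by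
        refine mul_le_mul' ?_ ?_
        · calc (m : ℝ≥0∞) ^ (q * τ - 1) ≤ ((m + 1 : ℕ) : ℝ≥0∞) ^ (q * τ - 1) := by
                refine ENNReal.rpow_le_rpow ?_ (by linarith)
                exact_mod_cast Nat.le_succ m
            _ ≤ _ := by
                refine ENNReal.rpow_le_rpow_of_exponent_le ?_ (by linarith)
                exact_mod_cast Nat.le_add_left 1 m
        · refine (Finset.sum_le_sum hterm).trans ?_
          rw [Finset.sum_const, Finset.card_range, nsmul_eq_mul]
    _ = _ := by rw [mul_assoc, mul_assoc, mul_assoc, mul_assoc]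

end LowerOrder

section ReverseHolder

variable {n N m : ℕ} {O : Set (Sp n)}

lemma continuousOn_of_modulus {p ω₁ : _} (hσ : IsModulus ω₁)
    (hp : ∀ x ∈ O, ∀ y ∈ O, x ≠ y → |p x - p y| ≤ ω₁ ‖x - y‖) : ContinuousOn p O := by
  intro x hx
  rw [ContinuousWithinAt, Metric.tendsto_nhds]
  intro ε hε
  have h1 : ∀ᶠ r in 𝓝[>] (0 : ℝ), ω₁ r < ε := hσ.tendsto.eventually (gt_mem_nhds hε)
  obtain ⟨d, hd, hd1⟩ := (mem_nhdsGT_iff_exists_Ioo_subset).1 h1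
  filter_upwards [inter_mem_nhdsWithin O (Metric.ball_mem_nhds x hd)] with y hy
  rcases eq_or_ne y x with rfl | hyx
  · simpa using hε
  · rw [Real.dist_eq]
    refine (hp y hy.1 x hx hyx).trans_lt (hd1 ⟨norm_pos_iff.2 (sub_ne_zero.2 hyx), ?_⟩)
    rw [← dist_eq_norm]; exact hy.2

lemma laverage_add_const {B : Set (Sp n)} (h0 : volume B ≠ 0) (ht : volume B ≠ ⊤) (c : ℝ≥0∞)
    (f : Sp n → ℝ≥0∞) :
    ⨍⁻ x in B, (c + f x) ∂volume = c + ⨍⁻ x in B, f x ∂volume := by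
  rw [setLAverage_eq, setLAverage_eq, lintegral_add_left measurable_const, setLIntegral_const,
    ENNReal.add_div, ENNReal.mul_div_cancel_right h0 ht]

lemma rpow_le_one_add_rpow (a : ℝ≥0∞) {b c : ℝ} (hb : 0 ≤ b) (hbc : b ≤ c) :
    a ^ b ≤ 1 + a ^ c := by
  rcases le_total a 1 with h | h
  · exact (ENNReal.rpow_le_one h hb).trans le_self_add
  · exact (ENNReal.rpow_le_rpow_of_exponent_le h hbc).trans le_add_self

/-- The logarithmic condition on the modulus of continuity makes `r ^ (-ω₁ r)` bounded. -/
lemma rpow_le_of_log_condition {L M v r σ e : ℝ} (hM : 0 ≤ M) (hv : 0 < v) (hr : 0 < r)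
    (hr1 : r ≤ 1) (hσ1 : σ ≤ 1) (hlog : σ * Real.log (1 / r) ≤ L) (he0 : 0 ≤ e)
    (he : e ≤ 2 * σ) :
    (2 + M / (r ^ n * v)) ^ e ≤ (2 + M / v) ^ (2 : ℝ) * Real.exp (2 * n * L) := by
  have hrn : 0 < r ^ n := by positivity
  have hrn1 : r ^ n ≤ 1 := pow_le_one₀ hr.le hr1
  have h2 : 1 ≤ 2 + M / v := by
    have : 0 ≤ M / v := by positivity
    linarith
  have h1 : 2 + M / (r ^ n * v) ≤ (2 + M / v) * (r ^ n)⁻¹ := by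
    have : 1 ≤ (r ^ n)⁻¹ := (one_le_inv₀ hrn).2 hrn1
    rw [add_mul]
    refine add_le_add (by linarith) (le_of_eq ?_)
    field_simp
  calc (2 + M / (r ^ n * v)) ^ e ≤ ((2 + M / v) * (r ^ n)⁻¹) ^ e := by gcongr
    _ = (2 + M / v) ^ e * ((r ^ n)⁻¹) ^ e := Real.mul_rpow (by linarith) (by positivity)
    _ ≤ _ := by
      gcongr
      · linarith
      · rw [Real.rpow_def_of_pos (by positivity), Real.exp_le_exp, Real.log_inv, Real.log_pow]
        rw [Real.log_div one_ne_zero hr.ne', Real.log_one, zero_sub] at hlog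
        have hlr : 0 ≤ -Real.log r := by linarith [Real.log_nonpos hr.le hr1]
        have h3 : e * (-Real.log r) ≤ 2 * L := by
          calc e * (-Real.log r) ≤ 2 * σ * (-Real.log r) := by gcongr
            _ ≤ 2 * L := by linarith
        calc -(n * Real.log r) * e = n * (e * (-Real.log r)) := by ring
          _ ≤ n * (2 * L) := by gcongr
          _ = _ := by ring

/-- The reverse Hölder inequality for `|D^m u|^{p(x)}` on balls so small that the oscillation of the
exponent is at most `ε`. The exponent `s` and `ε` depend only on `n` and `γ₁`. -/
theorem exists_reverse_holder (hn : 2 ≤ n) {γ₁ : ℝ} (hγ₁ : 1 < γ₁) :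
    ∃ s ε : ℝ, 0 < s ∧ s < 1 ∧ 0 < ε ∧ ∀ (γ₂ L M : ℝ) (m : ℕ), γ₁ ≤ γ₂ → 1 ≤ L → 0 ≤ M →
    ∃ K : ℝ, 1 ≤ K ∧ ∀ {N : ℕ} {ω₁ : ℝ → ℝ} {μ : ℝ} {O : Set (Sp n)} {p : Sp n → ℝ}
      {f : Sp n → LowJet n N m → TopJet n N m → ℝ} {u : Sp n → Sp N}, IsOpen O → IsModulus ω₁ →
      (∀ R ∈ Ioc (0 : ℝ) 1, ω₁ R * Real.log (1 / R) ≤ L) → (∀ x ∈ O, γ₁ ≤ p x ∧ p x ≤ γ₂) →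
      (∀ x ∈ O, ∀ y ∈ O, x ≠ y → |p x - p y| ≤ ω₁ ‖x - y‖) → 0 < μ → μ ≤ 1 →
      IsCaratheodoryFun O f → HasGrowth O p μ L f → IsLocalMinimizer O p f u →
      ∫⁻ x in O, ENNReal.ofReal (‖topJet O m u x‖ ^ p x) ≤ ENNReal.ofReal M →
      ∀ (y : Sp n) (ρ : ℝ), 0 < ρ → 2 * ρ ≤ 1 → ω₁ (2 * ρ) ≤ ε → Metric.closedBall y (2 * ρ) ⊆ O →
      ⨍⁻ x in Metric.ball y ρ, ENNReal.ofReal (‖topJet O m u x‖ ^ p x) ∂volume ≤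
        ENNReal.ofReal K * ((⨍⁻ x in Metric.ball y (2 * ρ),
          ENNReal.ofReal (‖topJet O m u x‖ ^ p x) ^ s ∂volume) ^ (1 / s) + 1) := by
  have : Nonempty (Fin n) := ⟨⟨0, by omega⟩⟩
  have hn' : (2 : ℝ) ≤ n := by exact_mod_cast hn
  have hγ₁0 : 0 < γ₁ := by linarith
  -- `t` is the gain of the Sobolev–Poincaré inequality
  obtain ⟨t, ht⟩ : ∃ t : ℝ, t = (n - 1 / 2) / (n - 1) := ⟨_, rfl⟩
  have hn1 : (0 : ℝ) < n - 1 := by linarith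
  have ht1 : 1 < t := by rw [ht, one_lt_div hn1]; linarith
  have htn : (n - 1) * t = n - 1 / 2 := by rw [ht, mul_div_cancel₀ _ hn1.ne']
  -- `s ≥ 1 / γ₁` makes `s p₁` an admissible exponent, and `s > 1 / t` leaves room for the
  -- oscillation of the exponent: `p₂ ≤ t s p₁` on balls where the modulus of continuity is small
  obtain ⟨s, hs⟩ : ∃ s : ℝ, s = max (1 / γ₁) ((1 + 1 / t) / 2) := ⟨_, rfl⟩
  have ht0 : 0 < t := by linarith
  have h1t : 1 / t < 1 := by rw [div_lt_one ht0]; exact ht1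
  have hs1 : s < 1 := by
    rw [hs]; refine max_lt (by rw [div_lt_one hγ₁0]; exact hγ₁) (by linarith)
  have hs0 : 0 < s := by rw [hs]; exact lt_max_of_lt_left (by positivity)
  have hsγ : 1 ≤ s * γ₁ := by
    rw [← div_le_iff₀ hγ₁0, hs]; exact le_max_left _ _
  have hst : 1 < t * s := by
    have : (1 + 1 / t) / 2 ≤ s := by rw [hs]; exact le_max_right _ _
    calc 1 < (t + 1) / 2 := by linarith
      _ = t * ((1 + 1 / t) / 2) := by field_simp
      _ ≤ t * s := by gcongr
  obtain ⟨ε, hε⟩ : ∃ ε : ℝ, ε = min 1 ((t * s - 1) * γ₁ / 2) := ⟨_, rfl⟩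
  have hε0 : 0 < ε := by
    rw [hε]; exact lt_min one_pos (by have : 0 < t * s - 1 := by linarith
                                      positivity)
  refine ⟨s, ε, hs0, hs1, hε0, ?_⟩
  intro γ₂ L M m hγ hL hM
  obtain ⟨K₁, hK₁0, hK₁⟩ := exists_caccioppoli n m (γ := γ₂) (L := L) (by linarith) hL
  obtain ⟨D, hDt, hD⟩ := exists_laverage_lowSize_le (n := n) hn m (γ := γ₂ + 1) (by linarith)
  obtain ⟨v, hv⟩ : ∃ v : ℝ, v = (volume (Metric.ball (0 : Sp n) 1)).toReal := ⟨_, rfl⟩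
  have hvt : volume (Metric.ball (0 : Sp n) 1) = ENNReal.ofReal v := by
    rw [hv, ENNReal.ofReal_toReal measure_ball_lt_top.ne]
  have hv0 : 0 < v := by
    rw [hv]
    exact ENNReal.toReal_pos (Metric.measure_ball_pos _ _ one_pos).ne' measure_ball_lt_top.ne
  obtain ⟨Z, hZ⟩ : ∃ Z : ℝ, Z = (2 + M / v) ^ (2 : ℝ) * Real.exp (2 * n * L) := ⟨_, rfl⟩
  obtain ⟨a, ha⟩ : ∃ a : ℝ≥0∞, a = ENNReal.ofReal (K₁ * 2 ^ n) *
    (2 + D * (2 ^ (1 / s - 1) * ENNReal.ofReal Z)) := ⟨_, rfl⟩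
  have hat : a ≠ ⊤ := by
    rw [ha]
    have h1 : (1 : ℝ) ≤ 1 / s := (one_le_div hs0).2 hs1.le
    refine ENNReal.mul_ne_top ENNReal.ofReal_ne_top (ENNReal.add_ne_top.2 ⟨by simp,
      ENNReal.mul_ne_top hDt (ENNReal.mul_ne_top
        (ENNReal.rpow_ne_top_of_nonneg (by linarith) (by simp)) ENNReal.ofReal_ne_top)⟩)
  refine ⟨max 1 a.toReal, le_max_left _ _, ?_⟩
  intro N ω₁ μ O p f u hO hσ hlog hp hpσ hμ0 hμ1 hf hg hu hF y ρ hρ hρ1 hρε hball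
  have haK : a ≤ ENNReal.ofReal (max 1 a.toReal) := by
    calc a = ENNReal.ofReal a.toReal := (ENNReal.ofReal_toReal hat).symm
      _ ≤ _ := ENNReal.ofReal_le_ofReal (le_max_right _ _)
  obtain ⟨r, hr⟩ : ∃ r, r = 2 * ρ := ⟨_, rfl⟩
  have hr0 : 0 < r := by rw [hr]; positivity
  obtain ⟨σ, hσd⟩ : ∃ σ, σ = ω₁ r := ⟨_, rfl⟩
  have hσ0 : 0 < σ := by rw [hσd]; exact hσ.pos r hr0
  rw [← hr] at hρ1 hρε hball
  rw [← hσd] at hρε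
  have hσ1 : σ ≤ 1 := hρε.trans (by rw [hε]; exact min_le_left _ _)
  have hσ2 : 1 + 2 * σ / γ₁ ≤ t * s := by
    have h1 : σ ≤ (t * s - 1) * γ₁ / 2 := hρε.trans (by rw [hε]; exact min_le_right _ _)
    have h2 : 2 * σ / γ₁ ≤ t * s - 1 := by rw [div_le_iff₀ hγ₁0]; linarith
    linarith
  have hpc : ContinuousOn p O := continuousOn_of_modulus hσ hpσ
  have hyO : y ∈ O := hball (Metric.mem_closedBall_self hr0.le)
  -- `p₁ ≤ p ≤ p₂` on the ball, with `p₂ - p₁ ≤ 2σ`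
  obtain ⟨p₁, hp₁⟩ : ∃ p₁, p₁ = max γ₁ (p y - σ) := ⟨_, rfl⟩
  obtain ⟨p₂, hp₂⟩ : ∃ p₂, p₂ = p y + σ := ⟨_, rfl⟩
  have hpy := hp y hyO
  have hp₁γ : γ₁ ≤ p₁ := by rw [hp₁]; exact le_max_left _ _
  have hp₁₂ : p₁ ≤ p₂ := by rw [hp₁, hp₂]; exact max_le (by linarith) (by linarith)
  have hp₂₁ : p₂ - p₁ ≤ 2 * σ := by
    have : p y - σ ≤ p₁ := by rw [hp₁]; exact le_max_right _ _
    rw [hp₂]; linarith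
  have hpx : ∀ x ∈ Metric.closedBall y r, p₁ ≤ p x ∧ p x ≤ p₂ := by
    intro x hx
    have hxO := hball hx
    have h1 : |p x - p y| ≤ σ := by
      rcases eq_or_ne x y with rfl | hxy
      · simpa using hσ0.le
      · refine (hpσ x hxO y hyO hxy).trans ?_
        rw [hσd]
        have hxr : ‖x - y‖ ≤ r := by rw [← dist_eq_norm]; exact hx
        exact hσ.mono (norm_pos_iff.2 (sub_ne_zero.2 hxy)) hr0 hxr
    rw [abs_le] at h1
    rw [hp₁, hp₂]
    exact ⟨max_le (hp x hxO).1 (by linarith [h1.1]), by linarith [h1.2]⟩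
  obtain ⟨q, hq⟩ : ∃ q, q = s * p₁ := ⟨_, rfl⟩
  have hq1 : 1 ≤ q := by
    rw [hq]; exact hsγ.trans (mul_le_mul_of_nonneg_left hp₁γ hs0.le)
  have hq0 : 0 < q := by linarith
  have hp₁0 : 0 < p₁ := by linarith
  obtain ⟨τ, hτ⟩ : ∃ τ, τ = p₂ / q := ⟨_, rfl⟩
  have hqτ : q * τ = p₂ := by rw [hτ, mul_div_cancel₀ _ hq0.ne']
  have hqp₁ : q ≤ p₁ := by rw [hq]; exact mul_le_of_le_one_left hp₁0.le hs1.le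
  have hτ1 : 1 ≤ τ := by rw [hτ, one_le_div hq0]; linarith
  have hτt : τ ≤ t := by
    rw [hτ, div_le_iff₀ hq0, hq, ← mul_assoc]
    calc p₂ ≤ p₁ + 2 * σ := by linarith
      _ ≤ p₁ + 2 * σ / γ₁ * p₁ := by
          have : 2 * σ / γ₁ * γ₁ ≤ 2 * σ / γ₁ * p₁ := by gcongr
          rw [div_mul_cancel₀ _ hγ₁0.ne'] at this
          linarith
      _ = (1 + 2 * σ / γ₁) * p₁ := by ring
      _ ≤ t * s * p₁ := by gcongr
  have hτn : ((n : ℝ) - 1) * τ ≤ n - 1 / 2 := by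
    rw [← htn]; gcongr
  -- the excess `e` of `τ` over `1 / s` produces the factor `Y ^ e` below, which stays bounded
  -- because of the logarithmic condition
  obtain ⟨e, he⟩ : ∃ e, e = (p₂ - p₁) / q := ⟨_, rfl⟩
  have he0 : 0 ≤ e := by rw [he]; exact div_nonneg (by linarith) hq0.le
  have he2 : e ≤ 2 * σ := by
    rw [he, div_le_iff₀ hq0]
    nlinarith
  have hτe : τ = 1 / s + e := by
    rw [hτ, he, hq]; field_simp; ring
  -- subtracting `P` makes the mean values of the lower order derivatives of `u` vanish
  have hB0 : volume (Metric.ball y r) ≠ 0 := (Metric.measure_ball_pos _ _ hr0).ne'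
  have hBt : volume (Metric.ball y r) ≠ ⊤ := measure_ball_lt_top.ne
  have hBO : Metric.ball y r ⊆ O := Metric.ball_subset_closedBall.trans hball
  obtain ⟨P, hP, hPm, hPmean⟩ := exists_polynomial_mean hB0 hBt Metric.isBounded_ball m
    (U := fun α => weakD O α u) (fun α hα =>
      ((hu.memSobolev.isWeakDeriv α hα.le).locInt_deriv.integrableOn_compact_subset hball
        (isCompact_closedBall y r)).mono_set Metric.ball_subset_closedBall)
  obtain ⟨T, hT⟩ : ∃ T : Sp n → ℝ≥0∞, T = fun x => ENNReal.ofReal ‖topJet O m u x‖ := ⟨_, rfl⟩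
  obtain ⟨W, hW⟩ : ∃ W : Sp n → ℝ≥0∞, W = fun x => ENNReal.ofReal (lowSize m ρ (diffJet O u P) x) :=
    ⟨_, rfl⟩
  obtain ⟨G, hG⟩ : ∃ G : Sp n → ℝ≥0∞, G = fun x => ENNReal.ofReal (‖topJet O m u x‖ ^ p x) :=
    ⟨_, rfl⟩
  have hGT : ∀ x ∈ O, G x = T x ^ p x := fun x hx => by
    rw [hG, hT]; dsimp only
    rw [ENNReal.ofReal_rpow_of_nonneg (norm_nonneg _) (by linarith [(hp x hx).1])]
  obtain ⟨A, hA⟩ : ∃ A, A = ⨍⁻ x in Metric.ball y r, G x ^ s ∂volume := ⟨_, rfl⟩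
  obtain ⟨Y, hY⟩ : ∃ Y, Y = 1 + A := ⟨_, rfl⟩
  have hBm : MeasurableSet (Metric.ball y r) := Metric.isOpen_ball.measurableSet
  have hcacc := hK₁ hO hpc (fun x hx => ⟨by linarith [(hp x hx).1], (hp x hx).2⟩) hμ0 hμ1 hf hg hu
    hP hPm y ρ hρ (by rw [← hr]; exact hball)
  rw [← hr] at hcacc
  have hpoinc := hD hO hu.memSobolev hP hPm hρ (by rw [← hr]; exact hball)
    (by rw [← hr]; exact hPmean) hq1 hτ1 hτn (by rw [hqτ, hp₂]; linarith)
  rw [← hr, hqτ] at hpoinc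
  have hTq : ⨍⁻ x in Metric.ball y r, ENNReal.ofReal ‖topJet O m u x‖ ^ q ∂volume ≤ Y := by
    rw [hY, hA, ← laverage_add_const hB0 hBt]
    refine laverage_mono_ae ?_
    filter_upwards [ae_restrict_mem hBm] with x hx
    rw [hGT x (hBO hx), ← ENNReal.rpow_mul, hT]
    refine rpow_le_one_add_rpow _ hq0.le ?_
    rw [hq, mul_comm]
    exact mul_le_mul_of_nonneg_right (hpx x (Metric.ball_subset_closedBall hx)).1 hs0.le
  have hYle : Y ≤ ENNReal.ofReal (2 + M / (r ^ n * v)) := by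
    have hvol : volume (Metric.ball y r) = ENNReal.ofReal (r ^ n * v) := by
      have := volume_ball_mul y (0 : Sp n) one_pos hr0
      rw [mul_one] at this
      rw [this, hvt, ENNReal.ofReal_mul (by positivity)]
    have h1 : A ≤ 1 + ⨍⁻ x in Metric.ball y r, G x ∂volume := by
      rw [hA, ← laverage_add_const hB0 hBt]
      refine laverage_mono_ae (Eventually.of_forall fun x => ?_)
      simpa using rpow_le_one_add_rpow (G x) hs0.le hs1.le
    have h2 : ⨍⁻ x in Metric.ball y r, G x ∂volume ≤ ENNReal.ofReal (M / (r ^ n * v)) := by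
      rw [setLAverage_eq, hvol, ENNReal.ofReal_div_of_pos (by positivity)]
      refine ENNReal.div_le_div_right (le_trans ?_ hF) _
      rw [hG]
      exact lintegral_mono_set hBO
    rw [ENNReal.ofReal_add (by norm_num) (by positivity), hY]
    calc 1 + A ≤ 1 + (1 + ENNReal.ofReal (M / (r ^ n * v))) := by
          gcongr; exact h1.trans (by gcongr)
      _ = _ := by rw [← add_assoc]; norm_num
  have hYe : Y ^ e ≤ ENNReal.ofReal Z := by
    calc Y ^ e ≤ ENNReal.ofReal (2 + M / (r ^ n * v)) ^ e := by gcongr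
      _ = ENNReal.ofReal ((2 + M / (r ^ n * v)) ^ e) :=
          ENNReal.ofReal_rpow_of_nonneg (by positivity) he0
      _ ≤ _ := by
        rw [hZ]
        exact ENNReal.ofReal_le_ofReal (rpow_le_of_log_condition hM hv0 hr0 hρ1 hσ1
          (by rw [hσd]; exact hlog r ⟨hr0, hρ1⟩) he0 he2)
  have hs1' : (1 : ℝ) ≤ 1 / s := (one_le_div hs0).2 hs1.le
  have hYs : Y ^ (1 / s) ≤ 2 ^ (1 / s - 1) * (A ^ (1 / s) + 1) := by
    rw [hY]
    refine (ENNReal.rpow_add_le_mul_rpow_add_rpow 1 A hs1').trans (le_of_eq ?_)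
    rw [ENNReal.one_rpow, add_comm]
  have hWle : ⨍⁻ x in Metric.ball y r, W x ^ p₂ ∂volume ≤
      D * (2 ^ (1 / s - 1) * ENNReal.ofReal Z) * (A ^ (1 / s) + 1) := by
    rw [hW]
    refine hpoinc.trans ?_
    calc _ ≤ D * Y ^ τ := by gcongr
      _ = D * (Y ^ (1 / s) * Y ^ e) := by
          rw [hτe, ENNReal.rpow_add_of_nonneg _ _ (by positivity) he0]
      _ ≤ D * (2 ^ (1 / s - 1) * (A ^ (1 / s) + 1) * ENNReal.ofReal Z) := by gcongr
      _ = _ := by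
          rw [mul_right_comm, ← mul_assoc]
  -- Caccioppoli's inequality in terms of mean values; `p ≤ p₂` is used for the lower order terms
  have hmean : ⨍⁻ x in Metric.ball y ρ, G x ∂volume ≤ ENNReal.ofReal (K₁ * 2 ^ n) *
      (2 + ⨍⁻ x in Metric.ball y r, W x ^ p₂ ∂volume) := by
    have hvol : volume (Metric.ball y r) =
        ENNReal.ofReal (2 ^ n) * volume (Metric.ball y ρ) := by
      rw [hr]; exact volume_ball_mul y y hρ (by norm_num)
    have hb0 : volume (Metric.ball y ρ) ≠ 0 := (Metric.measure_ball_pos _ _ hρ).ne'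
    have hbt : volume (Metric.ball y ρ) ≠ ⊤ := measure_ball_lt_top.ne
    have h1 : ∫⁻ x in Metric.closedBall y r,
        ENNReal.ofReal (lowSize m ρ (diffJet O u P) x ^ p x) ≤
        volume (Metric.ball y r) + ∫⁻ x in Metric.ball y r, W x ^ p₂ := by
      rw [← setLIntegral_congr (ball_ae_eq_closedBall y r)]
      calc _ ≤ ∫⁻ x in Metric.ball y r, (1 + W x ^ p₂) := by
            refine setLIntegral_mono' hBm fun x hx => ?_
            have hx' := Metric.ball_subset_closedBall hx
            have hpx0 : 0 ≤ p x := by linarith [(hp x (hball hx')).1]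
            rw [← ENNReal.ofReal_rpow_of_nonneg (lowSize_nonneg hρ _ x) hpx0, hW]
            exact rpow_le_one_add_rpow _ hpx0 (hpx x hx').2
        _ = _ := by
            rw [lintegral_add_left measurable_const, setLIntegral_const, one_mul]
    have h2 : ∫⁻ x in Metric.ball y ρ, G x ≤ ENNReal.ofReal K₁ *
        (2 * volume (Metric.ball y r) + ∫⁻ x in Metric.ball y r, W x ^ p₂) := by
      calc ∫⁻ x in Metric.ball y ρ, G x ≤ ∫⁻ x in Metric.closedBall y ρ, G x :=
            lintegral_mono_set Metric.ball_subset_closedBall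
        _ ≤ _ := by
            rw [hG]
            refine hcacc.trans ?_
            rw [← measure_congr (ball_ae_eq_closedBall y r), two_mul, add_assoc]
            gcongr
    have h3 : ∫⁻ x in Metric.ball y r, W x ^ p₂ =
        (⨍⁻ x in Metric.ball y r, W x ^ p₂ ∂volume) * volume (Metric.ball y r) := by
      rw [setLAverage_eq, ENNReal.div_mul_cancel hB0 hBt]
    rw [setLAverage_eq, ENNReal.div_le_iff hb0 hbt]
    refine h2.trans (le_of_eq ?_)
    rw [h3, ← add_mul, hvol, ENNReal.ofReal_mul hK₁0.le, mul_left_comm (2 + _),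
      mul_assoc, mul_assoc,
      mul_left_comm (ENNReal.ofReal (2 ^ n))]
  rw [← hr]
  have e1 : (⨍⁻ x in Metric.ball y r, ENNReal.ofReal (‖topJet O m u x‖ ^ p x) ^ s ∂volume) = A := by
    rw [hA, hG]
  have e2 : (⨍⁻ x in Metric.ball y ρ, ENNReal.ofReal (‖topJet O m u x‖ ^ p x) ∂volume) =
      ⨍⁻ x in Metric.ball y ρ, G x ∂volume := by rw [hG]
  rw [e1, e2]
  refine hmean.trans (le_trans ?_ (mul_le_mul' haK le_rfl))
  rw [ha, mul_assoc]
  gcongr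
  rw [add_mul]
  gcongr
  exact le_mul_of_one_le_right (zero_le) le_add_self

end ReverseHolder

/-! ### The conclusion -/

section Conclusion

variable {n : ℕ}

lemma le_of_closedBall_subset_ball [Nonempty (Fin n)] {x y : Sp n} {r R : ℝ} (hr : 0 ≤ r)
    (h : Metric.closedBall y r ⊆ Metric.ball x R) : r ≤ R := by
  obtain ⟨i⟩ := ‹Nonempty (Fin n)›
  obtain ⟨e, he⟩ : ∃ e : Sp n, ‖e‖ = 1 := ⟨EuclideanSpace.single i 1, by simp⟩
  have h1 : ∀ c : ℝ, |c| = r → dist (y + c • e) x < R := fun c hc => h (by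
    rw [Metric.mem_closedBall, dist_eq_norm, add_sub_cancel_left, norm_smul, he, mul_one,
      Real.norm_eq_abs, hc])
  have h2 := h1 r (abs_of_nonneg hr)
  have h3 := h1 (-r) (by rw [abs_neg, abs_of_nonneg hr])
  have h4 : dist (y + r • e) (y + (-r) • e) = 2 * r := by
    rw [dist_eq_norm, add_sub_add_left_eq_sub, ← sub_smul, norm_smul, he, mul_one,
      Real.norm_eq_abs, sub_neg_eq_add, abs_of_nonneg (by linarith)]
    ring
  linarith [dist_triangle_right (y + r • e) (y + (-r) • e) x]

/-- The passage from mean values in `[0, ∞]` to Bochner mean values in Gehring's conclusion. -/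
lemma integrableOn_and_average_le {F : Sp n → ℝ} (hF0 : ∀ x, 0 ≤ F x) {x₀ : Sp n} {R δ C : ℝ}
    [Nonempty (Fin n)] (hR : 0 < R) (hδ : 0 < δ) (hC : 0 < C)
    (hF : IntegrableOn F (Metric.ball x₀ R))
    (h : ∫⁻ y in Metric.ball x₀ (R / 2), ENNReal.ofReal (F y ^ (1 + δ)) ≤
        ENNReal.ofReal C * volume (Metric.ball x₀ R) *
          ((⨍⁻ y in Metric.ball x₀ R, ENNReal.ofReal (F y) ∂volume) + 1) ^ (1 + δ)) :
    IntegrableOn (fun x => F x ^ (1 + δ)) (Metric.ball x₀ (R / 2)) ∧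
      (⨍ x in Metric.ball x₀ (R / 2), F x ^ (1 + δ)) ^ (1 / (1 + δ)) ≤
        (C * 2 ^ n) ^ (1 / (1 + δ)) * ((⨍ x in Metric.ball x₀ R, F x) + 1) := by
  have hδ1 : 0 < 1 + δ := by linarith
  have hR2 : 0 < R / 2 := by linarith
  obtain ⟨a, ha⟩ : ∃ a, a = ⨍ x in Metric.ball x₀ R, F x := ⟨_, rfl⟩
  have ha0 : 0 ≤ a := by
    rw [ha, setAverage_eq]
    exact smul_nonneg (by positivity) (integral_nonneg hF0)
  have hla : ⨍⁻ y in Metric.ball x₀ R, ENNReal.ofReal (F y) ∂volume = ENNReal.ofReal a := by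
    rw [ha, ofReal_setAverage hF (Eventually.of_forall hF0), setLAverage_eq]
  have hm : AEStronglyMeasurable (fun x => F x ^ (1 + δ))
      (volume.restrict (Metric.ball x₀ (R / 2))) :=
    ((hF.mono_set (Metric.ball_subset_ball (by linarith))).aestronglyMeasurable.aemeasurable
      |>.pow_const _).aestronglyMeasurable
  have hvol : volume (Metric.ball x₀ R) =
      ENNReal.ofReal (2 ^ n) * volume (Metric.ball x₀ (R / 2)) := by
    rw [← volume_ball_mul x₀ x₀ hR2 two_pos, mul_div_cancel₀ _ two_ne_zero]
  have hV0 : volume (Metric.ball x₀ (R / 2)) ≠ 0 := (Metric.measure_ball_pos _ _ hR2).ne'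
  have hVt : volume (Metric.ball x₀ (R / 2)) ≠ ⊤ := measure_ball_lt_top.ne
  have hb : ∫⁻ y in Metric.ball x₀ (R / 2), ENNReal.ofReal (F y ^ (1 + δ)) ≤
      ENNReal.ofReal (C * 2 ^ n * (a + 1) ^ (1 + δ)) * volume (Metric.ball x₀ (R / 2)) := by
    refine h.trans (le_of_eq ?_)
    rw [hla, ← ENNReal.ofReal_one, ← ENNReal.ofReal_add ha0 zero_le_one,
      ENNReal.ofReal_rpow_of_pos (by linarith), hvol, ← mul_assoc, mul_right_comm,
      ← ENNReal.ofReal_mul hC.le, ← ENNReal.ofReal_mul (by positivity)]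
  have hint : IntegrableOn (fun x => F x ^ (1 + δ)) (Metric.ball x₀ (R / 2)) := by
    refine ⟨hm, ?_⟩
    rw [hasFiniteIntegral_iff_ofReal (Eventually.of_forall fun x => Real.rpow_nonneg (hF0 x) _)]
    exact hb.trans_lt (ENNReal.mul_lt_top ENNReal.ofReal_lt_top hVt.lt_top)
  refine ⟨hint, ?_⟩
  rw [← ha]
  have hav : (⨍ x in Metric.ball x₀ (R / 2), F x ^ (1 + δ)) ≤ C * 2 ^ n * (a + 1) ^ (1 + δ) := by
    rw [← ENNReal.ofReal_le_ofReal_iff (by positivity),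
      ofReal_setAverage hint (Eventually.of_forall fun x => Real.rpow_nonneg (hF0 x) _),
      ENNReal.div_le_iff hV0 hVt]
    exact hb
  calc _ ≤ (C * 2 ^ n * (a + 1) ^ (1 + δ)) ^ (1 / (1 + δ)) := by
        refine Real.rpow_le_rpow ?_ hav (by positivity)
        rw [setAverage_eq]
        exact smul_nonneg (by positivity) (integral_nonneg fun x => Real.rpow_nonneg (hF0 x) _)
    _ = _ := by
        rw [Real.mul_rpow (by positivity) (by positivity), ← Real.rpow_mul (by linarith),
          mul_one_div_cancel hδ1.ne', Real.rpow_one]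

end Conclusion

end HigherOrder

theorem lemma3p1 (n : ℕ) (hn : 2 ≤ n) (γ₁ : ℝ) (hγ₁ : 1 < γ₁) :
    ∃ R₀ : (ℝ → ℝ) → ℝ, (∀ ω₁, IsModulus ω₁ → 0 < R₀ ω₁) ∧
      ∀ (γ₂ L M : ℝ) (m : ℕ), γ₁ ≤ γ₂ → 1 ≤ L → 1 ≤ m →
        ∃ δ c : ℝ, 0 < δ ∧ 0 < c ∧
          ∀ (N : ℕ) (ω₁ : ℝ → ℝ) (μ : ℝ) (Ω O : Set (Sp n)) (p : Sp n → ℝ)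
            (f : Sp n → LowJet n N m → TopJet n N m → ℝ) (u : Sp n → Sp N),
            1 ≤ N →
            -- the domain, the exponent and its modulus of continuity
            IsOpen Ω → IsConnected Ω → Bornology.IsBounded Ω →
            IsModulus ω₁ →
            (∀ R ∈ Set.Ioc (0 : ℝ) 1, ω₁ R * Real.log (1 / R) ≤ L) →
            (∀ x ∈ Ω, γ₁ ≤ p x ∧ p x ≤ γ₂) →
            (∀ x ∈ Ω, ∀ y ∈ Ω, x ≠ y → |p x - p y| ≤ ω₁ ‖x - y‖) →
            -- the integrand and the minimizer
            IsOpen O → O ⊆ Ω →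
            0 < μ → μ ≤ 1 →
            IsCaratheodoryFun O f → HasGrowth O p μ L f → HasXContinuity O p ω₁ μ L f →
            IsLocalMinimizer O p f u →
            IntegrableOn (fun x => ‖topJet O m u x‖ ^ p x) O →
            ∫ x in O, ‖topJet O m u x‖ ^ p x ≤ M →
            ∀ (x₀ : Sp n) (R : ℝ), 0 < R → R ≤ R₀ ω₁ → Metric.closedBall x₀ R ⊆ O →
              IntegrableOn (fun x => ‖topJet O m u x‖ ^ (p x * (1 + δ)))
                (Metric.ball x₀ (R / 2)) ∧
              (⨍ x in Metric.ball x₀ (R / 2), ‖topJet O m u x‖ ^ (p x * (1 + δ))) ^ (1 / (1 + δ)) ≤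
                c * ((⨍ x in Metric.ball x₀ R, ‖topJet O m u x‖ ^ p x) + 1) := by
  have : Nonempty (Fin n) := ⟨⟨0, by omega⟩⟩
  obtain ⟨s, ε, hs0, hs1, hε, hRH⟩ := exists_reverse_holder hn hγ₁
  -- below the radius `R₀` the modulus of continuity is at most `ε`
  have hR₀ : ∀ ω₁ : ℝ → ℝ, ∃ r : ℝ, IsModulus ω₁ → 0 < r ∧ r ≤ 1 ∧ ω₁ r ≤ ε := by
    intro ω₁
    by_cases hω : IsModulus ω₁
    · have h1 : ∀ᶠ r in 𝓝[>] (0 : ℝ), ω₁ r < ε := hω.tendsto.eventually (gt_mem_nhds hε)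
      obtain ⟨r, hr, hr1⟩ := (h1.and (Ioo_mem_nhdsGT one_pos)).exists
      exact ⟨r, fun _ => ⟨hr1.1, hr1.2.le, hr.le⟩⟩
    · exact ⟨0, fun h => absurd h hω⟩
  choose R₀ hR₀ using hR₀
  refine ⟨R₀, fun ω₁ hω => (hR₀ ω₁ hω).1, ?_⟩
  intro γ₂ L M m hγ hL _
  -- for negative `M` the hypotheses are void, but constants are needed all the same
  obtain ⟨K, hK1, hK⟩ := hRH γ₂ L (max M 0) m hγ hL (le_max_right _ _)
  obtain ⟨δ, C, hδ, hC, hG⟩ := exists_gehring n hK1 hs0 hs1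
  refine ⟨δ, (C * 2 ^ n) ^ (1 / (1 + δ)), hδ, by positivity, ?_⟩
  intro N ω₁ μ Ω O p f u _ _ _ _ hω hlog hp hpω hO hOΩ hμ0 hμ1 hf hg _ hu hFi hFM x₀ R hR hRR₀ hball
  obtain ⟨-, hr1, hrε⟩ := hR₀ ω₁ hω
  obtain ⟨F, hF⟩ : ∃ F : Sp n → ℝ, F = fun x => ‖topJet O m u x‖ ^ p x := ⟨_, rfl⟩
  have hF0 : ∀ x, 0 ≤ F x := fun x => by rw [hF]; positivity
  have hFO : IntegrableOn F O := by rw [hF]; exact hFi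
  have hpow : (fun x => ‖topJet O m u x‖ ^ (p x * (1 + δ))) = fun x => F x ^ (1 + δ) := by
    funext x; rw [hF, Real.rpow_mul (norm_nonneg _)]
  have hBO : Metric.ball x₀ R ⊆ O := Metric.ball_subset_closedBall.trans hball
  have hFl : ∫⁻ x in O, ENNReal.ofReal (F x) ≤ ENNReal.ofReal (max M 0) := by
    rw [← ofReal_integral_eq_lintegral_ofReal hFO (Eventually.of_forall hF0), hF]
    exact ENNReal.ofReal_le_ofReal (hFM.trans (le_max_left _ _))
  have hrev := hK hO hω hlog (fun x hx => hp x (hOΩ hx))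
    (fun x hx y hy => hpω x (hOΩ hx) y (hOΩ hy)) hμ0 hμ1 hf hg hu (by rw [hF] at hFl; exact hFl)
  -- Gehring's lemma is stated for measurable functions; `F` is measurable only up to null sets
  obtain ⟨G, hGm, hG0, hGF⟩ : ∃ G : Sp n → ℝ, Measurable G ∧ (∀ x, 0 ≤ G x) ∧
      G =ᵐ[volume.restrict O] F := by
    refine ⟨fun x => |hFO.aestronglyMeasurable.mk F x|,
      hFO.aestronglyMeasurable.stronglyMeasurable_mk.measurable.abs, fun x => abs_nonneg _, ?_⟩
    filter_upwards [hFO.aestronglyMeasurable.ae_eq_mk] with x hx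
    rw [← hx, abs_of_nonneg (hF0 x)]
  have hGB : ∀ B ⊆ O, G =ᵐ[volume.restrict B] F := fun B hB =>
    ae_mono (Measure.restrict_mono hB le_rfl) hGF
  have hlin : ∀ (B : Set (Sp n)) (g : ℝ → ℝ≥0∞), B ⊆ O →
      ∫⁻ x in B, g (G x) = ∫⁻ x in B, g (F x) := fun B g hB =>
    lintegral_congr_ae ((hGB B hB).fun_comp g)
  have hfin : ∫⁻ x in Metric.ball x₀ R, ENNReal.ofReal (G x) ≠ ⊤ := by
    rw [hlin _ _ hBO]
    exact ((lintegral_mono_set hBO).trans_lt (hFl.trans_lt ENNReal.ofReal_lt_top)).ne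
  have hconc := hG x₀ R G hR hGm hG0 hfin (fun y ρ hρ hy => by
    have h2ρ : 2 * ρ ≤ R := le_of_closedBall_subset_ball (by positivity) hy
    have hyO : Metric.closedBall y (2 * ρ) ⊆ O := hy.trans hBO
    have hb : Metric.ball y (2 * ρ) ⊆ O := Metric.ball_subset_closedBall.trans hyO
    have hb' : Metric.ball y ρ ⊆ O := (Metric.ball_subset_ball (by linarith)).trans hb
    have hmono : ω₁ (2 * ρ) ≤ ε :=
      (hω.mono (mem_Ioi.2 (by linarith)) (mem_Ioi.2 (by linarith)) (h2ρ.trans hRR₀)).trans hrε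
    have := hrev y ρ hρ (by linarith) hmono hyO
    simp only [setLAverage_eq] at this ⊢
    rw [hlin _ _ hb', hlin _ (fun z => ENNReal.ofReal z ^ s) hb, hF]
    exact this)
  rw [setLAverage_eq, hlin _ _ hBO, ← setLAverage_eq, hlin _ (fun z => ENNReal.ofReal (z ^ (1 + δ)))
    ((Metric.ball_subset_ball (by linarith)).trans hBO)] at hconc
  have hfinal := integrableOn_and_average_le hF0 hR hδ hC (hFO.mono_set hBO) hconc
  rw [hpow]
  rw [hF] at hfinal ⊢
  exact hfinal
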